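/- **Setting.** Let $M$ be a compact oriented smooth four-manifold, possibly with boundary. Let $\mathcal V\to M$ be a smooth vector bundle whose fibre is Minkowski space $(V,\eta)$, $\eta$ of signature $(3,1)$, with structure group $SO(3,1)$. Let $\mathfrak g=\mathfrak{so}(3,1)$ and let $$\mathfrak d=\mathfrak g\oplus V\oplus\mathfrak g^*$$ be the Lie algebra whose bracket extends that of $\mathfrak g$, lets $\mathfrak g$ act on $V$ by the defining and on $\mathfrak g^*$ by the coadjoint representation, has $[v,w]=v\wedge w\in\mathfrak g^*$ for $v,w\in V$, where $(v\wedge w)(\chi)=\eta(\chi v,w)$, and satisfies $[V,\mathfrak g^*]=[\mathfrak g^*,\mathfrak g^*]=0$. Let $\beta\in\mathbb R$ and let $T:\mathfrak g\to\mathfrak g$ be a linear automorphism that commutes with the adjoint action of $\mathfrak g$. Write $\langle\cdot,\cdot\rangle$ for the natural pairing of $\mathfrak g$ and $\mathfrak g^*$, and put on $\mathfrak d$ the symmetric bilinear forms $$\langle (X,v,z),(Y,w,y)\rangle_{\mathfrak d}=\eta(v,w)+z(Y)+y(X),\qquad \langle (X,v,z),(Y,w,y)\rangle_{T}=\eta(v,w)+z(TY)+y(TX).$$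 We write $T$ and $(\mathrm{id}+\beta T)^{-1}$ also for the transposed maps on $\mathfrak g^*$, and use the same letters for the associated bundles. Products of forms are wedge products combined with the indicated bilinear maps. **Theories.** All fields are smooth. * *Quadratically extended General Relativity (qeGR)*: the fields are a connection $\mathbb A=(A,e,S)$ on the principal bundle with structure Lie algebra $\mathfrak d$ induced by the $SO(3,1)$-bundle of $\mathcal V$ (so $A$ is an $SO(3,1)$-connection, $e\in\Omega^1(M;\mathcal V)$, $S\in\Omega^1(M;\mathfrak g^*)$) and a form $\mathbb B=(c,\tau,B)\in\Omega^2(M;\mathfrak d)$ (so $c\in\Omega^2(M;\mathfrak g)$, $\tau\in\Omega^2(M;\mathcal V)$, $B\in\Omega^2(M;\mathfrak g^*)$), with $$S_{qeGR}=\int_M\langle\mathbb B,F_{\mathbb A}\rangle_{\mathfrak d}+\tfrac12\big(\langle\mathbb B,\mathbb B\rangle_{\mathfrak d}+\beta\langle\mathbb B,\mathbb B\rangle_T\big).$$ * *Quadratic generalised Holst theory (qgH)*: the fields are $e\in\Omega^1(M;\mathcal V)$, an $SO(3,1)$-connection $A$, and $\tau\in\Omega^2(M;\mathcal V)$, with $$S_{qgH}=\int_M\tfrac12\langle(\mathrm{id}+\beta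 T)^{-1}F_A,e\wedge e\rangle-\eta(\tau,d_Ae)-\tfrac{1+\beta}{2}\eta(\tau,\tau).$$ * *Generalised Holst theory (gH, for $\beta\ne-1$)*: the fields are $(e,A)$ as above, with $$S_{gH}=\tfrac12\int_M\langle(\mathrm{id}+\beta T)^{-1}F_A,e\wedge e\rangle+\tfrac1{1+\beta}\,\eta(d_Ae,d_Ae).$$ **Classical equivalence.** For a field theory with Lagrangian density $L$, let $\mathcal{EL}$ be the set of fields that solve the Euler–Lagrange equations, that is, at which the first variation of the action vanishes on all variations with compact support in the interior of a coordinate patch that trivialises $\mathcal V$. A map is *local* if in every such patch its value at $x$ depends smoothly on $x$ and on finitely many derivatives of the field at $x$. An *infinitesimal local symmetry* is a local vector field $X$ on the space of fields with $\mathcal L_XL=dY$ for some local functional $Y$ with values in three-forms. Let $\mathcal{EL}/\mathcal D$ be the quotient of $\mathcal{EL}$ by the equivalence relation generated by joining two solutions whenever they are the ends of a smooth path in $\mathcal{EL}$ whose velocity is at every time the value of an infinitesimal local symmetry. Two theories are *classically equivalent via* a pair of local maps $f,g$ between their spaces of fields, in opposite directions, if $f$ and $g$ map solutions to solutions and induce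 mutually inverse bijections of the quotients $\mathcal{EL}/\mathcal D$. **Proposition.** Assume that $(\beta,T)$ lies in the invertibility sector, $\beta T\neq-\mathrm{id}$. Then $\mathrm{id}+\beta T$ is invertible, and: 1. qeGR is classically equivalent to qgH, via the projection $(\mathbb A,\mathbb B)\mapsto(e,A,\tau)$ and the graph map $$F_1:(e,A,\tau)\longmapsto\big(e,A,\tau,\;B=-\tfrac12(\mathrm{id}+\beta T)^{-1}(e\wedge e),\;c=-(\mathrm{id}+\beta T)^{-1}F_A,\;S=0\big).$$ Moreover $F_1^*S_{qeGR}=-S_{qgH}$, and this holds for the Lagrangian densities (without boundary terms). 2. If in addition $\beta\neq-1$, then qgH is classically equivalent to gH, via the projection $(e,A,\tau)\mapsto(e,A)$ and the graph map $$F_2:(e,A)\longmapsto\big(e,A,\;\tau=-\tfrac1{1+\beta}\,d_Ae\big).$$ Moreover $F_2^*S_{qgH}=S_{gH}$, again for the Lagrangian densities. -/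

import Mathlib

open Set Filter Topology MeasureTheory
open scoped Manifold ContDiff

noncomputable section

/-! ### Minkowski space and the Lie algebra `so(3,1)` -/

/-- The model space of the (four-dimensional) space-time manifold. -/
abbrev E4 : Type := EuclideanSpace ℝ (Fin 4)

/-- The vector space underlying Minkowski space. -/
abbrev Mink : Type := Fin 4 → ℝ

/-- The Minkowski metric, of signature `(3,1)`, on `Mink`. -/
def eta : Mink →L[ℝ] Mink →L[ℝ] ℝ :=
  (LinearMap.mk₂ ℝ (fun v w : Mink => v 0 * w 0 + v 1 * w 1 + v 2 * w 2 - v 3 * w 3)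
    (fun a b c => by simp only [Pi.add_apply]; ring)
    (fun a b c => by simp only [Pi.smul_apply, smul_eq_mul]; ring)
    (fun a b c => by simp only [Pi.add_apply]; ring)
    (fun a b c => by simp only [Pi.smul_apply, smul_eq_mul]; ring)).toContinuousBilinearMap

/-- The group `SO(3,1)`: linear isometries of `eta` of determinant one. -/
def SO31 : Set (Mink →L[ℝ] Mink) :=
  {g | (∀ v w, eta (g v) (g w) = eta v w) ∧ LinearMap.det (g : Mink →ₗ[ℝ] Mink) = 1}

/-- The skew-symmetric endomorphisms of Minkowski space, as a space of operators. -/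
def so31Submodule : Submodule ℝ (Mink →L[ℝ] Mink) where
  carrier := {X | ∀ v w, eta (X v) w + eta v (X w) = 0}
  zero_mem' := by intro v w; simp
  add_mem' := by
    intro X Y hX hY v w
    simp only [add_apply, map_add]
    linear_combination hX v w + hY v w
  smul_mem' := by
    intro c X hX v w
    simp only [smul_apply, map_smul, smul_eq_mul]
    linear_combination c * hX v w

/-- The Lie algebra `𝔤 = so(3,1)` of skew-symmetric endomorphisms of Minkowski space. -/
def so31 : Type := so31Submodule

namespace so31

instance : NormedAddCommGroup so31 := inferInstanceAs (NormedAddCommGroup so31Submodule)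

instance : NormedSpace ℝ so31 := inferInstanceAs (NormedSpace ℝ so31Submodule)

instance : FiniteDimensional ℝ so31 := inferInstanceAs (FiniteDimensional ℝ so31Submodule)

/-- The underlying endomorphism of an element of `𝔤`; that is, the defining representation. -/
def toEnd : so31 →L[ℝ] Mink →L[ℝ] Mink := so31Submodule.subtypeL

theorem toEnd_injective : Function.Injective toEnd := Subtype.val_injective

theorem skew (X : so31) (v w : Mink) : eta (toEnd X v) w + eta v (toEnd X w) = 0 := X.2 v w

/-- The element of `𝔤` given by a skew-symmetric endomorphism. -/
def mk (X : Mink →L[ℝ] Mink) (hX : ∀ v w, eta (X v) w + eta v (X w) = 0) : so31 := ⟨X, hX⟩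

theorem toEnd_mk (X : Mink →L[ℝ] Mink) (hX : ∀ v w, eta (X v) w + eta v (X w) = 0) :
    toEnd (mk X hX) = X := rfl

/-- The commutator bracket of `so(3,1)`. -/
instance : Bracket so31 so31 where
  bracket X Y := mk (toEnd X * toEnd Y - toEnd Y * toEnd X) fun v w => by
    change eta (toEnd X (toEnd Y v) - toEnd Y (toEnd X v)) w
      + eta v (toEnd X (toEnd Y w) - toEnd Y (toEnd X w)) = 0
    simp only [map_sub, sub_apply]
    linear_combination skew X (toEnd Y v) w - skew Y (toEnd X v) w
      + skew X v (toEnd Y w) - skew Y v (toEnd X w)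

theorem toEnd_bracket (X Y : so31) : toEnd ⁅X, Y⁆ = toEnd X * toEnd Y - toEnd Y * toEnd X := rfl

instance : LieRing so31 where
  add_lie X Y Z := by
    apply toEnd_injective; simp only [toEnd_bracket, map_add]; noncomm_ring
  lie_add X Y Z := by
    apply toEnd_injective; simp only [toEnd_bracket, map_add]; noncomm_ring
  lie_self X := by
    apply toEnd_injective; simp only [toEnd_bracket, sub_self, map_zero]
  leibniz_lie X Y Z := by
    apply toEnd_injective
    simp only [toEnd_bracket, map_add, mul_sub, sub_mul, mul_assoc]
    abel

instance : LieAlgebra ℝ so31 where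
  lie_smul t X Y := by
    apply toEnd_injective
    simp only [toEnd_bracket, map_smul, mul_smul_comm, smul_mul_assoc, smul_sub]

end so31

/-! ### The trivial standard extension `𝔡 = 𝔤 ⊕ V ⊕ 𝔤*` of `𝔤 = so(3,1)` by `V = Mink` -/

/-- The dual `𝔤*` of `𝔤 = so(3,1)`. -/
abbrev so31Dual : Type := so31 →L[ℝ] ℝ

/-- The vector space `𝔡 = 𝔤 ⊕ V ⊕ 𝔤*`. -/
abbrev dAlg : Type := so31 × Mink × so31Dual

/-- The bracket of `𝔤` as a bilinear map. -/
def bracketG : so31 →L[ℝ] so31 →L[ℝ] so31 :=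
  (LinearMap.mk₂ ℝ (fun X Y : so31 => ⁅X, Y⁆) (fun a b c => add_lie a b c)
    (fun a b c => smul_lie a b c) (fun a b c => lie_add a b c)
    (fun a b c => lie_smul a b c)).toContinuousBilinearMap

/-- `v ∧ w` as an element of `𝔤* ≃ ⋀² V`: the functional `χ ↦ η(χ v, w)`. -/
def wedgeV : Mink →L[ℝ] Mink →L[ℝ] so31Dual :=
  (LinearMap.mk₂ ℝ (fun v w : Mink =>
      (LinearMap.toContinuousLinearMap
        { toFun := fun χ : so31 => eta (so31.toEnd χ v) w
          map_add' := fun a b => by simp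
          map_smul' := fun a b => by simp } : so31Dual))
    (fun a b c => by ext χ; simp) (fun a b c => by ext χ; simp)
    (fun a b c => by ext χ; simp) (fun a b c => by ext χ; simp)).toContinuousBilinearMap

theorem wedgeV_apply (v w : Mink) (χ : so31) : wedgeV v w χ = eta (so31.toEnd χ v) w := rfl

/-- The coadjoint representation of `𝔤` on `𝔤*`. -/
def coad : so31 →L[ℝ] so31Dual →L[ℝ] so31Dual :=
  (LinearMap.mk₂ ℝ (fun (X : so31) (z : so31Dual) => -(z ∘L bracketG X))
    (fun a b c => by ext χ; simp; ring) (fun a b c => by ext χ; simp)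
    (fun a b c => by ext χ; simp; ring) (fun a b c => by ext χ; simp)).toContinuousBilinearMap

theorem coad_apply (X : so31) (z : so31Dual) (Y : so31) : coad X z Y = -z ⁅X, Y⁆ := rfl

/-- The Lie bracket of `𝔡`. It extends the bracket of `𝔤`, acts on `V` by the defining
representation and on `𝔤*` by the coadjoint one, and `[v, w] = v ∧ w ∈ 𝔤*` on `V`. -/
def bracketD : dAlg →L[ℝ] dAlg →L[ℝ] dAlg :=
  (LinearMap.mk₂ ℝ (fun a b : dAlg =>
      ((bracketG a.1 b.1, so31.toEnd a.1 b.2.1 - so31.toEnd b.1 a.2.1,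
        coad a.1 b.2.2 - coad b.1 a.2.2 + wedgeV a.2.1 b.2.1) : dAlg))
    (fun a b c => by
      simp only [Prod.fst_add, Prod.snd_add, map_add, add_apply, Prod.mk_add_mk]
      refine Prod.ext rfl (Prod.ext ?_ ?_) <;> simp only <;> abel)
    (fun a b c => by
      simp only [Prod.smul_fst, Prod.smul_snd, map_smul, smul_apply,
        Prod.smul_mk, smul_sub, smul_add])
    (fun a b c => by
      simp only [Prod.fst_add, Prod.snd_add, map_add, add_apply, Prod.mk_add_mk]
      refine Prod.ext rfl (Prod.ext ?_ ?_) <;> simp only <;> abel)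
    (fun a b c => by
      simp only [Prod.smul_fst, Prod.smul_snd, map_smul, smul_apply,
        Prod.smul_mk, smul_sub, smul_add])).toContinuousBilinearMap

/-- The invariant inner product of `𝔡`: `η` on `V` plus the natural pairing of `𝔤` and `𝔤*`. -/
def pairD : dAlg →L[ℝ] dAlg →L[ℝ] ℝ :=
  (LinearMap.mk₂ ℝ (fun a b : dAlg => eta a.2.1 b.2.1 + a.2.2 b.1 + b.2.2 a.1)
    (fun a b c => by simp; ring) (fun a b c => by simp; ring)
    (fun a b c => by simp; ring) (fun a b c => by simp; ring)).toContinuousBilinearMap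

/-- The inner product of `𝔡` twisted by an endomorphism `T` of `𝔤`. -/
def pairTwisted (T : so31 →ₗ[ℝ] so31) : dAlg →L[ℝ] dAlg →L[ℝ] ℝ :=
  (LinearMap.mk₂ ℝ (fun a b : dAlg => eta a.2.1 b.2.1 + a.2.2 (T b.1) + b.2.2 (T a.1))
    (fun a b c => by simp; ring) (fun a b c => by simp; ring)
    (fun a b c => by simp; ring) (fun a b c => by simp; ring)).toContinuousBilinearMap

/-- The natural pairing `𝔤 × 𝔤* → ℝ`. -/
def pairG : so31 →L[ℝ] so31Dual →L[ℝ] ℝ := (ContinuousLinearMap.id ℝ so31Dual).flip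

/-- The endomorphism `id + β T` of `𝔤`. -/
def deform (T : so31 →ₗ[ℝ] so31) (β : ℝ) : Module.End ℝ so31 := LinearMap.id + β • T

/-- `(id + β T)⁻¹` on `𝔤` (meaningful if `id + β T` is invertible). -/
def deformInv (T : so31 →ₗ[ℝ] so31) (β : ℝ) : so31 →L[ℝ] so31 :=
  LinearMap.toContinuousLinearMap (Ring.inverse (deform T β))

/-- `(id + β T)⁻¹` on `𝔤*`. -/
def deformInvDual (T : so31 →ₗ[ℝ] so31) (β : ℝ) : so31Dual →L[ℝ] so31Dual :=
  (ContinuousLinearMap.compL ℝ so31 so31 ℝ).flip (deformInv T β)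

/-! ### Vector-valued forms on open pieces of the model space -/

section Forms

variable {W W' W₁ W₂ W₃ : Type*} [NormedAddCommGroup W] [NormedSpace ℝ W]
  [NormedAddCommGroup W'] [NormedSpace ℝ W']
  [NormedAddCommGroup W₁] [NormedSpace ℝ W₁] [NormedAddCommGroup W₂] [NormedSpace ℝ W₂]
  [NormedAddCommGroup W₃] [NormedSpace ℝ W₃]

/-- The wedge product of a `W₁`-valued `p`-form and a `W₂`-valued `q`-form, the values being
multiplied by the bilinear map `b`. -/
def wedge (b : W₁ →L[ℝ] W₂ →L[ℝ] W₃) {p q : ℕ}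
    (α : E4 [⋀^Fin p]→L[ℝ] W₁) (γ : E4 [⋀^Fin q]→L[ℝ] W₂) : E4 [⋀^Fin (p + q)]→L[ℝ] W₃ :=
  ((p.factorial * q.factorial : ℝ)⁻¹) •
    ContinuousMultilinearMap.alternatization
      ((((((ContinuousLinearMap.compContinuousMultilinearMapL ℝ (fun _ : Fin q => E4) W₂ W₃).flip
          γ.toContinuousMultilinearMap) ∘L b).compContinuousMultilinearMap
            α.toContinuousMultilinearMap).uncurrySum).domDomCongr finSumFinEquiv)

/-- The usual formula
`(α ∧ γ)(v) = 1/(p! q!) ∑_σ sgn(σ) b(α(v_{σ(1)}, …, v_{σ(p)}), γ(v_{σ(p+1)}, …, v_{σ(p+q)}))`. -/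
theorem wedge_apply (b : W₁ →L[ℝ] W₂ →L[ℝ] W₃) {p q : ℕ}
    (α : E4 [⋀^Fin p]→L[ℝ] W₁) (γ : E4 [⋀^Fin q]→L[ℝ] W₂) (v : Fin (p + q) → E4) :
    wedge b α γ v = ((p.factorial * q.factorial : ℝ)⁻¹) •
      ∑ σ : Equiv.Perm (Fin (p + q)), Equiv.Perm.sign σ •
        b (α fun i => v (σ (Fin.castAdd q i))) (γ fun j => v (σ (Fin.natAdd p j))) := by
  simp only [wedge, ContinuousAlternatingMap.smul_apply,
    ContinuousMultilinearMap.alternatization_apply_apply]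
  rfl

/-- The exterior covariant derivative `d_A σ = dω + A ∧ ω` on `s`, where `A` is a `W₁`-valued
one-form acting through the bilinear map `b`. -/
def covDeriv (b : W₁ →L[ℝ] W →L[ℝ] W) (s : Set E4) (A : E4 → E4 [⋀^Fin 1]→L[ℝ] W₁)
    (σ : E4 → E4 [⋀^Fin 1]→L[ℝ] W) (x : E4) : E4 [⋀^Fin 2]→L[ℝ] W :=
  extDerivWithin σ s x + wedge b (A x) (σ x)

/-- The curvature `F_A = dA + ½ [A ∧ A]` on `s`, where `b` is the Lie bracket. -/
def curvature (b : W →L[ℝ] W →L[ℝ] W) (s : Set E4) (A : E4 → E4 [⋀^Fin 1]→L[ℝ] W) (x : E4) :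
    E4 [⋀^Fin 2]→L[ℝ] W :=
  extDerivWithin A s x + (1 / 2 : ℝ) • wedge b (A x) (A x)

/-- The form obtained by applying a linear map to the values. -/
def mapVal (f : W →L[ℝ] W') {p : ℕ} (σ : E4 [⋀^Fin p]→L[ℝ] W) : E4 [⋀^Fin p]→L[ℝ] W' :=
  f.compContinuousAlternatingMap σ

/-- The `𝔤`-component of a `𝔡`-valued form. -/
def compG {p : ℕ} (σ : E4 [⋀^Fin p]→L[ℝ] dAlg) : E4 [⋀^Fin p]→L[ℝ] so31 :=
  mapVal (ContinuousLinearMap.fst ℝ so31 (Mink × so31Dual)) σ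

/-- The `V`-component of a `𝔡`-valued form. -/
def compV {p : ℕ} (σ : E4 [⋀^Fin p]→L[ℝ] dAlg) : E4 [⋀^Fin p]→L[ℝ] Mink :=
  mapVal (ContinuousLinearMap.fst ℝ Mink so31Dual ∘L
    ContinuousLinearMap.snd ℝ so31 (Mink × so31Dual)) σ

/-- The `𝔤*`-component of a `𝔡`-valued form. -/
def compGDual {p : ℕ} (σ : E4 [⋀^Fin p]→L[ℝ] dAlg) : E4 [⋀^Fin p]→L[ℝ] so31Dual :=
  mapVal (ContinuousLinearMap.snd ℝ Mink so31Dual ∘L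
    ContinuousLinearMap.snd ℝ so31 (Mink × so31Dual)) σ

/-- The standard frame of `E4`. -/
def frame (i : Fin 4) : E4 := EuclideanSpace.single i 1

end Forms

/-! ### Minkowski bundles and local representatives on manifolds -/

/-- All chart transitions of the given atlas preserve the orientation. -/
def IsOrientedAtlas {H : Type*} [TopologicalSpace H] (I : ModelWithCorners ℝ E4 H)
    (M : Type*) [TopologicalSpace M] [ChartedSpace H M] : Prop :=
  ∀ e ∈ atlas H M, ∀ e' ∈ atlas H M, ∀ p ∈ e.source ∩ e'.source,
    0 < (fderivWithin ℝ (e'.extend I ∘ (e.extend I).symm) (range I) (e.extend I p)).det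

/-- A smooth vector bundle over `M` with fibre Minkowski space and structure group `SO(3,1)`,
given by its local frames and coordinate changes. -/
structure MinkowskiBundle {H : Type*} [TopologicalSpace H] (I : ModelWithCorners ℝ E4 H)
    (M : Type*) [TopologicalSpace M] [ChartedSpace H M] (ι : Type*)
    extends VectorBundleCore ℝ M Mink ι where
  smooth : toVectorBundleCore.IsContMDiff I ∞
  mem_SO31 : ∀ i j, ∀ p ∈ baseSet i ∩ baseSet j, coordChange i j p ∈ SO31

/-- A local frame of the bundle together with a chart of the manifold. Global objects on `M` are
described by their representatives on all the patches. -/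
abbrev Patch (H : Type*) [TopologicalSpace H] (M : Type*) [TopologicalSpace M] [ChartedSpace H M]
    (ι : Type*) : Type _ := ι × atlas H M

/-- A family of local representatives: `u k x` is the value in the patch `k` at the point with
coordinates `x`. -/
abbrev Reps (H : Type*) [TopologicalSpace H] (M : Type*) [TopologicalSpace M]
    [ChartedSpace H M] (ι : Type*) (W : Type*) : Type _ := Patch H M ι → E4 → W

namespace MinkowskiBundle

variable {H : Type*} [TopologicalSpace H] {I : ModelWithCorners ℝ E4 H}
  {M : Type*} [TopologicalSpace M] [ChartedSpace H M] {ι : Type*}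
  (Z : MinkowskiBundle I M ι)
  {W : Type*} [NormedAddCommGroup W] [NormedSpace ℝ W]
  {W' : Type*} [NormedAddCommGroup W'] [NormedSpace ℝ W']

/-- The open subset of `M` covered by a patch. -/
def region (k : Patch H M ι) : Set M := k.2.1.source ∩ Z.baseSet k.1

/-- The point of `M` with coordinates `x` in the patch `k`. -/
def pt (_Z : MinkowskiBundle I M ι) (k : Patch H M ι) (x : E4) : M := (k.2.1.extend I).symm x

/-- The coordinate domain of a patch. -/
def dom (k : Patch H M ι) : Set E4 := (k.2.1.extend I).target ∩ Z.pt k ⁻¹' Z.baseSet k.1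

/-- The part of the coordinate domain of `k` that is also covered by `k'`. -/
def overlap (k k' : Patch H M ι) : Set E4 := Z.dom k ∩ Z.pt k ⁻¹' Z.region k'

/-- The change from the coordinates of `k` to those of `k'`. -/
def trans (k k' : Patch H M ι) (x : E4) : E4 := k'.2.1.extend I (Z.pt k x)

/-- The derivative of `trans`. -/
def jac (k k' : Patch H M ι) (x : E4) : E4 →L[ℝ] E4 := fderivWithin ℝ (Z.trans k k') (range I) x

/-- The change of frame: it maps components with respect to the frame of `k'` to components with
respect to the frame of `k`. -/
def glue (k k' : Patch H M ι) (x : E4) : Mink →L[ℝ] Mink := Z.coordChange k'.1 k.1 (Z.pt k x)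

/-- The derivative of `glue`. -/
def dglue (k k' : Patch H M ι) (x : E4) : E4 →L[ℝ] Mink →L[ℝ] Mink :=
  fderivWithin ℝ (Z.glue k k') (Z.dom k) x

/-- The representatives are smooth, and (to have no junk values) zero off the coordinate
domains. -/
def IsSmooth (u : Reps H M ι W) : Prop :=
  ∀ k, ContDiffOn ℝ ∞ (u k) (Z.dom k) ∧ ∀ x ∉ Z.dom k, u k x = 0

/-- Transformation law of real-valued forms. -/
def IsForm {p : ℕ} (σ : Reps H M ι (E4 [⋀^Fin p]→L[ℝ] ℝ)) : Prop :=
  ∀ k k', ∀ x ∈ Z.overlap k k', ∀ v,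
    σ k x v = σ k' (Z.trans k k' x) (fun i => Z.jac k k' x (v i))

/-- Transformation law of forms with values in the Minkowski bundle. -/
def IsFormV {p : ℕ} (σ : Reps H M ι (E4 [⋀^Fin p]→L[ℝ] Mink)) : Prop :=
  ∀ k k', ∀ x ∈ Z.overlap k k', ∀ v,
    σ k x v = Z.glue k k' x (σ k' (Z.trans k k' x) (fun i => Z.jac k k' x (v i)))

/-- Transformation law of forms with values in the adjoint bundle:
`σ_k = g σ_{k'} g⁻¹`, with `g` moved to the left-hand side. -/
def IsFormG {p : ℕ} (σ : Reps H M ι (E4 [⋀^Fin p]→L[ℝ] so31)) : Prop :=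
  ∀ k k', ∀ x ∈ Z.overlap k k', ∀ v,
    so31.toEnd (σ k x v) ∘L Z.glue k k' x =
      Z.glue k k' x ∘L so31.toEnd (σ k' (Z.trans k k' x) (fun i => Z.jac k k' x (v i)))

/-- Transformation law of forms with values in the coadjoint bundle:
`σ_k (g Y g⁻¹) = σ_{k'} Y` for `Y ∈ 𝔤`. -/
def IsFormGDual {p : ℕ} (σ : Reps H M ι (E4 [⋀^Fin p]→L[ℝ] so31Dual)) : Prop :=
  ∀ k k', ∀ x ∈ Z.overlap k k', ∀ v, ∀ X Y : so31,
    so31.toEnd X ∘L Z.glue k k' x = Z.glue k k' x ∘L so31.toEnd Y →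
      σ k x v X = σ k' (Z.trans k k' x) (fun i => Z.jac k k' x (v i)) Y

/-- Transformation law of connection forms of the `SO(3,1)`-bundle:
`A_k = g A_{k'} g⁻¹ - dg g⁻¹`, with `g` moved to the left-hand side. -/
def IsConnection (A : Reps H M ι (E4 [⋀^Fin 1]→L[ℝ] so31)) : Prop :=
  ∀ k k', ∀ x ∈ Z.overlap k k', ∀ v,
    so31.toEnd (A k x v) ∘L Z.glue k k' x =
      Z.glue k k' x ∘L so31.toEnd (A k' (Z.trans k k' x) (fun i => Z.jac k k' x (v i)))
        - Z.dglue k k' x (v 0)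

/-- Transformation law of forms with values in the bundle with fibre `𝔡` (adjoint bundle of the
principal `D`-bundle induced by the `SO(3,1)`-bundle). -/
def IsFormD {p : ℕ} (σ : Reps H M ι (E4 [⋀^Fin p]→L[ℝ] dAlg)) : Prop :=
  Z.IsFormG (fun k x => compG (σ k x)) ∧ Z.IsFormV (fun k x => compV (σ k x)) ∧
    Z.IsFormGDual (fun k x => compGDual (σ k x))

/-- Transformation law of connection forms of the principal `D`-bundle induced by the
`SO(3,1)`-bundle. -/
def IsConnectionD (σ : Reps H M ι (E4 [⋀^Fin 1]→L[ℝ] dAlg)) : Prop :=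
  Z.IsConnection (fun k x => compG (σ k x)) ∧ Z.IsFormV (fun k x => compV (σ k x)) ∧
    Z.IsFormGDual (fun k x => compGDual (σ k x))

/-- `P`, defined on the fields `u ∈ F`, is local: in every patch, `P u` at `x` is a smooth function
of `x` and of the derivatives of `u` at `x` up to some finite order. -/
def IsLocal (F : Set (Reps H M ι W)) (P : Reps H M ι W → Reps H M ι W') : Prop :=
  ∀ k, ∃ (N : ℕ) (G : E4 × ((j : Fin (N + 1)) → E4 [×(j : ℕ)]→L[ℝ] W) → W'),
    ContDiffOn ℝ ∞ G (Z.dom k ×ˢ univ) ∧ ∀ u ∈ F, ∀ x ∈ Z.dom k,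
      P u k x = G (x, fun j => iteratedFDerivWithin ℝ (j : ℕ) (u k) (Z.dom k) x)

end MinkowskiBundle

/-! ### Classical field theories, critical loci, symmetries and classical equivalence -/

/-- The data of a classical field theory on `M`: the fields (sections of an affine bundle, given by
local representatives with values in `W`), their infinitesimal variations, and the local
representatives of the Lagrangian density. -/
structure FieldTheory {H : Type*} [TopologicalSpace H] {I : ModelWithCorners ℝ E4 H}
    {M : Type*} [TopologicalSpace M] [ChartedSpace H M] {ι : Type*}
    (Z : MinkowskiBundle I M ι) (W : Type*) [NormedAddCommGroup W] [NormedSpace ℝ W] where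
  fields : Set (Reps H M ι W)
  variations : Set (Reps H M ι W)
  lagrangian : Reps H M ι W → Reps H M ι (E4 [⋀^Fin 4]→L[ℝ] ℝ)

namespace FieldTheory

variable {H : Type*} [TopologicalSpace H] {I : ModelWithCorners ℝ E4 H}
  {M : Type*} [TopologicalSpace M] [ChartedSpace H M] {ι : Type*}
  {Z : MinkowskiBundle I M ι}
  {W : Type*} [NormedAddCommGroup W] [NormedSpace ℝ W]
  {W' : Type*} [NormedAddCommGroup W'] [NormedSpace ℝ W']

/-- The action `∫_M L`, computed with a partition of unity subordinate to the patches. -/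
def action (𝒯 : FieldTheory Z W) (ρ : SmoothPartitionOfUnity (Patch H M ι) I M)
    (u : Reps H M ι W) : ℝ :=
  ∑ᶠ k, ∫ x in Z.dom k, ρ k (Z.pt k x) * 𝒯.lagrangian u k x frame

/-- The critical locus: the fields `u` with `∫ δL(u; χ) = 0` for every variation `χ` with compact
support in the interior of some patch, that is, the solutions of the Euler-Lagrange equations. -/
def criticalLocus (𝒯 : FieldTheory Z W) : Set (Reps H M ι W) :=
  {u | u ∈ 𝒯.fields ∧ ∀ k, ∀ χ ∈ 𝒯.variations,
    (∃ K : Set E4, IsCompact K ∧ K ⊆ interior (Z.dom k) ∧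
      ∀ k', ∀ y ∈ Z.dom k', Z.pt k' y ∉ Z.pt k '' K → χ k' y = 0) →
    ∫ x in Z.dom k, deriv (fun t : ℝ => 𝒯.lagrangian (u + t • χ) k x frame) 0 = 0}

/-- Infinitesimal local symmetries: local vector fields `V` on the space of fields such that
`ℒ_V L = d Y` for a local functional `Y` with values in three-forms on `M`. -/
def IsSymmetry (𝒯 : FieldTheory Z W) (V : Reps H M ι W → Reps H M ι W) : Prop :=
  (∀ u ∈ 𝒯.fields, V u ∈ 𝒯.variations) ∧ Z.IsLocal 𝒯.fields V ∧
    ∃ Y : Reps H M ι W → Reps H M ι (E4 [⋀^Fin 3]→L[ℝ] ℝ),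
      Z.IsLocal 𝒯.fields Y ∧
      ∀ u ∈ 𝒯.fields, Z.IsForm (Y u) ∧ ∀ k, ∀ x ∈ Z.dom k,
        HasDerivAt (fun t : ℝ => 𝒯.lagrangian (u + t • V u) k x)
          (extDerivWithin (Y u k) (Z.dom k) x) 0

/-- Two critical fields are joined by a smooth path in the critical locus whose velocity lies, at
every time, in the distribution spanned by the symmetries. -/
def Joined (𝒯 : FieldTheory Z W) (a b : 𝒯.criticalLocus) : Prop :=
  ∃ γ : ℝ → Reps H M ι W, γ 0 = a.1 ∧ γ 1 = b.1 ∧ (∀ s, γ s ∈ 𝒯.criticalLocus) ∧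
    (∀ k, ContDiffOn ℝ ∞ (fun q : ℝ × E4 => γ q.1 k q.2) (univ ×ˢ Z.dom k)) ∧
    ∀ s, ∃ V, 𝒯.IsSymmetry V ∧
      ∀ k, ∀ x ∈ Z.dom k, HasDerivAt (fun s' => γ s' k x) (V (γ s) k x) s

/-- The moduli space: the critical locus modulo symmetries (leaf space of the distribution). -/
def Moduli (𝒯 : FieldTheory Z W) : Type _ := Quot 𝒯.Joined

/-- The class of a critical field in the moduli space. -/
def cls (𝒯 : FieldTheory Z W) (a : 𝒯.criticalLocus) : 𝒯.Moduli := Quot.mk _ a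

/-- The local maps `f` and `g` between the spaces of fields realise a classical equivalence: they
preserve the critical loci and induce mutually inverse bijections of the moduli spaces. -/
structure IsClassicalEquivalence (𝒯 : FieldTheory Z W) (𝒯' : FieldTheory Z W')
    (f : Reps H M ι W → Reps H M ι W') (g : Reps H M ι W' → Reps H M ι W) : Prop where
  mapsTo_fields : MapsTo f 𝒯.fields 𝒯'.fields
  mapsTo_fields' : MapsTo g 𝒯'.fields 𝒯.fields
  isLocal : Z.IsLocal 𝒯.fields f
  isLocal' : Z.IsLocal 𝒯'.fields g
  mapsTo_critical : MapsTo f 𝒯.criticalLocus 𝒯'.criticalLocus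
  mapsTo_critical' : MapsTo g 𝒯'.criticalLocus 𝒯.criticalLocus
  moduli : ∃ Φ : 𝒯.Moduli ≃ 𝒯'.Moduli,
    (∀ a : 𝒯.criticalLocus, Φ (𝒯.cls a) = 𝒯'.cls ⟨f a.1, mapsTo_critical a.2⟩) ∧
    ∀ b : 𝒯'.criticalLocus, Φ.symm (𝒯'.cls b) = 𝒯.cls ⟨g b.1, mapsTo_critical' b.2⟩

end FieldTheory

/-! ### The three theories -/

/-- Values of the fields `(𝔸, 𝔹)` of quadratically extended General Relativity. -/
abbrev FibQeGR : Type := (E4 [⋀^Fin 1]→L[ℝ] dAlg) × (E4 [⋀^Fin 2]→L[ℝ] dAlg)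

/-- Values of the fields `(e, A, τ)` of quadratic generalised Holst theory. -/
abbrev FibQgH : Type :=
  (E4 [⋀^Fin 1]→L[ℝ] Mink) × (E4 [⋀^Fin 1]→L[ℝ] so31) × (E4 [⋀^Fin 2]→L[ℝ] Mink)

/-- Values of the fields `(e, A)` of generalised Holst theory. -/
abbrev FibGH : Type := (E4 [⋀^Fin 1]→L[ℝ] Mink) × (E4 [⋀^Fin 1]→L[ℝ] so31)

section Theories

variable {H : Type*} [TopologicalSpace H] {I : ModelWithCorners ℝ E4 H}
  {M : Type*} [TopologicalSpace M] [ChartedSpace H M] {ι : Type*}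
  (Z : MinkowskiBundle I M ι) (T : so31 →ₗ[ℝ] so31) (β : ℝ)

/-- Quadratically extended General Relativity, with Lagrangian density
`⟨𝔹, F_𝔸⟩ + ½ (⟨𝔹, 𝔹⟩ + β ⟨𝔹, 𝔹⟩_T)`. -/
def qeGR : FieldTheory Z FibQeGR where
  fields := {u | Z.IsSmooth u ∧
    Z.IsConnectionD (fun k x => (u k x).1) ∧ Z.IsFormD (fun k x => (u k x).2)}
  variations := {u | Z.IsSmooth u ∧
    Z.IsFormD (fun k x => (u k x).1) ∧ Z.IsFormD (fun k x => (u k x).2)}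
  lagrangian u k x :=
    wedge pairD (u k x).2 (curvature bracketD (Z.dom k) (fun y => (u k y).1) x) +
      (1 / 2 : ℝ) • (wedge pairD (u k x).2 (u k x).2 +
        β • wedge (pairTwisted T) (u k x).2 (u k x).2)

/-- Quadratic generalised Holst theory, with Lagrangian density
`½ ⟨(id + β T)⁻¹ F_A, e ∧ e⟩ - η(τ, d_A e) - ½ (1 + β) η(τ, τ)`. -/
def qgH : FieldTheory Z FibQgH where
  fields := {u | Z.IsSmooth u ∧ Z.IsFormV (fun k x => (u k x).1) ∧
    Z.IsConnection (fun k x => (u k x).2.1) ∧ Z.IsFormV (fun k x => (u k x).2.2)}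
  variations := {u | Z.IsSmooth u ∧ Z.IsFormV (fun k x => (u k x).1) ∧
    Z.IsFormG (fun k x => (u k x).2.1) ∧ Z.IsFormV (fun k x => (u k x).2.2)}
  lagrangian u k x :=
    (1 / 2 : ℝ) • wedge pairG
        (mapVal (deformInv T β) (curvature bracketG (Z.dom k) (fun y => (u k y).2.1) x))
        (wedge wedgeV (u k x).1 (u k x).1) -
      wedge eta (u k x).2.2
        (covDeriv so31.toEnd (Z.dom k) (fun y => (u k y).2.1) (fun y => (u k y).1) x) -
      ((1 + β) / 2) • wedge eta (u k x).2.2 (u k x).2.2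

/-- Generalised Holst theory, with Lagrangian density
`½ (⟨(id + β T)⁻¹ F_A, e ∧ e⟩ + (1 + β)⁻¹ η(d_A e, d_A e))`. -/
def gH : FieldTheory Z FibGH where
  fields := {u | Z.IsSmooth u ∧ Z.IsFormV (fun k x => (u k x).1) ∧
    Z.IsConnection (fun k x => (u k x).2)}
  variations := {u | Z.IsSmooth u ∧ Z.IsFormV (fun k x => (u k x).1) ∧
    Z.IsFormG (fun k x => (u k x).2)}
  lagrangian u k x :=
    (1 / 2 : ℝ) • (wedge pairG
        (mapVal (deformInv T β) (curvature bracketG (Z.dom k) (fun y => (u k y).2) x))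
        (wedge wedgeV (u k x).1 (u k x).1) +
      (1 / (1 + β)) • wedge eta
        (covDeriv so31.toEnd (Z.dom k) (fun y => (u k y).2) (fun y => (u k y).1) x)
        (covDeriv so31.toEnd (Z.dom k) (fun y => (u k y).2) (fun y => (u k y).1) x))

/-- The graph map `F₁ : (e, A, τ) ↦ (𝔸 = (A, e, S), 𝔹 = (c, τ, B))` with `S = 0`,
`c = -(id + β T)⁻¹ F_A` and `B = -½ (id + β T)⁻¹ (e ∧ e)`. -/
def graphMap₁ (u : Reps H M ι FibQgH) : Reps H M ι FibQeGR := fun k =>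
  (Z.dom k).indicator fun x =>
    ((u k x).2.1.prod ((u k x).1.prod 0),
      (-mapVal (deformInv T β) (curvature bracketG (Z.dom k) (fun y => (u k y).2.1) x)).prod
        ((u k x).2.2.prod
          (-((1 / 2 : ℝ) • mapVal (deformInvDual T β) (wedge wedgeV (u k x).1 (u k x).1)))))

/-- The projection `(𝔸, 𝔹) ↦ (e, A, τ)` that forgets `S`, `c` and `B`. -/
def forget₁ (u : Reps H M ι FibQeGR) : Reps H M ι FibQgH := fun k x =>
  (compV (u k x).1, compG (u k x).1, compV (u k x).2)

/-- The graph map `F₂ : (e, A) ↦ (e, A, τ)` with `τ = -(1 + β)⁻¹ d_A e`. -/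
def graphMap₂ (u : Reps H M ι FibGH) : Reps H M ι FibQgH := fun k =>
  (Z.dom k).indicator fun x =>
    ((u k x).1, (u k x).2,
      -((1 / (1 + β)) • covDeriv so31.toEnd (Z.dom k) (fun y => (u k y).2) (fun y => (u k y).1) x))

/-- The projection `(e, A, τ) ↦ (e, A)`. -/
def forget₂ (u : Reps H M ι FibQgH) : Reps H M ι FibGH := fun k x =>
  ((u k x).1, (u k x).2.1)

end Theories

end

/-!
The three theories are related by completing squares. Write `Q = (id + β T)⁻¹`. In the Lagrangian
of quadratically extended General Relativity the fields `c` and `B` enter algebraically, and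
`lagrangian_eq_completed_square` rewrites it as
`⟨(id + β T) R_c, R_B⟩ - ⟨Q F_A, d_A S⟩ - L_qgH`, with the residuals `R_c = c + Q F_A` and
`R_B = B + Q (d_A S + ½ e ∧ e)`. By the Bianchi identity, and because `Q` commutes with the adjoint
action, the middle term is the exact form `d ⟨Q F_A, S⟩` (`extDerivWithin_pairG_curvature`).
Hence `S` does not enter the remaining field equations: the solutions of qeGR are the solutions of
qgH, together with an arbitrary `S` and the values of `c` and `B` for which the residuals vanish.
Similarly `lagQgH_eq` writes `L_qgH` as `L_gH - ½ (1 + β) η(R_τ, R_τ)`, where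
`R_τ = τ + (1 + β)⁻¹ d_A e`, and `τ` is determined by `R_τ = 0`.

The passage from such an identity of Lagrangians to classical equivalence is the same in both cases,
and is carried out once, for the structure `FieldTheory.Reduction`. A term that is quadratic in the
residuals does not contribute to a first variation at a field with vanishing residuals, nor to the
variation along a vector field that preserves the residuals to first order. So solutions project to
solutions and the graph over a solution is a solution; symmetries of the large theory restrict to
the graph and descend, and symmetries of the small theory lift once the auxiliary fields are varied
so that the residuals stay constant to first order. A solution with parameter `S` is joined to the
one with parameter `0` by the path of solutions with parameters `t S`, whose velocity is a symmetry,
because the Lagrangian depends on `S` only through the residuals and an exact term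
(`FieldTheory.Reduction.joined_graph`). Therefore the projection and the graph over `S = 0` induce
inverse bijections of the quotients (`FieldTheory.Reduction.isClassicalEquivalence`).

That the residuals vanish on solutions is the fundamental lemma of the calculus of variations, with
test fields `φ w` for a bump function `φ` and a constant form `w`. For `c` and `B` the test fields
are wedge products of two Minkowski-valued one-forms of this kind, which suffice because a two-form
is determined by its products with decomposable constant forms (`two_form_eq_zero`).

Finally, `id + β T` is invertible because the commutant of the adjoint representation of `so(3,1)`
is `ℝ[⋆] ≅ ℂ`, a field (`AdEquivariant.injective`). Since `⋆` is given by the metric and the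
determinant, elements of the commutant also commute with the conjugation by `SO(3,1)`, which is not
connected (`AdEquivariant.conj`); this makes `Q F_A` and the graph maps independent of the patch.
-/

/-! ### The Lie algebra `so(3,1)` -/

theorem eta_apply (v w : Mink) : eta v w = v 0 * w 0 + v 1 * w 1 + v 2 * w 2 - v 3 * w 3 := rfl

theorem eta_comm (v w : Mink) : eta v w = eta w v := by
  simp only [eta_apply]; ring

/-- The standard basis of Minkowski space. -/
def mb (i : Fin 4) : Mink := Pi.single i 1

theorem mb_expand (v : Mink) : v = v 0 • mb 0 + v 1 • mb 1 + v 2 • mb 2 + v 3 • mb 3 := by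
  ext i; fin_cases i <;> simp [mb]

theorem eta_nondegenerate (v : Mink) (h : ∀ w, eta v w = 0) : v = 0 := by
  ext i
  have := h (mb i)
  fin_cases i <;> simpa [eta_apply, mb] using this

theorem eta_ext {v w : Mink} (h : ∀ u, eta v u = eta w u) : v = w :=
  sub_eq_zero.1 (eta_nondegenerate _ fun u => by simp [h u])

namespace so31

theorem ext_eta {X Y : so31} (h : ∀ v w, eta (toEnd X v) w = eta (toEnd Y v) w) : X = Y :=
  toEnd_injective (ContinuousLinearMap.ext fun v => eta_ext (h v))

theorem toEnd_lie_apply (X Y : so31) (v : Mink) :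
    toEnd ⁅X, Y⁆ v = toEnd X (toEnd Y v) - toEnd Y (toEnd X v) := rfl

theorem eta_toEnd_left (X : so31) (v w : Mink) : eta (toEnd X v) w = -eta v (toEnd X w) := by
  linear_combination skew X v w

end so31

open so31

/-- The skew-symmetric endomorphism `x ↦ η(v, x) w - η(w, x) v`. -/
noncomputable def wedgeG : Mink →L[ℝ] Mink →L[ℝ] so31 :=
  (LinearMap.mk₂ ℝ (fun v w : Mink =>
      so31.mk ((eta v).smulRight w - (eta w).smulRight v) (fun x y => by
        simp only [sub_apply, ContinuousLinearMap.smulRight_apply, map_sub, map_smul, smul_apply,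
          smul_eq_mul]
        rw [eta_comm x w, eta_comm x v]; ring))
    (fun a b c => toEnd_injective (by
      simp only [toEnd_mk, map_add]; ext; simp; ring))
    (fun a b c => toEnd_injective (by
      simp only [toEnd_mk, map_smul]; ext; simp; ring))
    (fun a b c => toEnd_injective (by
      simp only [toEnd_mk, map_add]; ext; simp; ring))
    (fun a b c => toEnd_injective (by
      simp only [toEnd_mk, map_smul]; ext; simp; ring))).toContinuousBilinearMap

theorem toEnd_wedgeG (v w x : Mink) : toEnd (wedgeG v w) x = eta v x • w - eta w x • v := rfl

theorem wedgeG_self (v : Mink) : wedgeG v v = 0 :=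
  toEnd_injective (by ext1 x; simp [toEnd_wedgeG])

theorem wedgeG_swap (v w : Mink) : wedgeG v w = -wedgeG w v :=
  toEnd_injective (by ext1 x; simp [toEnd_wedgeG])

theorem lie_wedgeG (X : so31) (v w : Mink) :
    ⁅X, wedgeG v w⁆ = wedgeG (toEnd X v) w + wedgeG v (toEnd X w) := by
  apply toEnd_injective
  ext1 x
  simp only [toEnd_lie_apply, map_add, toEnd_wedgeG, add_apply, map_sub, map_smul, eta_toEnd_left,
    neg_smul]
  abel

/-- Every element of `so(3,1)` is a sum of elementary bivectors. -/
theorem so31_eq_wedgeG (X : so31) : X = (1 / 2 : ℝ) • (wedgeG (mb 0) (toEnd X (mb 0)) +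
    wedgeG (mb 1) (toEnd X (mb 1)) + wedgeG (mb 2) (toEnd X (mb 2)) -
    wedgeG (mb 3) (toEnd X (mb 3))) := by
  refine ext_eta fun x y => ?_
  have h : ∀ z, eta (toEnd X x) z = x 0 * eta (toEnd X (mb 0)) z + x 1 * eta (toEnd X (mb 1)) z +
      x 2 * eta (toEnd X (mb 2)) z + x 3 * eta (toEnd X (mb 3)) z := by
    intro z
    conv_lhs => rw [mb_expand x]
    simp
  have h2 : eta (toEnd X x) y = y 0 * eta (toEnd X x) (mb 0) + y 1 * eta (toEnd X x) (mb 1) +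
      y 2 * eta (toEnd X x) (mb 2) + y 3 * eta (toEnd X x) (mb 3) := by
    conv_lhs => rw [mb_expand y]
    simp
  have h3 : ∀ i, eta (toEnd X x) (mb i) = -eta (toEnd X (mb i)) x := fun i => by
    rw [eta_toEnd_left, eta_comm]
  have h4 : ∀ (i) (z : Mink), eta (mb i) z = (if i = 3 then -z i else z i) := by
    intro i z; fin_cases i <;> simp [eta_apply, mb]
  simp only [map_smul, map_add, map_sub, smul_apply, add_apply, sub_apply, toEnd_wedgeG, h4,
    smul_eq_mul]
  simp only [Fin.reduceEq, if_true, if_false]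
  rw [h3, h3, h3, h3] at h2
  linear_combination (1 / 2 : ℝ) * h y + (1 / 2 : ℝ) * h2

theorem so31Dual_ext {z z' : so31Dual} (h : ∀ v w, z (wedgeG v w) = z' (wedgeG v w)) : z = z' := by
  ext X
  rw [so31_eq_wedgeG X]
  simp only [map_smul, map_add, map_sub, h]

/-! ### The commutant of the adjoint representation -/

section Commutant

/-- A linear endomorphism that commutes with the adjoint action. -/
def AdEquivariant (P : so31 →ₗ[ℝ] so31) : Prop := ∀ X Y : so31, P ⁅X, Y⁆ = ⁅X, P Y⁆

theorem eta_mb (i j : Fin 4) :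
    eta (mb i) (mb j) = if i = j then (if i = 3 then -1 else 1) else 0 := by
  fin_cases i <;> fin_cases j <;> simp [eta_apply, mb]

theorem lie_wedgeG_wedgeG (a b c d : Mink) : ⁅wedgeG a b, wedgeG c d⁆ =
    eta a c • wedgeG b d - eta b c • wedgeG a d + eta a d • wedgeG c b - eta b d • wedgeG c a := by
  rw [lie_wedgeG, toEnd_wedgeG, toEnd_wedgeG]
  simp only [map_sub, map_smul, sub_apply, smul_apply]
  abel

set_option linter.unusedSimpArgs false in
/-- The commutant of the adjoint representation of `so(3,1)` is spanned by the identity and the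
Hodge star, here in terms of the elementary bivectors of the standard basis. The bivectors `01` and
`23` span the centraliser of each of them, which gives the two coefficients; the other values
follow, since the remaining basis bivectors are brackets. -/
theorem AdEquivariant.exists_coeff {P : so31 →ₗ[ℝ] so31} (hP : AdEquivariant P) :
    ∃ a b : ℝ, P (wedgeG (mb 0) (mb 1)) = a • wedgeG (mb 0) (mb 1) + b • wedgeG (mb 2) (mb 3) ∧
      P (wedgeG (mb 0) (mb 2)) = a • wedgeG (mb 0) (mb 2) - b • wedgeG (mb 1) (mb 3) ∧
      P (wedgeG (mb 1) (mb 2)) = a • wedgeG (mb 1) (mb 2) + b • wedgeG (mb 0) (mb 3) ∧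
      P (wedgeG (mb 0) (mb 3)) = a • wedgeG (mb 0) (mb 3) - b • wedgeG (mb 1) (mb 2) ∧
      P (wedgeG (mb 1) (mb 3)) = a • wedgeG (mb 1) (mb 3) + b • wedgeG (mb 0) (mb 2) ∧
      P (wedgeG (mb 2) (mb 3)) = a • wedgeG (mb 2) (mb 3) - b • wedgeG (mb 0) (mb 1) := by
  have key : ∃ a b : ℝ,
      P (wedgeG (mb 0) (mb 1)) = a • wedgeG (mb 0) (mb 1) + b • wedgeG (mb 2) (mb 3) := by
    set f := P (wedgeG (mb 0) (mb 1)) with hf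
    have h1 : ⁅wedgeG (mb 0) (mb 1), f⁆ = 0 := by rw [hf, ← hP]; simp
    have h2 : ⁅wedgeG (mb 2) (mb 3), f⁆ = 0 := by
      rw [hf, ← hP, lie_wedgeG_wedgeG]; simp [eta_mb]
    -- the entries of `f` that mix the planes `01` and `23` vanish
    have e1 : ∀ i j, eta (toEnd ⁅wedgeG (mb 0) (mb 1), f⁆ (mb i)) (mb j) = 0 := by simp [h1]
    have e2 : ∀ i j, eta (toEnd ⁅wedgeG (mb 2) (mb 3), f⁆ (mb i)) (mb j) = 0 := by simp [h2]
    have sk : ∀ i j, eta (toEnd f (mb i)) (mb j) = - eta (toEnd f (mb j)) (mb i) := fun i j => by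
      rw [eta_toEnd_left, eta_comm]
    simp only [toEnd_lie_apply, toEnd_wedgeG, map_sub, map_smul, sub_apply, smul_apply,
      smul_eq_mul, eta_mb] at e1 e2
    refine ⟨-eta (toEnd f (mb 1)) (mb 0), eta (toEnd f (mb 3)) (mb 2), ?_⟩
    have ex : ∀ v : Mink, v = eta v (mb 0) • mb 0 + eta v (mb 1) • mb 1 + eta v (mb 2) • mb 2 +
        (-eta v (mb 3)) • mb 3 := fun v => by
      conv_lhs => rw [mb_expand v]
      simp [eta_apply, mb]
    have f02 : eta (toEnd f (mb 0)) (mb 2) = 0 := by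
      have := e1 1 2; have h' := sk 0 2; simp [eta_comm _ (toEnd f _)] at this; linarith
    have f03 : eta (toEnd f (mb 0)) (mb 3) = 0 := by
      have := e1 1 3; have h' := sk 0 3; simp [eta_comm _ (toEnd f _)] at this; linarith
    have f12 : eta (toEnd f (mb 1)) (mb 2) = 0 := by
      have := e1 0 2; have h' := sk 1 2; simp [eta_comm _ (toEnd f _)] at this; linarith
    have f13 : eta (toEnd f (mb 1)) (mb 3) = 0 := by
      have := e1 0 3; have h' := sk 1 3; simp [eta_comm _ (toEnd f _)] at this; linarith
    have f00 : ∀ i, eta (toEnd f (mb i)) (mb i) = 0 := fun i => by linarith [sk i i]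
    conv_lhs => rw [so31_eq_wedgeG f]
    conv_lhs => rw [ex (toEnd f (mb 0)), ex (toEnd f (mb 1)), ex (toEnd f (mb 2)),
      ex (toEnd f (mb 3)), f02, f03, f12, f13, f00, f00, f00, f00, sk 2 0, sk 2 1, sk 3 0,
      sk 3 1, f02, f03, f12, f13, sk 0 1, sk 2 3]
    simp only [map_add, map_smul, wedgeG_swap (mb 1) (mb 0), wedgeG_swap (mb 3) (mb 2)]
    module
  have s10 := wedgeG_swap (mb 1) (mb 0)
  have s20 := wedgeG_swap (mb 2) (mb 0)
  have s21 := wedgeG_swap (mb 2) (mb 1)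
  have s30 := wedgeG_swap (mb 3) (mb 0)
  have s31 := wedgeG_swap (mb 3) (mb 1)
  have s32 := wedgeG_swap (mb 3) (mb 2)
  obtain ⟨a, b, h01⟩ := key
  have h02 : P (wedgeG (mb 0) (mb 2)) = a • wedgeG (mb 0) (mb 2) - b • wedgeG (mb 1) (mb 3) := by
    have h : wedgeG (mb 0) (mb 2) = ⁅wedgeG (mb 1) (mb 2), wedgeG (mb 0) (mb 1)⁆ := by
      simp [lie_wedgeG_wedgeG, eta_mb, s10, s20, s21, s30, s31, s32, sub_eq_add_neg]
    rw [h, hP, h01]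
    simp [lie_wedgeG_wedgeG, eta_mb, s10, s20, s21, s30, s31, s32, sub_eq_add_neg]
  have h12 : P (wedgeG (mb 1) (mb 2)) = a • wedgeG (mb 1) (mb 2) + b • wedgeG (mb 0) (mb 3) := by
    have h : wedgeG (mb 1) (mb 2) = ⁅wedgeG (mb 2) (mb 0), wedgeG (mb 0) (mb 1)⁆ := by
      simp [lie_wedgeG_wedgeG, eta_mb, s10, s20, s21, s30, s31, s32, sub_eq_add_neg]
    rw [h, hP, h01]
    simp [lie_wedgeG_wedgeG, eta_mb, s10, s20, s21, s30, s31, s32, sub_eq_add_neg]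
  have h03 : P (wedgeG (mb 0) (mb 3)) = a • wedgeG (mb 0) (mb 3) - b • wedgeG (mb 1) (mb 2) := by
    have h : wedgeG (mb 0) (mb 3) = ⁅wedgeG (mb 1) (mb 3), wedgeG (mb 0) (mb 1)⁆ := by
      simp [lie_wedgeG_wedgeG, eta_mb, s10, s20, s21, s30, s31, s32, sub_eq_add_neg]
    rw [h, hP, h01]
    simp [lie_wedgeG_wedgeG, eta_mb, s10, s20, s21, s30, s31, s32, sub_eq_add_neg]
  have h13 : P (wedgeG (mb 1) (mb 3)) = a • wedgeG (mb 1) (mb 3) + b • wedgeG (mb 0) (mb 2) := by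
    have h : wedgeG (mb 1) (mb 3) = ⁅wedgeG (mb 3) (mb 0), wedgeG (mb 0) (mb 1)⁆ := by
      simp [lie_wedgeG_wedgeG, eta_mb, s10, s20, s21, s30, s31, s32, sub_eq_add_neg]
    rw [h, hP, h01]
    simp [lie_wedgeG_wedgeG, eta_mb, s10, s20, s21, s30, s31, s32, sub_eq_add_neg]
  have h23 : P (wedgeG (mb 2) (mb 3)) = a • wedgeG (mb 2) (mb 3) - b • wedgeG (mb 0) (mb 1) := by
    have h : wedgeG (mb 2) (mb 3) = ⁅wedgeG (mb 1) (mb 2), wedgeG (mb 1) (mb 3)⁆ := by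
      simp [lie_wedgeG_wedgeG, eta_mb, s10, s20, s21, s30, s31, s32, sub_eq_add_neg]
    rw [h, hP, h13]
    simp [lie_wedgeG_wedgeG, eta_mb, s10, s20, s21, s30, s31, s32, sub_eq_add_neg]
  exact ⟨a, b, h01, h02, h12, h03, h13, h23⟩

/-- An equivariant endomorphism that is not zero is injective, since its coefficients satisfy
`a² + b² ≠ 0`. -/
theorem AdEquivariant.injective {P : so31 →ₗ[ℝ] so31} (hP : AdEquivariant P) (h0 : P ≠ 0) :
    Function.Injective P := by
  obtain ⟨a, b, h01, h02, h12, h03, h13, h23⟩ := hP.exists_coeff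
  -- `P` is a root of `X² - 2 a X + (a² + b²)`, by inspection of the six basis bivectors
  have hPP : ∀ X, P (P X) = (2 * a) • P X - (a ^ 2 + b ^ 2) • X := by
    have hb : ∀ i j, P (P (wedgeG (mb i) (mb j))) = (2 * a) • P (wedgeG (mb i) (mb j)) -
        (a ^ 2 + b ^ 2) • wedgeG (mb i) (mb j) := by
      have hs : ∀ i j, P (P (wedgeG (mb i) (mb j))) = (2 * a) • P (wedgeG (mb i) (mb j)) -
          (a ^ 2 + b ^ 2) • wedgeG (mb i) (mb j) → P (P (wedgeG (mb j) (mb i))) =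
            (2 * a) • P (wedgeG (mb j) (mb i)) - (a ^ 2 + b ^ 2) • wedgeG (mb j) (mb i) := by
        intro i j h
        rw [wedgeG_swap (mb j) (mb i), map_neg, map_neg, h]
        module
      have g01 : P (P (wedgeG (mb 0) (mb 1))) = (2 * a) • P (wedgeG (mb 0) (mb 1)) -
          (a ^ 2 + b ^ 2) • wedgeG (mb 0) (mb 1) := by
        simp only [h01, map_add, map_smul, h23]; module
      have g02 : P (P (wedgeG (mb 0) (mb 2))) = (2 * a) • P (wedgeG (mb 0) (mb 2)) -
          (a ^ 2 + b ^ 2) • wedgeG (mb 0) (mb 2) := by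
        simp only [h02, map_sub, map_smul, h13]; module
      have g12 : P (P (wedgeG (mb 1) (mb 2))) = (2 * a) • P (wedgeG (mb 1) (mb 2)) -
          (a ^ 2 + b ^ 2) • wedgeG (mb 1) (mb 2) := by
        simp only [h12, map_add, map_smul, h03]; module
      have g03 : P (P (wedgeG (mb 0) (mb 3))) = (2 * a) • P (wedgeG (mb 0) (mb 3)) -
          (a ^ 2 + b ^ 2) • wedgeG (mb 0) (mb 3) := by
        simp only [h03, map_sub, map_smul, h12]; module
      have g13 : P (P (wedgeG (mb 1) (mb 3))) = (2 * a) • P (wedgeG (mb 1) (mb 3)) -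
          (a ^ 2 + b ^ 2) • wedgeG (mb 1) (mb 3) := by
        simp only [h13, map_add, map_smul, h02]; module
      have g23 : P (P (wedgeG (mb 2) (mb 3))) = (2 * a) • P (wedgeG (mb 2) (mb 3)) -
          (a ^ 2 + b ^ 2) • wedgeG (mb 2) (mb 3) := by
        simp only [h23, map_sub, map_smul, h01]; module
      intro i j
      fin_cases i <;> fin_cases j <;>
        first
        | exact g01 | exact g02 | exact g12 | exact g03 | exact g13 | exact g23
        | exact hs _ _ g01 | exact hs _ _ g02 | exact hs _ _ g12 | exact hs _ _ g03
        | exact hs _ _ g13 | exact hs _ _ g23 | simp [wedgeG_self]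
    have hv : ∀ i (v : Mink), P (P (wedgeG (mb i) v)) = (2 * a) • P (wedgeG (mb i) v) -
        (a ^ 2 + b ^ 2) • wedgeG (mb i) v := by
      intro i v
      rw [mb_expand v]
      simp only [map_add, map_smul, hb]
      module
    intro X
    rw [so31_eq_wedgeG X]
    simp only [map_add, map_sub, map_smul, hv]
    module
  have hab : a ^ 2 + b ^ 2 ≠ 0 := by
    intro hab
    obtain ⟨ha, hb⟩ := (add_eq_zero_iff_of_nonneg (sq_nonneg a) (sq_nonneg b)).1 hab
    rw [sq_eq_zero_iff] at ha hb
    subst ha hb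
    apply h0
    have hb : ∀ i j, P (wedgeG (mb i) (mb j)) = 0 := by
      have hs : ∀ i j, P (wedgeG (mb i) (mb j)) = 0 → P (wedgeG (mb j) (mb i)) = 0 := by
        intro i j h
        rw [wedgeG_swap, map_neg, h, neg_zero]
      simp only [zero_smul, add_zero, sub_zero] at h01 h02 h12 h03 h13 h23
      intro i j
      fin_cases i <;> fin_cases j <;>
        first
        | exact h01 | exact h02 | exact h12 | exact h03 | exact h13 | exact h23
        | exact hs _ _ h01 | exact hs _ _ h02 | exact hs _ _ h12 | exact hs _ _ h03
        | exact hs _ _ h13 | exact hs _ _ h23 | simp [wedgeG_self]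
    have hv : ∀ i (v : Mink), P (wedgeG (mb i) v) = 0 := fun i v => by
      rw [mb_expand v]; simp [hb]
    ext1 X
    rw [so31_eq_wedgeG X]
    simp [hv]
  rw [injective_iff_map_eq_zero]
  intro X hX
  have := hPP X
  rw [hX, map_zero, smul_zero, zero_sub, eq_comm, neg_eq_zero, smul_eq_zero] at this
  exact this.resolve_left hab

/-- Equivariant endomorphisms in invariant terms: as bilinear forms they combine the metric on
bivectors and the volume form. -/
theorem AdEquivariant.exists_det {P : so31 →ₗ[ℝ] so31} (hP : AdEquivariant P) :
    ∃ a b : ℝ, ∀ v w x y, eta (toEnd (P (wedgeG v w)) x) y =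
      a * (eta v x * eta w y - eta w x * eta v y) + b * Matrix.det (Matrix.of ![v, w, x, y]) := by
  obtain ⟨a, b, h01, h02, h12, h03, h13, h23⟩ := hP.exists_coeff
  refine ⟨a, -b, fun v w x y => ?_⟩
  have hvw : wedgeG v w = (v 0 * w 1 - v 1 * w 0) • wedgeG (mb 0) (mb 1) +
      (v 0 * w 2 - v 2 * w 0) • wedgeG (mb 0) (mb 2) +
      (v 1 * w 2 - v 2 * w 1) • wedgeG (mb 1) (mb 2) +
      (v 0 * w 3 - v 3 * w 0) • wedgeG (mb 0) (mb 3) +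
      (v 1 * w 3 - v 3 * w 1) • wedgeG (mb 1) (mb 3) +
      (v 2 * w 3 - v 3 * w 2) • wedgeG (mb 2) (mb 3) := by
    conv_lhs => rw [mb_expand v, mb_expand w]
    simp only [map_add, map_smul, add_apply, smul_apply, wedgeG_self,
      wedgeG_swap (mb 1) (mb 0), wedgeG_swap (mb 2) (mb 0), wedgeG_swap (mb 2) (mb 1),
      wedgeG_swap (mb 3) (mb 0), wedgeG_swap (mb 3) (mb 1), wedgeG_swap (mb 3) (mb 2)]
    module
  have hm : ∀ i (z : Mink), eta (mb i) z = (if i = 3 then -z i else z i) := by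
    intro i z; fin_cases i <;> simp [eta_apply, mb]
  rw [hvw]
  simp only [map_add, map_smul, map_sub, add_apply, smul_apply, sub_apply, h01, h02, h12, h03, h13,
    h23, toEnd_wedgeG, hm, smul_eq_mul]
  simp only [Fin.reduceEq, if_true, if_false, Matrix.det_succ_row_zero, Matrix.det_fin_zero,
    Fin.sum_univ_succ, Finset.univ_unique, Finset.sum_singleton, eta_apply, Matrix.of_apply,
    Matrix.submatrix_apply]
  simp [Fin.succAbove]
  ring

/-- An endomorphism that commutes with the adjoint action of the Lie algebra also commutes with the
conjugation by any element of `SO(3,1)`, although this group is not connected. -/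
theorem AdEquivariant.conj {P : so31 →ₗ[ℝ] so31} (hP : AdEquivariant P) {g : Mink →L[ℝ] Mink}
    (hg : g ∈ SO31) {X Y : so31} (h : toEnd X ∘L g = g ∘L toEnd Y) :
    toEnd (P X) ∘L g = g ∘L toEnd (P Y) := by
  obtain ⟨a, b, hab⟩ := hP.exists_det
  have hgi : Function.Injective g := by
    rw [injective_iff_map_eq_zero]
    intro v hv
    refine eta_nondegenerate v fun w => ?_
    rw [← hg.1, hv, map_zero, zero_apply]
  have hgs : Function.Surjective g :=
    (LinearMap.injective_iff_surjective (f := (g : Mink →ₗ[ℝ] Mink))).1 hgi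
  have hdet : ∀ v w x y, Matrix.det (Matrix.of ![g v, g w, g x, g y]) =
      Matrix.det (Matrix.of ![v, w, x, y]) := by
    intro v w x y
    have := (Pi.basisFun ℝ (Fin 4)).det_comp (g : Mink →ₗ[ℝ] Mink) ![v, w, x, y]
    rw [hg.2, one_mul, Pi.basisFun_det_apply, Pi.basisFun_det_apply] at this
    have e : Matrix.of ![g v, g w, g x, g y] = Matrix.of (g ∘ ![v, w, x, y]) := by
      ext i j
      fin_cases i <;> rfl
    rw [e]
    exact this
  have hw : ∀ v w x y, eta (toEnd (P (wedgeG (g v) (g w))) (g x)) (g y) =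
      eta (toEnd (P (wedgeG v w)) x) y := by
    intro v w x y
    rw [hab, hab, hdet]
    simp only [hg.1]
  have hX : X = (1 / 2 : ℝ) • (wedgeG (g (mb 0)) (g (toEnd Y (mb 0))) +
      wedgeG (g (mb 1)) (g (toEnd Y (mb 1))) + wedgeG (g (mb 2)) (g (toEnd Y (mb 2))) -
      wedgeG (g (mb 3)) (g (toEnd Y (mb 3)))) := by
    apply toEnd_injective
    ext1 z
    obtain ⟨z, rfl⟩ := hgs z
    have h1 := DFunLike.congr_fun h z
    simp only [ContinuousLinearMap.comp_apply] at h1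
    rw [h1]
    conv_lhs => rw [so31_eq_wedgeG Y]
    simp only [map_smul, map_add, map_sub, smul_apply, add_apply, sub_apply, toEnd_wedgeG, hg.1]
  ext1 x
  refine eta_ext fun y => ?_
  obtain ⟨y, rfl⟩ := hgs y
  simp only [ContinuousLinearMap.comp_apply]
  rw [hg.1, hX]
  conv_rhs => rw [so31_eq_wedgeG Y]
  simp only [map_smul, map_add, map_sub, smul_apply, add_apply, sub_apply, hw]

end Commutant

/-! ### Invertibility of `id + β T` -/

section Deform

variable {T : so31 →ₗ[ℝ] so31} {β : ℝ}

theorem AdEquivariant.deform (hT : AdEquivariant T) : AdEquivariant (deform T β) := by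
  intro X Y
  simp [_root_.deform, hT X Y]

theorem AdEquivariant.isUnit_deform (hT : AdEquivariant T) (h : β • T ≠ -LinearMap.id) :
    IsUnit (_root_.deform T β) := by
  rw [Module.End.isUnit_iff]
  have hi : Function.Injective (_root_.deform T β) :=
    hT.deform.injective fun h0 => h (eq_neg_of_add_eq_zero_right h0)
  exact ⟨hi, LinearMap.injective_iff_surjective.1 hi⟩

theorem deformInv_deform (h : IsUnit (deform T β)) (X : so31) :
    deformInv T β (deform T β X) = X :=
  DFunLike.congr_fun (Ring.inverse_mul_cancel _ h) X

theorem deform_deformInv (h : IsUnit (deform T β)) (X : so31) :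
    deform T β (deformInv T β X) = X :=
  DFunLike.congr_fun (Ring.mul_inverse_cancel _ h) X

theorem AdEquivariant.deformInv (hT : AdEquivariant T) (h : IsUnit (_root_.deform T β)) :
    AdEquivariant (_root_.deformInv T β : so31 →ₗ[ℝ] so31) := by
  intro X Y
  have hi : Function.Injective (_root_.deform T β) := ((Module.End.isUnit_iff _).1 h).1
  apply hi
  rw [hT.deform]
  simp [deform_deformInv h]

end Deform

/-! ### Wedge products in low degrees -/

theorem sum_perm_fin_two {W : Type*} [AddCommGroup W] (h : Fin 2 → Fin 2 → W) :
    ∑ σ : Equiv.Perm (Fin 2), Equiv.Perm.sign σ • h (σ 0) (σ 1) = h 0 1 - h 1 0 := by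
  rw [← Equiv.sum_comp Equiv.Perm.decomposeFin.symm]
  simp only [Fintype.sum_prod_type, Fin.sum_univ_succ, Equiv.Perm.decomposeFin.symm_sign]
  simp [sub_eq_add_neg]

theorem sum_perm_fin_three {W : Type*} [AddCommGroup W] (h : Fin 3 → Fin 3 → Fin 3 → W) :
    ∑ σ : Equiv.Perm (Fin 3), Equiv.Perm.sign σ • h (σ 0) (σ 1) (σ 2) =
      h 0 1 2 - h 0 2 1 - h 1 0 2 + h 1 2 0 + h 2 0 1 - h 2 1 0 := by
  have : (Finset.univ : Finset (Equiv.Perm (Fin 3))) = {1, Equiv.swap 1 2, Equiv.swap 0 1,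
    Equiv.swap 0 1 * Equiv.swap 1 2, Equiv.swap 1 2 * Equiv.swap 0 1, Equiv.swap 0 2} := by decide
  rw [this]
  repeat rw [Finset.sum_insert (by decide)]
  simp [Equiv.Perm.sign_swap', Equiv.swap_apply_def]
  abel

theorem sum_perm_fin_four {W : Type*} [AddCommGroup W] (h : Fin 4 → Fin 4 → Fin 4 → Fin 4 → W) :
    ∑ σ : Equiv.Perm (Fin 4), Equiv.Perm.sign σ • h (σ 0) (σ 1) (σ 2) (σ 3) =
      (h 0 1 2 3 - h 0 1 3 2 - h 0 2 1 3 + h 0 2 3 1 + h 0 3 1 2 - h 0 3 2 1) -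
      (h 1 0 2 3 - h 1 0 3 2 - h 1 2 0 3 + h 1 2 3 0 + h 1 3 0 2 - h 1 3 2 0) +
      (h 2 0 1 3 - h 2 0 3 1 - h 2 1 0 3 + h 2 1 3 0 + h 2 3 0 1 - h 2 3 1 0) -
      (h 3 0 1 2 - h 3 0 2 1 - h 3 1 0 2 + h 3 1 2 0 + h 3 2 0 1 - h 3 2 1 0) := by
  rw [← Equiv.sum_comp Equiv.Perm.decomposeFin.symm]
  simp only [Fintype.sum_prod_type, Equiv.Perm.decomposeFin.symm_sign, mul_smul]
  have h1 : (1 : Fin 4) = Fin.succ 0 := rfl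
  have h2 : (2 : Fin 4) = Fin.succ 1 := rfl
  have h3 : (3 : Fin 4) = Fin.succ 2 := rfl
  conv_lhs =>
    enter [2, p, 2, e]
    rw [h1, h2, h3]
    simp only [Equiv.Perm.decomposeFin_symm_apply_zero, Equiv.Perm.decomposeFin_symm_apply_succ]
  simp only [← Finset.smul_sum]
  conv_lhs =>
    enter [2, p]
    rw [sum_perm_fin_three fun i j k => h p (Equiv.swap 0 p i.succ) (Equiv.swap 0 p j.succ)
      (Equiv.swap 0 p k.succ)]
  simp only [Fin.sum_univ_four]
  simp [Equiv.swap_apply_def]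
  abel

section WedgeFormulas

variable {W W' W₁ W₂ W₃ : Type*} [NormedAddCommGroup W] [NormedSpace ℝ W]
  [NormedAddCommGroup W'] [NormedSpace ℝ W']
  [NormedAddCommGroup W₁] [NormedSpace ℝ W₁] [NormedAddCommGroup W₂] [NormedSpace ℝ W₂]
  [NormedAddCommGroup W₃] [NormedSpace ℝ W₃]

theorem two_form_swap (α : E4 [⋀^Fin 2]→L[ℝ] W) (u v : E4) : α ![u, v] = -α ![v, u] := by
  have := α.map_swap ![v, u] (i := 0) (j := 1) (by decide)
  refine Eq.trans ?_ this
  change α _ = α _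
  congr 1
  ext i : 1
  fin_cases i <;> rfl

theorem three_form_swap₀₁ (α : E4 [⋀^Fin 3]→L[ℝ] W) (u v w : E4) :
    α ![u, v, w] = -α ![v, u, w] := by
  have := α.map_swap ![v, u, w] (i := 0) (j := 1) (by decide)
  refine Eq.trans ?_ this
  change α _ = α _
  congr 1
  ext i : 1
  fin_cases i <;> rfl

theorem three_form_swap₁₂ (α : E4 [⋀^Fin 3]→L[ℝ] W) (u v w : E4) :
    α ![u, v, w] = -α ![u, w, v] := by
  have := α.map_swap ![u, w, v] (i := 1) (j := 2) (by decide)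
  refine Eq.trans ?_ this
  change α _ = α _
  congr 1
  ext i : 1
  fin_cases i <;> rfl

theorem wedge_one_one (b : W₁ →L[ℝ] W₂ →L[ℝ] W₃) (α : E4 [⋀^Fin 1]→L[ℝ] W₁)
    (γ : E4 [⋀^Fin 1]→L[ℝ] W₂) (v : Fin 2 → E4) :
    (wedge b α γ : E4 [⋀^Fin 2]→L[ℝ] W₃) v =
      b (α ![v 0]) (γ ![v 1]) - b (α ![v 1]) (γ ![v 0]) := by
  rw [show (wedge b α γ : E4 [⋀^Fin 2]→L[ℝ] W₃) v = _ from wedge_apply b α γ v]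
  have := sum_perm_fin_two fun i j => b (α ![v i]) (γ ![v j])
  simp only [Nat.factorial, Nat.cast_one, mul_one, inv_one, one_smul, ← this]
  refine Finset.sum_congr rfl fun σ _ => ?_
  congr 4 <;> (ext i : 1; fin_cases i; rfl)

theorem wedge_two_one (b : W₁ →L[ℝ] W₂ →L[ℝ] W₃) (α : E4 [⋀^Fin 2]→L[ℝ] W₁)
    (γ : E4 [⋀^Fin 1]→L[ℝ] W₂) (v : Fin 3 → E4) :
    (wedge b α γ : E4 [⋀^Fin 3]→L[ℝ] W₃) v =
      b (α ![v 0, v 1]) (γ ![v 2]) - b (α ![v 0, v 2]) (γ ![v 1]) +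
        b (α ![v 1, v 2]) (γ ![v 0]) := by
  rw [show (wedge b α γ : E4 [⋀^Fin 3]→L[ℝ] W₃) v = _ from wedge_apply b α γ v]
  have := sum_perm_fin_three fun i j k => b (α ![v i, v j]) (γ ![v k])
  have e : ∑ σ : Equiv.Perm (Fin (2 + 1)), Equiv.Perm.sign σ •
        b (α fun i => v (σ (Fin.castAdd 1 i))) (γ fun j => v (σ (Fin.natAdd 2 j))) =
      ∑ σ : Equiv.Perm (Fin 3), Equiv.Perm.sign σ • b (α ![v (σ 0), v (σ 1)]) (γ ![v (σ 2)]) := by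
    refine Finset.sum_congr rfl fun σ _ => ?_
    congr 4 <;> (ext i : 1; fin_cases i <;> rfl)
  rw [e, this, two_form_swap α (v 1) (v 0), two_form_swap α (v 2) (v 0),
    two_form_swap α (v 2) (v 1)]
  simp only [Nat.factorial, map_neg, neg_apply]
  norm_num
  module

theorem wedge_two_two (b : W₁ →L[ℝ] W₂ →L[ℝ] W₃) (α : E4 [⋀^Fin 2]→L[ℝ] W₁)
    (γ : E4 [⋀^Fin 2]→L[ℝ] W₂) (v : Fin 4 → E4) :
    (wedge b α γ : E4 [⋀^Fin 4]→L[ℝ] W₃) v =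
      b (α ![v 0, v 1]) (γ ![v 2, v 3]) - b (α ![v 0, v 2]) (γ ![v 1, v 3]) +
        b (α ![v 0, v 3]) (γ ![v 1, v 2]) + b (α ![v 1, v 2]) (γ ![v 0, v 3]) -
        b (α ![v 1, v 3]) (γ ![v 0, v 2]) + b (α ![v 2, v 3]) (γ ![v 0, v 1]) := by
  rw [show (wedge b α γ : E4 [⋀^Fin 4]→L[ℝ] W₃) v = _ from wedge_apply b α γ v]
  have := sum_perm_fin_four fun i j k l => b (α ![v i, v j]) (γ ![v k, v l])
  have e : ∑ σ : Equiv.Perm (Fin (2 + 2)), Equiv.Perm.sign σ •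
        b (α fun i => v (σ (Fin.castAdd 2 i))) (γ fun j => v (σ (Fin.natAdd 2 j))) =
      ∑ σ : Equiv.Perm (Fin 4), Equiv.Perm.sign σ •
        b (α ![v (σ 0), v (σ 1)]) (γ ![v (σ 2), v (σ 3)]) := by
    refine Finset.sum_congr rfl fun σ _ => ?_
    congr 4 <;> (ext i : 1; fin_cases i <;> rfl)
  rw [e, this, two_form_swap α (v 1) (v 0), two_form_swap α (v 2) (v 0),
    two_form_swap α (v 2) (v 1), two_form_swap α (v 3) (v 0), two_form_swap α (v 3) (v 1),
    two_form_swap α (v 3) (v 2), two_form_swap γ (v 1) (v 0), two_form_swap γ (v 2) (v 0),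
    two_form_swap γ (v 2) (v 1), two_form_swap γ (v 3) (v 0), two_form_swap γ (v 3) (v 1),
    two_form_swap γ (v 3) (v 2)]
  simp only [Nat.factorial, map_neg, neg_apply]
  norm_num
  module

theorem wedge_three_one (b : W₁ →L[ℝ] W₂ →L[ℝ] W₃) (α : E4 [⋀^Fin 3]→L[ℝ] W₁)
    (γ : E4 [⋀^Fin 1]→L[ℝ] W₂) (v : Fin 4 → E4) :
    (wedge b α γ : E4 [⋀^Fin 4]→L[ℝ] W₃) v =
      b (α ![v 0, v 1, v 2]) (γ ![v 3]) - b (α ![v 0, v 1, v 3]) (γ ![v 2]) +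
        b (α ![v 0, v 2, v 3]) (γ ![v 1]) - b (α ![v 1, v 2, v 3]) (γ ![v 0]) := by
  rw [show (wedge b α γ : E4 [⋀^Fin 4]→L[ℝ] W₃) v = _ from wedge_apply b α γ v]
  have := sum_perm_fin_four fun i j k l => b (α ![v i, v j, v k]) (γ ![v l])
  have e : ∑ σ : Equiv.Perm (Fin (3 + 1)), Equiv.Perm.sign σ •
        b (α fun i => v (σ (Fin.castAdd 1 i))) (γ fun j => v (σ (Fin.natAdd 3 j))) =
      ∑ σ : Equiv.Perm (Fin 4), Equiv.Perm.sign σ •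
        b (α ![v (σ 0), v (σ 1), v (σ 2)]) (γ ![v (σ 3)]) := by
    refine Finset.sum_congr rfl fun σ _ => ?_
    congr 4 <;> (ext i : 1; fin_cases i <;> rfl)
  have s : ∀ i j k, α ![v i, v j, v k] = -α ![v j, v i, v k] := fun i j k =>
    three_form_swap₀₁ α _ _ _
  have s' : ∀ i j k, α ![v i, v j, v k] = -α ![v i, v k, v j] := fun i j k =>
    three_form_swap₁₂ α _ _ _
  rw [e, this, s' 0 2 1, s 1 0 2, s' 1 2 0, s 1 0 2, s 2 0 1, s' 0 2 1, s 2 1 0, s' 1 2 0, s 1 0 2,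
    s' 0 3 1, s 1 0 3, s' 1 3 0, s 1 0 3, s 3 0 1, s' 0 3 1, s 3 1 0, s' 1 3 0, s 1 0 3,
    s' 0 3 2, s 2 0 3, s' 2 3 0, s 2 0 3, s 3 0 2, s' 0 3 2, s 3 2 0, s' 2 3 0, s 2 0 3,
    s' 1 3 2, s 2 1 3, s' 2 3 1, s 2 1 3, s 3 1 2, s' 1 3 2, s 3 2 1, s' 2 3 1, s 2 1 3]
  simp only [Nat.factorial, map_neg, neg_apply]
  norm_num
  module

theorem extDerivWithin_one (α : E4 → E4 [⋀^Fin 1]→L[ℝ] W) (s : Set E4) (x : E4)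
    (v : Fin 2 → E4) : extDerivWithin α s x v =
      fderivWithin ℝ α s x (v 0) ![v 1] - fderivWithin ℝ α s x (v 1) ![v 0] := by
  rw [extDerivWithin, ContinuousAlternatingMap.alternatizeUncurryFin_apply, Fin.sum_univ_two]
  simp only [Fin.val_zero, Fin.val_one, pow_zero, pow_one, one_smul, neg_smul, sub_eq_add_neg]
  congr 2
  · ext i : 1; fin_cases i; rfl
  · congr 1; ext i : 1; fin_cases i; rfl

theorem extDerivWithin_two (α : E4 → E4 [⋀^Fin 2]→L[ℝ] W) (s : Set E4) (x : E4)
    (v : Fin 3 → E4) : extDerivWithin α s x v =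
      fderivWithin ℝ α s x (v 0) ![v 1, v 2] - fderivWithin ℝ α s x (v 1) ![v 0, v 2] +
        fderivWithin ℝ α s x (v 2) ![v 0, v 1] := by
  rw [extDerivWithin, ContinuousAlternatingMap.alternatizeUncurryFin_apply, Fin.sum_univ_three]
  have e0 : (0 : Fin 3).removeNth v = ![v 1, v 2] := by ext i : 1; fin_cases i <;> rfl
  have e1 : (1 : Fin 3).removeNth v = ![v 0, v 2] := by ext i : 1; fin_cases i <;> rfl
  have e2 : (2 : Fin 3).removeNth v = ![v 0, v 1] := by ext i : 1; fin_cases i <;> rfl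
  rw [e0, e1, e2]
  simp [sub_eq_add_neg]

theorem extDerivWithin_three (α : E4 → E4 [⋀^Fin 3]→L[ℝ] W) (s : Set E4) (x : E4)
    (v : Fin 4 → E4) : extDerivWithin α s x v =
      fderivWithin ℝ α s x (v 0) ![v 1, v 2, v 3] - fderivWithin ℝ α s x (v 1) ![v 0, v 2, v 3] +
        fderivWithin ℝ α s x (v 2) ![v 0, v 1, v 3] -
        fderivWithin ℝ α s x (v 3) ![v 0, v 1, v 2] := by
  rw [extDerivWithin, ContinuousAlternatingMap.alternatizeUncurryFin_apply, Fin.sum_univ_four]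
  have e0 : (0 : Fin 4).removeNth v = ![v 1, v 2, v 3] := by ext i : 1; fin_cases i <;> rfl
  have e1 : (1 : Fin 4).removeNth v = ![v 0, v 2, v 3] := by ext i : 1; fin_cases i <;> rfl
  have e2 : (2 : Fin 4).removeNth v = ![v 0, v 1, v 3] := by ext i : 1; fin_cases i <;> rfl
  have e3 : (3 : Fin 4).removeNth v = ![v 0, v 1, v 2] := by ext i : 1; fin_cases i <;> rfl
  rw [e0, e1, e2, e3]
  simp [sub_eq_add_neg, pow_succ]

/-! ### The wedge product as a continuous bilinear map -/

instance [FiniteDimensional ℝ W] (p : ℕ) : FiniteDimensional ℝ (E4 [⋀^Fin p]→L[ℝ] W) :=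
  FiniteDimensional.of_injective
    ((AlternatingMap.toMultilinearMapLM (R := ℝ) (S := ℝ)) ∘ₗ
      (ContinuousAlternatingMap.toAlternatingMapLinear (R := ℝ) (A := ℝ)))
    (fun _ _ h => ContinuousAlternatingMap.toAlternatingMap_injective
      (AlternatingMap.coe_multilinearMap_injective h))

theorem mapVal_apply (f : W₁ →L[ℝ] W₂) {p : ℕ} (α : E4 [⋀^Fin p]→L[ℝ] W₁) (v : Fin p → E4) :
    mapVal f α v = f (α v) := rfl

variable [FiniteDimensional ℝ W₁]

/-- Application of a linear map to the values, as a continuous linear map on forms. -/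
noncomputable def mapValL (f : W₁ →L[ℝ] W₂) (p : ℕ) :
    (E4 [⋀^Fin p]→L[ℝ] W₁) →L[ℝ] (E4 [⋀^Fin p]→L[ℝ] W₂) :=
  LinearMap.toContinuousLinearMap
    { toFun := fun α => mapVal f α
      map_add' := fun a b => by ext v; simp [mapVal]
      map_smul' := fun r a => by ext v; simp [mapVal] }

theorem mapValL_apply (f : W₁ →L[ℝ] W₂) {p : ℕ} (α : E4 [⋀^Fin p]→L[ℝ] W₁) :
    mapValL f p α = mapVal f α := rfl


theorem two_le_infty : (2 : ℕ∞ω) ≤ ∞ :=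
  WithTop.coe_le_coe.2 (le_top : (2 : ℕ∞) ≤ ⊤)

theorem extDerivWithin_mapVal (f : W₁ →L[ℝ] W₂) {p : ℕ} {α : E4 → E4 [⋀^Fin p]→L[ℝ] W₁}
    {s : Set E4} {x : E4} (hs : UniqueDiffWithinAt ℝ s x) (hα : DifferentiableWithinAt ℝ α s x) :
    extDerivWithin (fun y => mapVal f (α y)) s x = mapVal f (extDerivWithin α s x) := by
  have := ((mapValL f p).hasFDerivAt.comp_hasFDerivWithinAt x hα.hasFDerivWithinAt).fderivWithin hs
  ext v
  rw [mapVal_apply, extDerivWithin, extDerivWithin,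
    ContinuousAlternatingMap.alternatizeUncurryFin_apply,
    ContinuousAlternatingMap.alternatizeUncurryFin_apply]
  erw [this]
  simp [mapValL_apply, mapVal_apply]

variable [FiniteDimensional ℝ W₂]

/-- The wedge product as a continuous bilinear map. -/
noncomputable def wedgeL (b : W₁ →L[ℝ] W₂ →L[ℝ] W₃) (p q : ℕ) :
    (E4 [⋀^Fin p]→L[ℝ] W₁) →L[ℝ] (E4 [⋀^Fin q]→L[ℝ] W₂) →L[ℝ] (E4 [⋀^Fin (p + q)]→L[ℝ] W₃) :=
  (LinearMap.mk₂ ℝ (fun α γ => wedge b α γ)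
    (fun a a' c => by
      ext v; simp [wedge_apply, ← smul_add, ← Finset.sum_add_distrib])
    (fun r a c => by
      ext v; simp [wedge_apply, Finset.smul_sum, smul_comm r])
    (fun a c c' => by
      ext v; simp [wedge_apply, ← smul_add, ← Finset.sum_add_distrib])
    (fun r a c => by
      ext v; simp [wedge_apply, Finset.smul_sum, smul_comm r])).toContinuousBilinearMap

theorem wedgeL_apply (b : W₁ →L[ℝ] W₂ →L[ℝ] W₃) {p q : ℕ} (α : E4 [⋀^Fin p]→L[ℝ] W₁)
    (γ : E4 [⋀^Fin q]→L[ℝ] W₂) : wedgeL b p q α γ = wedge b α γ := rfl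

section Leibniz

variable {s : Set E4} {x : E4}

theorem hasFDerivWithinAt_wedge (b : W₁ →L[ℝ] W₂ →L[ℝ] W₃) {p q : ℕ}
    {α : E4 → E4 [⋀^Fin p]→L[ℝ] W₁} {γ : E4 → E4 [⋀^Fin q]→L[ℝ] W₂}
    (hs : UniqueDiffWithinAt ℝ s x)
    (hα : DifferentiableWithinAt ℝ α s x) (hγ : DifferentiableWithinAt ℝ γ s x) (u : E4) :
    fderivWithin ℝ (fun y => wedge b (α y) (γ y)) s x u =
      wedge b (fderivWithin ℝ α s x u) (γ x) + wedge b (α x) (fderivWithin ℝ γ s x u) := by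
  have := ((wedgeL b p q).hasFDerivWithinAt_of_bilinear hα.hasFDerivWithinAt
    hγ.hasFDerivWithinAt).fderivWithin hs
  simp only [wedgeL_apply] at this
  rw [this, add_apply]
  exact add_comm _ _

theorem extDerivWithin_wedge_two_one (b : W₁ →L[ℝ] W₂ →L[ℝ] W₃)
    {α : E4 → E4 [⋀^Fin 2]→L[ℝ] W₁} {γ : E4 → E4 [⋀^Fin 1]→L[ℝ] W₂}
    (hs : UniqueDiffWithinAt ℝ s x)
    (hα : DifferentiableWithinAt ℝ α s x) (hγ : DifferentiableWithinAt ℝ γ s x) :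
    (extDerivWithin (fun y => (wedge b (α y) (γ y) : E4 [⋀^Fin 3]→L[ℝ] W₃)) s x :
        E4 [⋀^Fin 4]→L[ℝ] W₃) =
      wedge b (extDerivWithin α s x : E4 [⋀^Fin 3]→L[ℝ] W₁) (γ x) +
        wedge b (α x) (extDerivWithin γ s x) := by
  ext v
  rw [extDerivWithin_three, ContinuousAlternatingMap.add_apply, wedge_three_one, wedge_two_two]
  have h := hasFDerivWithinAt_wedge b hs hα hγ
  simp only [Nat.reduceAdd] at h
  simp only [h, ContinuousAlternatingMap.add_apply, wedge_two_one, extDerivWithin_one,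
    extDerivWithin_two]
  simp
  abel

end Leibniz

/-! ### The Bianchi identity -/

section Bianchi

variable {s : Set E4} {x : E4}

/-- The Bianchi identity `dF = [F ∧ A]`. -/
theorem extDerivWithin_curvature {A : E4 → E4 [⋀^Fin 1]→L[ℝ] so31} (hs : UniqueDiffOn ℝ s)
    (hx : x ∈ s) (hx' : x ∈ closure (interior s)) (hA : ContDiffOn ℝ ∞ A s) :
    (extDerivWithin (curvature bracketG s A) s x : E4 [⋀^Fin 3]→L[ℝ] so31) =
      wedge bracketG (curvature bracketG s A x) (A x) := by
  have hAd : DifferentiableWithinAt ℝ A s x := (hA x hx).differentiableWithinAt (by simp)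
  have hdA : DifferentiableWithinAt ℝ (extDerivWithin A s) s x :=
    (ContinuousAlternatingMap.alternatizeUncurryFinCLM ℝ E4
      so31).differentiableAt.comp_differentiableWithinAt x
        (((hA x hx).fderivWithin_right hs (m := 1) two_le_infty hx).differentiableWithinAt
          (by simp))
  have hw : DifferentiableWithinAt ℝ
      (fun y => (wedge bracketG (A y) (A y) : E4 [⋀^Fin 2]→L[ℝ] so31)) s x :=
    ((wedgeL bracketG 1 1).hasFDerivWithinAt_of_bilinear hAd.hasFDerivWithinAt
      hAd.hasFDerivWithinAt).differentiableWithinAt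
  have h0 : extDerivWithin (extDerivWithin A s) s x = 0 :=
    extDerivWithin_extDerivWithin_apply (hA x hx) (by simpa using two_le_infty) hs hx' hx
  have hF : extDerivWithin (curvature bracketG s A) s x = (1 / 2 : ℝ) •
      extDerivWithin (fun y => (wedge bracketG (A y) (A y) : E4 [⋀^Fin 2]→L[ℝ] so31)) s x := by
    unfold curvature
    rw [extDerivWithin_fun_add (hs x hx) hdA (hw.fun_const_smul _), h0,
      zero_add, extDerivWithin_fun_smul _ _ (hs x hx)]
  rw [hF]
  ext v
  rw [ContinuousAlternatingMap.smul_apply, extDerivWithin_two]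
  have h := hasFDerivWithinAt_wedge bracketG (hs x hx) hAd hAd
  simp only [Nat.reduceAdd] at h
  have hb : ∀ X Y, bracketG X Y = ⁅X, Y⁆ := fun _ _ => rfl
  simp only [h, ContinuousAlternatingMap.add_apply, wedge_two_one, wedge_one_one, curvature,
    ContinuousAlternatingMap.smul_apply, extDerivWithin_one, hb]
  simp only [Matrix.cons_val_zero, Matrix.cons_val_one]
  generalize A x ![v 0] = a
  generalize A x ![v 1] = b
  generalize A x ![v 2] = c
  generalize fderivWithin ℝ A s x = D
  have j1 : ⁅⁅a, b⁆, c⁆ = ⁅a, ⁅b, c⁆⁆ - ⁅b, ⁅a, c⁆⁆ := lie_lie _ _ _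
  have s1 : ∀ X Y : so31, ⁅X, Y⁆ = -⁅Y, X⁆ := fun X Y => (lie_skew X Y).symm
  simp only [add_lie, smul_lie, sub_lie]
  rw [s1 a (D (v 1) ![v 2]), s1 a (D (v 2) ![v 1]), s1 b (D (v 0) ![v 2]), s1 b (D (v 2) ![v 0]),
    s1 c (D (v 0) ![v 1]), s1 c (D (v 1) ![v 0]), j1, s1 b a, s1 c a, s1 c b, s1 ⁅a, c⁆ b,
    s1 ⁅b, c⁆ a]
  simp only [neg_lie]
  rw [s1 ⁅a, c⁆ b, s1 ⁅b, c⁆ a, j1]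
  module

theorem pairG_apply (X : so31) (z : so31Dual) : pairG X z = z X := rfl

/-- Twisted Bianchi identity: `⟨Q F_A, d_A S⟩ = d ⟨Q F_A, S⟩` for every `Q` that commutes with the
adjoint action. -/
theorem extDerivWithin_pairG_curvature {Q : so31 →L[ℝ] so31}
    (hQ : AdEquivariant (Q : so31 →ₗ[ℝ] so31))
    {A : E4 → E4 [⋀^Fin 1]→L[ℝ] so31} {S : E4 → E4 [⋀^Fin 1]→L[ℝ] so31Dual}
    (hs : UniqueDiffOn ℝ s) (hx : x ∈ s) (hx' : x ∈ closure (interior s))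
    (hA : ContDiffOn ℝ ∞ A s) (hS : ContDiffOn ℝ ∞ S s)
    (hF : DifferentiableWithinAt ℝ (curvature bracketG s A) s x) :
    (extDerivWithin (fun y => (wedge pairG (mapVal Q (curvature bracketG s A y)) (S y) :
        E4 [⋀^Fin 3]→L[ℝ] ℝ)) s x : E4 [⋀^Fin 4]→L[ℝ] ℝ) =
      wedge pairG (mapVal Q (curvature bracketG s A x)) (covDeriv coad s A S x) := by
  have hQF : DifferentiableWithinAt ℝ (fun y => mapVal Q (curvature bracketG s A y)) s x :=
    (mapValL Q 2).differentiableAt.comp_differentiableWithinAt x hF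
  rw [extDerivWithin_wedge_two_one pairG (hs x hx) hQF
      ((hS x hx).differentiableWithinAt (by simp)), extDerivWithin_mapVal Q (hs x hx) hF,
      extDerivWithin_curvature hs hx hx' hA]
  ext v
  rw [ContinuousAlternatingMap.add_apply]
  have hq : ∀ X Y, Q (bracketG X Y) = ⁅Q X, Y⁆ := fun X Y => by
    have h1 := hQ Y X
    change Q ⁅Y, X⁆ = ⁅Y, Q X⁆ at h1
    change Q ⁅X, Y⁆ = _
    rw [← lie_skew X Y, map_neg, h1, lie_skew]
  have hc : ∀ X z Y, coad X z Y = z ⁅Y, X⁆ := fun X z Y => by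
    rw [coad_apply, ← map_neg, lie_skew]
  simp only [covDeriv, wedge_three_one, wedge_two_two, mapVal_apply, wedge_two_one, wedge_one_one,
    ContinuousAlternatingMap.add_apply, pairG_apply, add_apply, sub_apply, map_add, map_sub, hq, hc]
  simp
  ring

end Bianchi

end WedgeFormulas

/-! ### Splitting the Lagrangian of quadratically extended General Relativity -/

/-- The continuous linear map `id + β T`. -/
noncomputable def deformL (T : so31 →ₗ[ℝ] so31) (β : ℝ) : so31 →L[ℝ] so31 :=
  LinearMap.toContinuousLinearMap (deform T β)

theorem deformL_apply (T : so31 →ₗ[ℝ] so31) (β : ℝ) (X : so31) :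
    deformL T β X = X + β • T X := rfl

theorem deformInvDual_apply (T : so31 →ₗ[ℝ] so31) (β : ℝ) (z : so31Dual) (X : so31) :
    deformInvDual T β z X = z (deformInv T β X) := rfl

section Components

variable {s : Set E4} {x : E4} {σ : E4 → E4 [⋀^Fin 1]→L[ℝ] dAlg}

theorem compG_apply {p : ℕ} (σ : E4 [⋀^Fin p]→L[ℝ] dAlg) (v : Fin p → E4) :
    compG σ v = (σ v).1 := rfl

theorem compV_apply {p : ℕ} (σ : E4 [⋀^Fin p]→L[ℝ] dAlg) (v : Fin p → E4) :
    compV σ v = (σ v).2.1 := rfl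

theorem compGDual_apply {p : ℕ} (σ : E4 [⋀^Fin p]→L[ℝ] dAlg) (v : Fin p → E4) :
    compGDual σ v = (σ v).2.2 := rfl

theorem bracketD_apply (a b : dAlg) : bracketD a b =
    (bracketG a.1 b.1, so31.toEnd a.1 b.2.1 - so31.toEnd b.1 a.2.1,
      coad a.1 b.2.2 - coad b.1 a.2.2 + wedgeV a.2.1 b.2.1) := rfl

theorem compG_curvature (hs : UniqueDiffWithinAt ℝ s x) (hσ : DifferentiableWithinAt ℝ σ s x) :
    compG (curvature bracketD s σ x) = curvature bracketG s (fun y => compG (σ y)) x := by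
  simp only [curvature]
  rw [show extDerivWithin (fun y => compG (σ y)) s x = compG (extDerivWithin σ s x) from
    extDerivWithin_mapVal _ hs hσ]
  ext v : 1
  simp only [compG_apply, ContinuousAlternatingMap.add_apply, ContinuousAlternatingMap.smul_apply,
    wedge_one_one, bracketD_apply]
  rfl

theorem compV_curvature (hs : UniqueDiffWithinAt ℝ s x) (hσ : DifferentiableWithinAt ℝ σ s x) :
    compV (curvature bracketD s σ x) =
      covDeriv so31.toEnd s (fun y => compG (σ y)) (fun y => compV (σ y)) x := by
  simp only [curvature, covDeriv]
  rw [show extDerivWithin (fun y => compV (σ y)) s x = compV (extDerivWithin σ s x) from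
    extDerivWithin_mapVal _ hs hσ]
  ext v : 1
  simp only [compV_apply, compG_apply, ContinuousAlternatingMap.add_apply,
    ContinuousAlternatingMap.smul_apply, wedge_one_one, bracketD_apply, Prod.fst_add, Prod.snd_add,
    Prod.smul_fst, Prod.smul_snd, Prod.fst_sub, Prod.snd_sub]
  module

theorem compGDual_curvature (hs : UniqueDiffWithinAt ℝ s x)
    (hσ : DifferentiableWithinAt ℝ σ s x) :
    compGDual (curvature bracketD s σ x) =
      covDeriv coad s (fun y => compG (σ y)) (fun y => compGDual (σ y)) x +
        (1 / 2 : ℝ) • wedge wedgeV (compV (σ x)) (compV (σ x)) := by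
  simp only [curvature, covDeriv]
  rw [show extDerivWithin (fun y => compGDual (σ y)) s x = compGDual (extDerivWithin σ s x) from
    extDerivWithin_mapVal _ hs hσ]
  ext v : 1
  simp only [compV_apply, compG_apply, compGDual_apply, ContinuousAlternatingMap.add_apply,
    ContinuousAlternatingMap.smul_apply, wedge_one_one, bracketD_apply, Prod.snd_add,
    Prod.smul_snd, Prod.snd_sub]
  module

end Components

theorem wedge_pairD (σ γ : E4 [⋀^Fin 2]→L[ℝ] dAlg) : wedge pairD σ γ =
    wedge eta (compV σ) (compV γ) + wedge pairG (compG γ) (compGDual σ) +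
      wedge pairG (compG σ) (compGDual γ) := by
  have h : ∀ a b, pairD a b = eta a.2.1 b.2.1 + a.2.2 b.1 + b.2.2 a.1 := fun _ _ => rfl
  ext v
  simp only [ContinuousAlternatingMap.add_apply, wedge_two_two, h, compG_apply, compV_apply,
    compGDual_apply, pairG_apply]
  ring

theorem wedge_pairTwisted (T : so31 →ₗ[ℝ] so31) (σ : E4 [⋀^Fin 2]→L[ℝ] dAlg) :
    wedge (pairTwisted T) σ σ = wedge eta (compV σ) (compV σ) +
      (2 : ℝ) • wedge pairG (mapVal (LinearMap.toContinuousLinearMap T) (compG σ))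
        (compGDual σ) := by
  have h : ∀ a b, pairTwisted T a b = eta a.2.1 b.2.1 + a.2.2 (T b.1) + b.2.2 (T a.1) :=
    fun _ _ => rfl
  ext v
  simp only [ContinuousAlternatingMap.add_apply, ContinuousAlternatingMap.smul_apply,
    wedge_two_two, h, compG_apply, compV_apply, mapVal_apply, smul_eq_mul,
    compGDual_apply, pairG_apply, LinearMap.coe_toContinuousLinearMap']
  ring

variable (T : so31 →ₗ[ℝ] so31) (β : ℝ)

/-- The tensor `c + (id + β T)⁻¹ F_A`, whose vanishing is the field equation of `B`. -/
noncomputable def residC (s : Set E4) (U : E4 → FibQeGR) (x : E4) : E4 [⋀^Fin 2]→L[ℝ] so31 :=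
  compG (U x).2 + mapVal (deformInv T β) (curvature bracketG s (fun y => compG (U y).1) x)

/-- The tensor `B + (id + β T)⁻¹ (d_A S + ½ e ∧ e)`, whose vanishing is the field equation
of `c`. -/
noncomputable def residB (s : Set E4) (U : E4 → FibQeGR) (x : E4) :
    E4 [⋀^Fin 2]→L[ℝ] so31Dual :=
  compGDual (U x).2 + mapVal (deformInvDual T β)
    (covDeriv coad s (fun y => compG (U y).1) (fun y => compGDual (U y).1) x +
      (1 / 2 : ℝ) • wedge wedgeV (compV (U x).1) (compV (U x).1))

variable {T β}

/-- Completing the square in `c` and `B`. -/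
theorem lagrangian_eq_completed_square (h : IsUnit (deform T β)) {s : Set E4} {x : E4}
    {U : E4 → FibQeGR} (hs : UniqueDiffWithinAt ℝ s x)
    (hU : DifferentiableWithinAt ℝ (fun y => (U y).1) s x) :
    (wedge pairD (U x).2 (curvature bracketD s (fun y => (U y).1) x) +
      (1 / 2 : ℝ) • (wedge pairD (U x).2 (U x).2 + β • wedge (pairTwisted T) (U x).2 (U x).2) :
        E4 [⋀^Fin 4]→L[ℝ] ℝ) =
    wedge pairG (mapVal (deformL T β) (residC T β s U x)) (residB T β s U x) -
      wedge pairG (mapVal (deformInv T β) (curvature bracketG s (fun y => compG (U y).1) x))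
        (covDeriv coad s (fun y => compG (U y).1) (fun y => compGDual (U y).1) x) -
      ((1 / 2 : ℝ) • wedge pairG
          (mapVal (deformInv T β) (curvature bracketG s (fun y => compG (U y).1) x))
          (wedge wedgeV (compV (U x).1) (compV (U x).1)) -
        wedge eta (compV (U x).2)
          (covDeriv so31.toEnd s (fun y => compG (U y).1) (fun y => compV (U y).1) x) -
        ((1 + β) / 2) • wedge eta (compV (U x).2) (compV (U x).2)) := by
  rw [wedge_pairD, wedge_pairD, wedge_pairTwisted, compG_curvature hs hU, compV_curvature hs hU,
    compGDual_curvature hs hU, residC, residB]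
  have hp : ∀ X, deformL T β (deformInv T β X) = X := deform_deformInv h
  have hq : ∀ X, deformInv T β (deformL T β X) = X := deformInv_deform h
  ext v
  simp only [ContinuousAlternatingMap.add_apply, ContinuousAlternatingMap.sub_apply,
    ContinuousAlternatingMap.smul_apply, wedge_two_two, mapVal_apply, pairG_apply, map_add, hp,
    map_smul, add_apply, deformInvDual_apply, hq, smul_eq_mul]
  simp only [deformL_apply, map_add, map_smul, smul_eq_mul, LinearMap.coe_toContinuousLinearMap']
  ring

/-! ### One-parameter families of smooth functions -/

section Families

variable {W W' W₁ W₂ W₃ : Type*} [NormedAddCommGroup W] [NormedSpace ℝ W]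
  [NormedAddCommGroup W'] [NormedSpace ℝ W']
  [NormedAddCommGroup W₁] [NormedSpace ℝ W₁] [NormedAddCommGroup W₂] [NormedSpace ℝ W₂]
  [NormedAddCommGroup W₃] [NormedSpace ℝ W₃]

/-- Domains on which one-sided calculus works: derivatives within the set are unique, and every
point is a limit of interior points. -/
structure IsCalcDomain (s : Set E4) : Prop where
  uniqueDiffOn : UniqueDiffOn ℝ s
  subset_closure : s ⊆ closure (interior s)

/-- A family of functions on `s` that is jointly smooth in the parameter and the point. -/
def SmoothFamily (s : Set E4) (γ : ℝ → E4 → W) : Prop :=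
  ContDiffOn ℝ ∞ (fun q : ℝ × E4 => γ q.1 q.2) (univ ×ˢ s)

/-- The velocity of the family `γ` at the parameter `t` is `δ`, at every point of `s`. -/
def HasVelocity (s : Set E4) (γ : ℝ → E4 → W) (δ : E4 → W) (t : ℝ) : Prop :=
  ∀ x ∈ s, HasDerivAt (fun t' => γ t' x) (δ x) t

variable {s : Set E4} {γ : ℝ → E4 → W} {δ : E4 → W} {t : ℝ} {x : E4}

theorem SmoothFamily.contDiffOn (h : SmoothFamily s γ) (t : ℝ) : ContDiffOn ℝ ∞ (γ t) s :=
  h.comp (contDiff_prodMk_right t).contDiffOn fun _ hx => ⟨mem_univ _, hx⟩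

theorem smoothFamily_const {f : E4 → W} (h : ContDiffOn ℝ ∞ f s) : SmoothFamily s fun _ => f :=
  h.comp contDiff_snd.contDiffOn fun _ hq => hq.2

theorem hasVelocity_const (f : E4 → W) : HasVelocity s (fun _ => f) 0 t :=
  fun x _ => hasDerivAt_const t (f x)

theorem SmoothFamily.clm (h : SmoothFamily s γ) (L : W →L[ℝ] W') :
    SmoothFamily s fun t x => L (γ t x) :=
  L.contDiff.comp_contDiffOn h

theorem HasVelocity.clm (h : HasVelocity s γ δ t) (L : W →L[ℝ] W') :
    HasVelocity s (fun t x => L (γ t x)) (fun x => L (δ x)) t :=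
  fun x hx => L.hasFDerivAt.comp_hasDerivAt t (h x hx)

theorem SmoothFamily.add {γ' : ℝ → E4 → W} (h : SmoothFamily s γ) (h' : SmoothFamily s γ') :
    SmoothFamily s fun t x => γ t x + γ' t x :=
  ContDiffOn.add h h'

theorem HasVelocity.add {γ' : ℝ → E4 → W} {δ' : E4 → W} (h : HasVelocity s γ δ t)
    (h' : HasVelocity s γ' δ' t) :
    HasVelocity s (fun t x => γ t x + γ' t x) (fun x => δ x + δ' x) t :=
  fun x hx => (h x hx).add (h' x hx)

theorem SmoothFamily.sub {γ' : ℝ → E4 → W} (h : SmoothFamily s γ) (h' : SmoothFamily s γ') :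
    SmoothFamily s fun t x => γ t x - γ' t x :=
  ContDiffOn.sub h h'

theorem SmoothFamily.const_smul (h : SmoothFamily s γ) (c : ℝ) :
    SmoothFamily s fun t x => c • γ t x :=
  ContDiffOn.const_smul c h

theorem HasVelocity.const_smul (h : HasVelocity s γ δ t) (c : ℝ) :
    HasVelocity s (fun t x => c • γ t x) (fun x => c • δ x) t :=
  fun x hx => (h x hx).const_smul c

theorem SmoothFamily.neg (h : SmoothFamily s γ) : SmoothFamily s fun t x => -γ t x :=
  ContDiffOn.neg h

theorem HasVelocity.neg (h : HasVelocity s γ δ t) :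
    HasVelocity s (fun t x => -γ t x) (fun x => -δ x) t :=
  fun x hx => (h x hx).neg

theorem SmoothFamily.prodMk {γ' : ℝ → E4 → W'} (h : SmoothFamily s γ) (h' : SmoothFamily s γ') :
    SmoothFamily s fun t x => (γ t x, γ' t x) :=
  ContDiffOn.prodMk h h'

theorem HasVelocity.prodMk {γ' : ℝ → E4 → W'} {δ' : E4 → W'} (h : HasVelocity s γ δ t)
    (h' : HasVelocity s γ' δ' t) :
    HasVelocity s (fun t x => (γ t x, γ' t x)) (fun x => (δ x, δ' x)) t :=
  fun x hx => (h x hx).prodMk (h' x hx)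

theorem SmoothFamily.bilin {γ₁ : ℝ → E4 → W₁} {γ₂ : ℝ → E4 → W₂} (h₁ : SmoothFamily s γ₁)
    (h₂ : SmoothFamily s γ₂) (b : W₁ →L[ℝ] W₂ →L[ℝ] W₃) :
    SmoothFamily s fun t x => b (γ₁ t x) (γ₂ t x) :=
  (b.contDiff.comp_contDiffOn h₁).clm_apply h₂

theorem HasVelocity.bilin {γ₁ : ℝ → E4 → W₁} {γ₂ : ℝ → E4 → W₂} {δ₁ : E4 → W₁} {δ₂ : E4 → W₂}
    (h₁ : HasVelocity s γ₁ δ₁ t) (h₂ : HasVelocity s γ₂ δ₂ t) (b : W₁ →L[ℝ] W₂ →L[ℝ] W₃) :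
    HasVelocity s (fun t x => b (γ₁ t x) (γ₂ t x))
      (fun x => b (δ₁ x) (γ₂ t x) + b (γ₁ t x) (δ₂ x)) t := fun x hx => by
  have := (b.hasFDerivAt.comp_hasDerivAt t (h₁ x hx)).clm_apply (h₂ x hx)
  exact this

theorem HasVelocity.congr {δ' : E4 → W} (h : HasVelocity s γ δ t) (hδ : EqOn δ δ' s) :
    HasVelocity s γ δ' t :=
  fun x hx => hδ hx ▸ h x hx

theorem HasVelocity.congr_family {γ' : ℝ → E4 → W} (h : HasVelocity s γ δ t)
    (hγ : ∀ t, EqOn (γ' t) (γ t) s) : HasVelocity s γ' δ t :=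
  fun x hx => (h x hx).congr_of_eventuallyEq (Eventually.of_forall fun t => hγ t hx)

/-- The straight line through `f` with direction `g`. -/
theorem smoothFamily_line {f g : E4 → W} (hf : ContDiffOn ℝ ∞ f s) (hg : ContDiffOn ℝ ∞ g s) :
    SmoothFamily s fun t x => f x + t • g x :=
  (smoothFamily_const hf).add (contDiff_fst.contDiffOn.smul (smoothFamily_const hg))

theorem hasVelocity_line (f g : E4 → W) : HasVelocity s (fun t x => f x + t • g x) g t :=
  fun x _ => by simpa using ((hasDerivAt_id t).smul_const (g x)).const_add (f x)

theorem IsCalcDomain.prod (hs : IsCalcDomain s) : UniqueDiffOn ℝ ((univ : Set ℝ) ×ˢ s) :=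
  uniqueDiffOn_univ.prod hs.uniqueDiffOn

theorem SmoothFamily.fderivWithin_eq (hs : IsCalcDomain s) (h : SmoothFamily s γ) (hx : x ∈ s) :
    fderivWithin ℝ (γ t) s x =
      (fderivWithin ℝ (fun q : ℝ × E4 => γ q.1 q.2) (univ ×ˢ s) (t, x)).comp
      (ContinuousLinearMap.inr ℝ ℝ E4) := by
  have h1 := ((h (t, x) ⟨mem_univ _, hx⟩).differentiableWithinAt (by simp)).hasFDerivWithinAt
  have h2 : HasFDerivWithinAt (fun y : E4 => (t, y)) (ContinuousLinearMap.inr ℝ ℝ E4) s x :=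
    (hasFDerivAt_prodMk_right t x).hasFDerivWithinAt
  exact (h1.comp x h2 fun y hy => ⟨mem_univ _, hy⟩).fderivWithin (hs.uniqueDiffOn x hx)

theorem SmoothFamily.fderivWithin (hs : IsCalcDomain s) (h : SmoothFamily s γ) :
    SmoothFamily s fun t x => fderivWithin ℝ (γ t) s x := by
  have h1 : ContDiffOn ℝ ∞ (_root_.fderivWithin ℝ (fun q : ℝ × E4 => γ q.1 q.2) (univ ×ˢ s))
      (univ ×ˢ s) := ContDiffOn.fderivWithin h hs.prod (by simp)
  refine (h1.clm_comp (contDiffOn_const (c := ContinuousLinearMap.inr ℝ ℝ E4))).congr ?_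
  rintro ⟨t, x⟩ ⟨-, hx⟩
  exact h.fderivWithin_eq hs hx

/-- Derivatives in the parameter and in space commute. -/
theorem HasVelocity.fderivWithin (hs : IsCalcDomain s) (h : SmoothFamily s γ)
    (hv : HasVelocity s γ δ t) :
    HasVelocity s (fun t x => fderivWithin ℝ (γ t) s x) (fun x => fderivWithin ℝ δ s x) t := by
  intro x hx
  set g : ℝ × E4 → W := fun q => γ q.1 q.2 with hg
  set D := (univ : Set ℝ) ×ˢ s with hD
  have hxD : ∀ t, (t, x) ∈ D := fun t => ⟨mem_univ _, hx⟩
  have hcl : (t, x) ∈ closure (interior D) := by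
    rw [hD, interior_prod_eq, closure_prod_eq, interior_univ, closure_univ]
    exact ⟨mem_univ _, hs.subset_closure hx⟩
  have h1 : ContDiffOn ℝ ∞ (_root_.fderivWithin ℝ g D) D :=
    ContDiffOn.fderivWithin h hs.prod (by simp)
  have hΓ : HasFDerivWithinAt (_root_.fderivWithin ℝ g D)
      (_root_.fderivWithin ℝ (_root_.fderivWithin ℝ g D) D (t, x)) D (t, x) :=
    ((h1 (t, x) (hxD t)).differentiableWithinAt (by simp)).hasFDerivWithinAt
  have hsymm := ContDiffWithinAt.isSymmSndFDerivWithinAt (h (t, x) (hxD t))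
    (by simpa using two_le_infty) hs.prod hcl (hxD t)
  have hδ : ∀ y ∈ s, δ y = _root_.fderivWithin ℝ g D (t, y) (1, 0) := by
    intro y hy
    have ha := ((h (t, y) ⟨mem_univ _, hy⟩).differentiableWithinAt (by simp)).hasFDerivWithinAt
    have hb : HasDerivAt (fun t' : ℝ => (t', y)) ((1 : ℝ), (0 : E4)) t :=
      (hasDerivAt_id t).prodMk (hasDerivAt_const t y)
    have hc := ha.comp_hasDerivWithinAt t (hb.hasDerivWithinAt (s := univ))
      (fun t' _ => (⟨mem_univ _, hy⟩ : (t', y) ∈ D))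
    rw [hasDerivWithinAt_univ] at hc
    exact (hv y hy).unique hc
  have e1 : HasDerivAt (fun t' => _root_.fderivWithin ℝ (γ t') s x)
      ((_root_.fderivWithin ℝ (_root_.fderivWithin ℝ g D) D (t, x) (1, 0)).comp
        (ContinuousLinearMap.inr ℝ ℝ E4)) t := by
    have hb : HasDerivAt (fun t' : ℝ => (t', x)) ((1 : ℝ), (0 : E4)) t :=
      (hasDerivAt_id t).prodMk (hasDerivAt_const t x)
    have hc := hΓ.comp_hasDerivWithinAt t (hb.hasDerivWithinAt (s := univ)) (fun t' _ => hxD t')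
    rw [hasDerivWithinAt_univ] at hc
    have hd := (((ContinuousLinearMap.compL ℝ E4 (ℝ × E4) W).flip
      (ContinuousLinearMap.inr ℝ ℝ E4)).hasFDerivAt).comp_hasDerivAt t hc
    refine hd.congr_of_eventuallyEq (Eventually.of_forall fun t' => ?_)
    exact h.fderivWithin_eq hs hx
  have e2 : _root_.fderivWithin ℝ δ s x =
      (_root_.fderivWithin ℝ (_root_.fderivWithin ℝ g D) D (t, x) (1, 0)).comp
        (ContinuousLinearMap.inr ℝ ℝ E4) := by
    have h2 : HasFDerivWithinAt (fun y : E4 => (t, y)) (ContinuousLinearMap.inr ℝ ℝ E4) s x :=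
      (hasFDerivAt_prodMk_right t x).hasFDerivWithinAt
    have h3 := (hΓ.comp x h2 fun y hy => ⟨mem_univ _, hy⟩).clm_apply
      (hasFDerivWithinAt_const ((1 : ℝ), (0 : E4)) x s)
    rw [fderivWithin_congr hδ (hδ x hx)]
    erw [h3.fderivWithin (hs.uniqueDiffOn x hx)]
    ext u
    have := hsymm.eq (0, u) (1, 0)
    simpa using this
  exact e1.congr_deriv e2.symm

end Families

section FormFamilies

variable {W W₁ W₂ W₃ : Type*} [NormedAddCommGroup W] [NormedSpace ℝ W]
  [NormedAddCommGroup W₁] [NormedSpace ℝ W₁] [NormedAddCommGroup W₂] [NormedSpace ℝ W₂]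
  [NormedAddCommGroup W₃] [NormedSpace ℝ W₃]
  {s : Set E4} {t : ℝ}

theorem SmoothFamily.extDerivWithin (hs : IsCalcDomain s) {p : ℕ}
    {γ : ℝ → E4 → E4 [⋀^Fin p]→L[ℝ] W} (h : SmoothFamily s γ) :
    SmoothFamily s fun t x => extDerivWithin (γ t) s x :=
  (h.fderivWithin hs).clm (ContinuousAlternatingMap.alternatizeUncurryFinCLM ℝ E4 W)

theorem HasVelocity.extDerivWithin (hs : IsCalcDomain s) {p : ℕ}
    {γ : ℝ → E4 → E4 [⋀^Fin p]→L[ℝ] W} {δ : E4 → E4 [⋀^Fin p]→L[ℝ] W} (h : SmoothFamily s γ)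
    (hv : HasVelocity s γ δ t) : HasVelocity s (fun t x => extDerivWithin (γ t) s x)
      (fun x => extDerivWithin δ s x) t :=
  (hv.fderivWithin hs h).clm (ContinuousAlternatingMap.alternatizeUncurryFinCLM ℝ E4 W)

variable [FiniteDimensional ℝ W₁]

theorem SmoothFamily.mapVal {p : ℕ} {γ : ℝ → E4 → E4 [⋀^Fin p]→L[ℝ] W₁} (h : SmoothFamily s γ)
    (f : W₁ →L[ℝ] W₂) : SmoothFamily s fun t x => mapVal f (γ t x) :=
  h.clm (mapValL f p)

theorem HasVelocity.mapVal {p : ℕ} {γ : ℝ → E4 → E4 [⋀^Fin p]→L[ℝ] W₁}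
    {δ : E4 → E4 [⋀^Fin p]→L[ℝ] W₁} (h : HasVelocity s γ δ t) (f : W₁ →L[ℝ] W₂) :
    HasVelocity s (fun t x => mapVal f (γ t x)) (fun x => mapVal f (δ x)) t :=
  h.clm (mapValL f p)

variable [FiniteDimensional ℝ W₂]

theorem SmoothFamily.wedge {p q : ℕ} {γ₁ : ℝ → E4 → E4 [⋀^Fin p]→L[ℝ] W₁}
    {γ₂ : ℝ → E4 → E4 [⋀^Fin q]→L[ℝ] W₂} (h₁ : SmoothFamily s γ₁) (h₂ : SmoothFamily s γ₂)
    (b : W₁ →L[ℝ] W₂ →L[ℝ] W₃) : SmoothFamily s fun t x => wedge b (γ₁ t x) (γ₂ t x) :=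
  h₁.bilin h₂ (wedgeL b p q)

theorem HasVelocity.wedge {p q : ℕ} {γ₁ : ℝ → E4 → E4 [⋀^Fin p]→L[ℝ] W₁}
    {γ₂ : ℝ → E4 → E4 [⋀^Fin q]→L[ℝ] W₂} {δ₁ : E4 → E4 [⋀^Fin p]→L[ℝ] W₁}
    {δ₂ : E4 → E4 [⋀^Fin q]→L[ℝ] W₂}
    (h₁ : HasVelocity s γ₁ δ₁ t) (h₂ : HasVelocity s γ₂ δ₂ t) (b : W₁ →L[ℝ] W₂ →L[ℝ] W₃) :
    HasVelocity s (fun t x => wedge b (γ₁ t x) (γ₂ t x))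
      (fun x => wedge b (δ₁ x) (γ₂ t x) + wedge b (γ₁ t x) (δ₂ x)) t :=
  h₁.bilin h₂ (wedgeL b p q)

theorem SmoothFamily.covDeriv (hs : IsCalcDomain s) {b : W₁ →L[ℝ] W₂ →L[ℝ] W₂}
    {A : ℝ → E4 → E4 [⋀^Fin 1]→L[ℝ] W₁} {γ : ℝ → E4 → E4 [⋀^Fin 1]→L[ℝ] W₂}
    (hA : SmoothFamily s A) (h : SmoothFamily s γ) :
    SmoothFamily s fun t x => covDeriv b s (A t) (γ t) x :=
  (h.extDerivWithin hs).add (hA.wedge h b)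

theorem HasVelocity.covDeriv (hs : IsCalcDomain s) {b : W₁ →L[ℝ] W₂ →L[ℝ] W₂}
    {A : ℝ → E4 → E4 [⋀^Fin 1]→L[ℝ] W₁} {γ : ℝ → E4 → E4 [⋀^Fin 1]→L[ℝ] W₂}
    {a : E4 → E4 [⋀^Fin 1]→L[ℝ] W₁} {δ : E4 → E4 [⋀^Fin 1]→L[ℝ] W₂}
    (h : SmoothFamily s γ) (hA : HasVelocity s A a t) (hv : HasVelocity s γ δ t) :
    HasVelocity s (fun t x => covDeriv b s (A t) (γ t) x)
      (fun x => covDeriv b s (A t) δ x + _root_.wedge b (a x) (γ t x)) t :=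
  ((hv.extDerivWithin hs h).add (hA.wedge hv b)).congr fun x _ => by
    simp only [_root_.covDeriv]; abel

theorem SmoothFamily.curvature (hs : IsCalcDomain s) {b : W₁ →L[ℝ] W₁ →L[ℝ] W₁}
    {A : ℝ → E4 → E4 [⋀^Fin 1]→L[ℝ] W₁} (hA : SmoothFamily s A) :
    SmoothFamily s fun t x => curvature b s (A t) x :=
  (hA.extDerivWithin hs).add ((hA.wedge hA b).const_smul (1 / 2))

/-- The variation of the curvature is the covariant derivative of the variation of the
connection. -/
theorem HasVelocity.curvature (hs : IsCalcDomain s) {A : ℝ → E4 → E4 [⋀^Fin 1]→L[ℝ] so31}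
    {a : E4 → E4 [⋀^Fin 1]→L[ℝ] so31} (h : SmoothFamily s A) (hA : HasVelocity s A a t) :
    HasVelocity s (fun t x => curvature bracketG s (A t) x)
      (fun x => _root_.covDeriv bracketG s (A t) a x) t := by
  refine HasVelocity.congr ((hA.extDerivWithin hs h).add
    ((hA.wedge hA bracketG).const_smul (1 / 2))) fun x _ => ?_
  have : (_root_.wedge bracketG (a x) (A t x) : E4 [⋀^Fin 2]→L[ℝ] so31) =
      _root_.wedge bracketG (A t x) (a x) := by
    ext v : 1
    rw [wedge_one_one, wedge_one_one]
    have hb : ∀ X Y : so31, bracketG X Y = -bracketG Y X := fun X Y => (lie_skew X Y).symm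
    rw [hb (a x _), hb (a x _)]
    abel
  simp only [_root_.covDeriv]
  rw [this]
  simp only [Nat.reduceAdd]
  module

end FormFamilies

/-! ### Stokes' theorem and the fundamental lemma of the calculus of variations -/

section Integration

variable {s K : Set E4}

theorem integral_fderiv_apply_eq_zero {f : E4 → ℝ} (hf : ContDiff ℝ ∞ f)
    (hc : HasCompactSupport f) (v : E4) :
    Integrable (fun x => fderiv ℝ f x v) ∧ ∫ x, fderiv ℝ f x v = 0 := by
  have hi : Integrable (fun x => fderiv ℝ f x v) :=
    Continuous.integrable_of_hasCompactSupport
      ((hf.continuous_fderiv (by simp)).clm_apply continuous_const) (hc.fderiv_apply ℝ v)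
  refine ⟨hi, ?_⟩
  have := integral_mul_fderiv_eq_neg_fderiv_mul_of_integrable (μ := (volume : Measure E4))
    (f := fun _ : E4 => (1 : ℝ)) (g := f) (v := v) (by simp) (by simpa using hi)
    (by simpa using hf.continuous.integrable_of_hasCompactSupport hc)
    (fun x _ => by fun_prop) (fun x _ => (hf.differentiable (by simp)).differentiableAt)
  simpa using this

/-- Stokes' theorem for a three-form with compact support in the interior of the domain. -/
theorem integral_extDerivWithin_eq_zero {Y : E4 → E4 [⋀^Fin 3]→L[ℝ] ℝ} (hm : MeasurableSet s)
    (hY : ContDiffOn ℝ ∞ Y s) (hK : IsCompact K) (hKs : K ⊆ interior s)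
    (h0 : ∀ x ∈ s, x ∉ K → Y x = 0) :
    IntegrableOn (fun x => (extDerivWithin Y s x : E4 [⋀^Fin 4]→L[ℝ] ℝ) frame) s ∧
      ∫ x in s, (extDerivWithin Y s x : E4 [⋀^Fin 4]→L[ℝ] ℝ) frame = 0 := by
  classical
  set Z : E4 → E4 [⋀^Fin 3]→L[ℝ] ℝ := K.indicator Y with hZ
  have hZY : ∀ x ∈ s, Z x = Y x := fun x hx => by
    by_cases hxK : x ∈ K
    · simp [hZ, hxK]
    · simp [hZ, hxK, h0 x hx hxK]
  have hZ0 : ∀ x ∉ K, Z =ᶠ[𝓝 x] 0 := fun x hx => by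
    filter_upwards [hK.isClosed.isOpen_compl.mem_nhds hx] with y hy
    exact indicator_of_notMem hy _
  have hZs : ContDiff ℝ ∞ Z := by
    rw [contDiff_iff_contDiffAt]
    intro x
    by_cases hx : x ∈ K
    · have hn : s ∈ 𝓝 x := mem_interior_iff_mem_nhds.1 (hKs hx)
      refine (hY.contDiffAt hn).congr_of_eventuallyEq ?_
      filter_upwards [hn] with y hy using hZY y hy
    · exact contDiffAt_const.congr_of_eventuallyEq (hZ0 x hx)
  have hZc : HasCompactSupport Z := HasCompactSupport.intro hK fun x hx =>
    indicator_of_notMem hx _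
  have hd : ∀ x ∈ s, extDerivWithin Y s x = extDeriv Z x := fun x hx => by
    by_cases hxK : x ∈ K
    · have hn : s ∈ 𝓝 x := mem_interior_iff_mem_nhds.1 (hKs hxK)
      rw [extDerivWithin, fderivWithin_of_mem_nhds hn, ← extDeriv]
      exact (Filter.EventuallyEq.extDeriv_eq (by
        filter_upwards [hn] with y hy using (hZY y hy).symm))
    · rw [(hZ0 x hxK).extDeriv_eq]
      have : Y =ᶠ[𝓝[s] x] 0 := by
        filter_upwards [self_mem_nhdsWithin,
          mem_nhdsWithin_of_mem_nhds (hK.isClosed.isOpen_compl.mem_nhds hxK)] with y hy hyK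
          using h0 y hy hyK
      rw [this.extDerivWithin_eq (h0 x hx hxK)]
      simp [extDerivWithin, extDeriv, Pi.zero_def]
  have hd0 : ∀ x ∉ s, (extDeriv Z x : E4 [⋀^Fin 4]→L[ℝ] ℝ) frame = 0 := fun x hx => by
    rw [(hZ0 x fun h => hx (interior_subset (hKs h))).extDeriv_eq]
    simp [extDeriv, Pi.zero_def, ContinuousAlternatingMap.alternatizeUncurryFin_apply]
  have hcoord : ∀ v : Fin 3 → E4, ContDiff ℝ ∞ (fun x => Z x v) ∧
      HasCompactSupport (fun x => Z x v) := fun v =>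
    ⟨(ContinuousAlternatingMap.apply ℝ E4 ℝ v).contDiff.comp hZs,
      hZc.comp_left (g := fun α : E4 [⋀^Fin 3]→L[ℝ] ℝ => α v) rfl⟩
  have hform : ∀ x, (extDeriv Z x : E4 [⋀^Fin 4]→L[ℝ] ℝ) frame =
      ∑ i : Fin 4, (-1) ^ i.val • fderiv ℝ (Z · (i.removeNth frame)) x (frame i) := fun x =>
    extDeriv_apply (hZs.differentiable (by simp)).differentiableAt _
  have hterm := fun i : Fin 4 => integral_fderiv_apply_eq_zero (hcoord (i.removeNth frame)).1
    (hcoord (i.removeNth frame)).2 (frame i)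
  have hint : Integrable (fun x => (extDeriv Z x : E4 [⋀^Fin 4]→L[ℝ] ℝ) frame) := by
    simp only [hform]
    exact integrable_finsetSum _ fun i _ => (hterm i).1.smul ((-1 : ℤ) ^ i.val)
  have hval : ∫ x, (extDeriv Z x : E4 [⋀^Fin 4]→L[ℝ] ℝ) frame = 0 := by
    simp only [hform]
    rw [integral_finsetSum]
    · refine Finset.sum_eq_zero fun i _ => ?_
      simp only [zsmul_eq_mul]
      rw [integral_const_mul, (hterm i).2, mul_zero]
    · exact fun i _ => (hterm i).1.smul ((-1 : ℤ) ^ i.val)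
  have heq : ∫ x in s, (extDeriv Z x : E4 [⋀^Fin 4]→L[ℝ] ℝ) frame = 0 := by
    rw [setIntegral_eq_integral_of_forall_compl_eq_zero hd0, hval]
  exact ⟨hint.integrableOn.congr_fun (fun x hx => by simp only [hd x hx]) hm,
    heq ▸ setIntegral_congr_fun hm fun x hx => by simp only [hd x hx]⟩

/-- The fundamental lemma of the calculus of variations. Test functions have support in the interior
of the domain, which is dense in it. -/
theorem eqOn_zero_of_forall_integral_eq_zero (hs : IsCalcDomain s) {f : E4 → ℝ}
    (hf : ContinuousOn f s)
    (h : ∀ φ : E4 → ℝ, ContDiff ℝ ∞ φ → HasCompactSupport φ → tsupport φ ⊆ interior s →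
      ∫ x in s, φ x * f x = 0) : ∀ x ∈ s, f x = 0 := by
  have hfi : ContinuousOn f (interior s) := hf.mono interior_subset
  have hae := isOpen_interior.ae_eq_zero_of_integral_contDiff_smul_eq_zero (μ := volume)
    (f := f) (U := interior s)
    (hfi.locallyIntegrableOn isOpen_interior.measurableSet) fun φ h1 h2 h3 => by
      rw [← h φ h1 h2 h3]
      refine (setIntegral_eq_integral_of_forall_compl_eq_zero fun x hx => ?_).symm
      rw [image_eq_zero_of_notMem_tsupport fun hx' => hx (interior_subset (h3 hx')), zero_smul]
  have h1 : EqOn f 0 (interior s) := by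
    refine Measure.eqOn_of_ae_eq (μ := volume) ?_ hfi continuousOn_const
      (by rw [interior_interior]; exact subset_closure)
    rw [EventuallyEq, ae_restrict_iff' isOpen_interior.measurableSet]
    exact hae
  exact h1.of_subset_closure hf continuousOn_const interior_subset hs.subset_closure

theorem frame_eq_basis : frame = (EuclideanSpace.basisFun (Fin 4) ℝ).toBasis := by
  ext i : 1; simp [frame]

end Integration

section Nondegenerate

variable {W₁ W₂ : Type*} [NormedAddCommGroup W₁] [NormedSpace ℝ W₁] [NormedAddCommGroup W₂]
  [NormedSpace ℝ W₂]

/-- The coordinate one-form `dxⁱ` with a vector coefficient. -/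
noncomputable def coordForm (i : Fin 4) (w : W₁) : E4 [⋀^Fin 1]→L[ℝ] W₁ :=
  ContinuousAlternatingMap.ofSubsingleton ℝ E4 W₁ (0 : Fin 1)
    ((EuclideanSpace.proj i : E4 →L[ℝ] ℝ).smulRight w)

theorem coordForm_apply (i : Fin 4) (w : W₁) (v : Fin 1 → E4) : coordForm i w v = v 0 i • w := rfl

theorem frame_apply (i j : Fin 4) : frame i j = if j = i then 1 else 0 := by
  simp [frame]

/-- A two-form is determined by its wedge products with the decomposable constant two-forms. -/
theorem two_form_eq_zero {U U' : Type*} [NormedAddCommGroup U] [NormedSpace ℝ U]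
    [NormedAddCommGroup U'] [NormedSpace ℝ U']
    (b : W₁ →L[ℝ] W₂ →L[ℝ] ℝ) (m : U →L[ℝ] U' →L[ℝ] W₂)
    (hb : ∀ w, (∀ u u', b w (m u u') = 0) → w = 0) (α : E4 [⋀^Fin 2]→L[ℝ] W₁)
    (h : ∀ i j u u', (wedge b α (wedge m (coordForm i u) (coordForm j u') : E4 [⋀^Fin 2]→L[ℝ] W₂) :
      E4 [⋀^Fin 4]→L[ℝ] ℝ) frame = 0) : α = 0 := by
  have hij : ∀ i j : Fin 4, i < j → α ![frame i, frame j] = 0 := by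
    intro i j hij
    refine hb _ fun u u' => ?_
    have h' := fun k l => h k l u u'
    simp only [wedge_two_two, wedge_one_one, coordForm_apply] at h'
    fin_cases i <;> fin_cases j <;> simp at hij
    · simpa [frame_apply] using h' 2 3
    · simpa [frame_apply] using h' 1 3
    · simpa [frame_apply] using h' 1 2
    · simpa [frame_apply] using h' 0 3
    · simpa [frame_apply] using h' 0 2
    · simpa [frame_apply] using h' 0 1
  have hall : ∀ i j : Fin 4, α ![frame i, frame j] = 0 := by
    intro i j
    rcases lt_trichotomy i j with h | rfl | h
    · exact hij i j h
    · have := two_form_swap α (frame i) (frame i)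
      have h2 : (2 : ℝ) • α ![frame i, frame i] = 0 := by rw [two_smul]; nth_rewrite 1 [this]; simp
      exact (smul_eq_zero.1 h2).resolve_left two_ne_zero
    · rw [two_form_swap, hij j i h, neg_zero]
  apply ContinuousAlternatingMap.toAlternatingMap_injective
  refine (EuclideanSpace.basisFun (Fin 4) ℝ).toBasis.ext_alternating fun v _ => ?_
  have := hall (v 0) (v 1)
  rw [frame_eq_basis] at this
  refine Eq.trans ?_ this
  change α _ = α _
  congr 1
  ext i : 1
  fin_cases i <;> rfl

theorem two_form_eq_zero_of_forall_wedge (b : W₁ →L[ℝ] W₂ →L[ℝ] ℝ)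
    (hb : ∀ w, (∀ w', b w w' = 0) → w = 0) (α : E4 [⋀^Fin 2]→L[ℝ] W₁)
    (h : ∀ γ : E4 [⋀^Fin 2]→L[ℝ] W₂, (wedge b α γ : E4 [⋀^Fin 4]→L[ℝ] ℝ) frame = 0) : α = 0 :=
  two_form_eq_zero b (ContinuousLinearMap.lsmul ℝ ℝ)
    (fun w hw => hb w fun w' => by simpa using hw 1 w') α fun _ _ _ _ => h _

end Nondegenerate

/-! ### Local operators -/

section LocalOperators

variable {X X' : Type*} {W W' W₁ W₂ W₃ : Type*} [NormedAddCommGroup W] [NormedSpace ℝ W]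
  [NormedAddCommGroup W'] [NormedSpace ℝ W']
  [NormedAddCommGroup W₁] [NormedSpace ℝ W₁] [NormedAddCommGroup W₂] [NormedSpace ℝ W₂]
  [NormedAddCommGroup W₃] [NormedSpace ℝ W₃]

/-- Jets of order `N` of `W`-valued functions, at a point. -/
abbrev Jet (N : ℕ) (W : Type*) [NormedAddCommGroup W] [NormedSpace ℝ W] : Type _ :=
  (j : Fin (N + 1)) → E4 [×(j : ℕ)]→L[ℝ] W

/-- The jet of a function at a point of `s`. -/
noncomputable def jet (s : Set E4) (N : ℕ) (f : E4 → W) (x : E4) : Jet N W :=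
  fun j => iteratedFDerivWithin ℝ (j : ℕ) f s x

/-- The operator `p` is local with respect to the representation `r`: on `s`, the function `p u`
is a smooth function of the point and of a jet of `r u`. -/
def LocalOn (s : Set E4) (F : Set X) (r : X → E4 → W) (p : X → E4 → W') : Prop :=
  ∃ (N : ℕ) (G : E4 × Jet N W → W'), ContDiffOn ℝ ∞ G (s ×ˢ univ) ∧
    ∀ u ∈ F, ∀ x ∈ s, p u x = G (x, jet s N (r u) x)

variable {s : Set E4} {F : Set X} {r : X → E4 → W}

/-- Truncation of jets. -/
noncomputable def jetTrunc {N N' : ℕ} (h : N ≤ N') : Jet N' W →L[ℝ] Jet N W :=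
  ContinuousLinearMap.pi fun j =>
    ContinuousLinearMap.proj (R := ℝ) (φ := fun j : Fin (N' + 1) => E4 [×(j : ℕ)]→L[ℝ] W)
      (Fin.castLE (Nat.succ_le_succ h) j)

theorem jetTrunc_jet {N N' : ℕ} (h : N ≤ N') (f : E4 → W) (x : E4) :
    jetTrunc h (jet s N' f x) = jet s N f x := rfl

theorem LocalOn.exists_order {p : X → E4 → W'} (hp : LocalOn s F r p) :
    ∃ N : ℕ, ∀ N' ≥ N, ∃ G : E4 × Jet N' W → W', ContDiffOn ℝ ∞ G (s ×ˢ univ) ∧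
      ∀ u ∈ F, ∀ x ∈ s, p u x = G (x, jet s N' (r u) x) := by
  obtain ⟨N, G, hG, h⟩ := hp
  refine ⟨N, fun N' hN => ⟨fun q => G (q.1, jetTrunc hN q.2), ?_, fun u hu x hx => ?_⟩⟩
  · have h1 : ContDiff ℝ ∞ fun q : E4 × Jet N' W => (q.1, jetTrunc (W := W) hN q.2) :=
      contDiff_fst.prodMk ((jetTrunc (W := W) hN : Jet N' W →L[ℝ] Jet N W).contDiff.comp
        (contDiff_snd (E := E4) (F := Jet N' W)))
    exact hG.comp h1.contDiffOn fun q hq => ⟨hq.1, mem_univ _⟩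
  · simp only [jetTrunc_jet]
    exact h u hu x hx

theorem LocalOn.congr {p p' : X → E4 → W'} (hp : LocalOn s F r p)
    (h : ∀ u ∈ F, ∀ x ∈ s, p' u x = p u x) : LocalOn s F r p' := by
  obtain ⟨N, G, hG, hpG⟩ := hp
  exact ⟨N, G, hG, fun u hu x hx => (h u hu x hx).trans (hpG u hu x hx)⟩

theorem localOn_fixed {σ : E4 → W'} (hσ : ContDiffOn ℝ ∞ σ s) : LocalOn s F r fun _ => σ :=
  ⟨0, fun q => σ q.1, hσ.comp contDiff_fst.contDiffOn fun _ hq => hq.1, fun _ _ _ _ => rfl⟩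

theorem localOn_self : LocalOn s F r r :=
  ⟨0, fun q => continuousMultilinearCurryFin0 ℝ E4 W (q.2 0),
    ((continuousMultilinearCurryFin0 ℝ E4 W).contDiff.comp
      ((ContinuousLinearMap.proj (R := ℝ) (φ := fun j : Fin (0 + 1) => E4 [×(j : ℕ)]→L[ℝ] W)
        0).contDiff.comp contDiff_snd)).contDiffOn,
    fun u _ x _ => by simp [jet]⟩

theorem LocalOn.prodMk {p : X → E4 → W₁} {q : X → E4 → W₂} (hp : LocalOn s F r p)
    (hq : LocalOn s F r q) : LocalOn s F r fun u x => (p u x, q u x) := by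
  obtain ⟨N, hN⟩ := hp.exists_order
  obtain ⟨N', hN'⟩ := hq.exists_order
  obtain ⟨G, hG, h⟩ := hN (max N N') (le_max_left _ _)
  obtain ⟨G', hG', h'⟩ := hN' (max N N') (le_max_right _ _)
  exact ⟨_, fun y => (G y, G' y), hG.prodMk hG', fun u hu x hx =>
    Prod.ext (h u hu x hx) (h' u hu x hx)⟩

theorem LocalOn.comp_contDiff {p : X → E4 → W₁} (hp : LocalOn s F r p) {φ : W₁ → W₂}
    (hφ : ContDiff ℝ ∞ φ) : LocalOn s F r fun u x => φ (p u x) := by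
  obtain ⟨N, G, hG, h⟩ := hp
  exact ⟨N, fun q => φ (G q), hφ.comp_contDiffOn hG, fun u hu x hx => congrArg φ (h u hu x hx)⟩

theorem LocalOn.clm {p : X → E4 → W₁} (hp : LocalOn s F r p) (L : W₁ →L[ℝ] W₂) :
    LocalOn s F r fun u x => L (p u x) :=
  hp.comp_contDiff L.contDiff

theorem LocalOn.bilin {p : X → E4 → W₁} {q : X → E4 → W₂} (hp : LocalOn s F r p)
    (hq : LocalOn s F r q) (b : W₁ →L[ℝ] W₂ →L[ℝ] W₃) :
    LocalOn s F r fun u x => b (p u x) (q u x) :=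
  (hp.prodMk hq).comp_contDiff (φ := fun y : W₁ × W₂ => b y.1 y.2)
    ((b.contDiff.comp contDiff_fst).clm_apply contDiff_snd)

theorem LocalOn.add {p q : X → E4 → W'} (hp : LocalOn s F r p) (hq : LocalOn s F r q) :
    LocalOn s F r fun u x => p u x + q u x :=
  (hp.prodMk hq).comp_contDiff (φ := fun y : W' × W' => y.1 + y.2) (contDiff_fst.add contDiff_snd)

theorem LocalOn.const_smul {p : X → E4 → W'} (hp : LocalOn s F r p) (c : ℝ) :
    LocalOn s F r fun u x => c • p u x :=
  hp.comp_contDiff (contDiff_id.const_smul c)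

theorem LocalOn.neg {p : X → E4 → W'} (hp : LocalOn s F r p) :
    LocalOn s F r fun u x => -p u x :=
  hp.comp_contDiff contDiff_neg

theorem LocalOn.pi {κ : Type*} [Fintype κ] {V : κ → Type*} [∀ i, NormedAddCommGroup (V i)]
    [∀ i, NormedSpace ℝ (V i)] {p : ∀ i, X → E4 → V i} (hp : ∀ i, LocalOn s F r (p i)) :
    LocalOn s F r fun u x i => p i u x := by
  choose N hN using fun i => (hp i).exists_order
  choose G hG h using fun i => hN i (Finset.univ.sup N) (Finset.le_sup (Finset.mem_univ i))
  exact ⟨_, fun y i => G i y, contDiffOn_pi.2 hG, fun u hu x hx => funext fun i => h i u hu x hx⟩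

theorem contDiffOn_jet (hs : UniqueDiffOn ℝ s) {f : E4 → W} (hf : ContDiffOn ℝ ∞ f s) (N : ℕ) :
    ContDiffOn ℝ ∞ (jet s N f) s :=
  contDiffOn_pi.2 fun j x hx => (hf x hx).iteratedFDerivWithin_right hs
    (WithTop.coe_le_coe.2 (le_top (a := (⊤ + (j : ℕ) : ℕ∞)))) hx

theorem LocalOn.contDiffOn (hs : UniqueDiffOn ℝ s) {p : X → E4 → W'} (hp : LocalOn s F r p)
    {u : X} (hu : u ∈ F) (hr : ContDiffOn ℝ ∞ (r u) s) : ContDiffOn ℝ ∞ (p u) s := by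
  obtain ⟨N, G, hG, h⟩ := hp
  exact (hG.comp (contDiffOn_id.prodMk (contDiffOn_jet hs hr N))
    fun x hx => ⟨hx, mem_univ _⟩).congr fun x hx => h u hu x hx

theorem hasFDerivWithinAt_jet (hs : UniqueDiffOn ℝ s) {f : E4 → W} (hf : ContDiffOn ℝ ∞ f s)
    (N : ℕ) {x : E4} (hx : x ∈ s) :
    HasFDerivWithinAt (jet s N f) (ContinuousLinearMap.pi fun j : Fin (N + 1) =>
      (jet s (N + 1) f x j.succ).curryLeft) s x := by
  rw [hasFDerivWithinAt_pi']
  intro j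
  have h := (contDiffOn_pi.1 (contDiffOn_jet hs hf N) j x hx).differentiableWithinAt (by simp)
  exact h.hasFDerivWithinAt

theorem contDiff_curryLeft (n : ℕ) :
    ContDiff ℝ ∞ fun f : E4 [×(n + 1)]→L[ℝ] W => f.curryLeft := by
  refine ContinuousLinearMap.contDiff (𝕜 := ℝ) (E := E4 [×(n + 1)]→L[ℝ] W)
    (F := E4 →L[ℝ] E4 [×n]→L[ℝ] W) (LinearMap.mkContinuous
      { toFun := fun f => f.curryLeft, map_add' := fun _ _ => rfl, map_smul' := fun _ _ => rfl } 1
      fun f => ?_)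
  rw [one_mul]
  exact (ContinuousMultilinearMap.curryLeft_norm f).le

/-- The derivative of a local operator is local: its symbol is the total derivative of the
symbol. -/
theorem LocalOn.fderivWithin (hs : UniqueDiffOn ℝ s) (hr : ∀ u ∈ F, ContDiffOn ℝ ∞ (r u) s)
    {p : X → E4 → W'} (hp : LocalOn s F r p) :
    LocalOn s F r fun u x => fderivWithin ℝ (p u) s x := by
  obtain ⟨N, G, hG, h⟩ := hp
  set D := s ×ˢ (univ : Set (Jet N W)) with hD
  have hDu : UniqueDiffOn ℝ D := hs.prod uniqueDiffOn_univ
  let tr : E4 × Jet (N + 1) W → E4 × Jet N W := fun q => (q.1, jetTrunc N.le_succ q.2)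
  have htr : ContDiff ℝ ∞ tr :=
    contDiff_fst.prodMk ((jetTrunc (W := W) N.le_succ).contDiff.comp contDiff_snd)
  have hDG : ContDiffOn ℝ ∞ (fun q => _root_.fderivWithin ℝ G D (tr q)) (s ×ˢ univ) :=
    (hG.fderivWithin hDu (m := ∞) (by simp)).comp htr.contDiffOn fun q hq => ⟨hq.1, mem_univ _⟩
  let c : ∀ j : Fin (N + 1), E4 × Jet (N + 1) W → E4 →L[ℝ] E4 [×(j : ℕ)]→L[ℝ] W :=
    fun j q => (q.2 j.succ).curryLeft
  have hc : ∀ j, ContDiff ℝ ∞ (c j) := fun j =>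
    have h1 : ContDiff ℝ ∞ fun q : E4 × Jet (N + 1) W => q.2 j.succ :=
      contDiff_pi.1 (contDiff_snd (E := E4) (F := Jet (N + 1) W)) j.succ
    (contDiff_curryLeft (W := W) j).comp h1
  refine ⟨N + 1, fun q => (_root_.fderivWithin ℝ G D (tr q)).comp (ContinuousLinearMap.inl ℝ E4 _) +
    ∑ j, ((_root_.fderivWithin ℝ G D (tr q)).comp ((ContinuousLinearMap.inr ℝ E4 _).comp
      (ContinuousLinearMap.single ℝ (fun j : Fin (N + 1) => E4 [×(j : ℕ)]→L[ℝ] W) j))).comp (c j q),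
    ?_, ?_⟩
  · refine (hDG.clm_comp contDiffOn_const).add (ContDiffOn.sum fun j _ => ?_)
    exact (hDG.clm_comp contDiffOn_const).clm_comp (hc j).contDiffOn
  · intro u hu x hx
    have h1 := (hG (x, jet s N (r u) x) ⟨hx, mem_univ _⟩).differentiableWithinAt (by simp)
    have h2 := (hasFDerivWithinAt_id x s).prodMk (hasFDerivWithinAt_jet hs (hr u hu) N hx)
    have h3 := (h1.hasFDerivWithinAt.comp x h2
      fun y hy => (⟨hy, mem_univ _⟩ : (id y, jet s N (r u) y) ∈ D)).congr
      (fun y hy => h u hu y hy) (h u hu x hx)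
    refine (h3.fderivWithin (hs x hx)).trans ?_
    ext v
    simp only [ContinuousLinearMap.comp_apply, add_apply,
      sum_apply, ContinuousLinearMap.prod_apply]
    rw [← map_sum, ← map_sum, ← map_add]
    congr 1
    refine Prod.ext (by simp [Prod.fst_sum]) ?_
    simp only [ContinuousLinearMap.inl_apply, ContinuousLinearMap.inr_apply, Prod.snd_add, zero_add]
    exact (Finset.univ_sum_single _).symm

theorem LocalOn.iteratedFDerivWithin (hs : UniqueDiffOn ℝ s)
    (hr : ∀ u ∈ F, ContDiffOn ℝ ∞ (r u) s) {p : X → E4 → W'} (hp : LocalOn s F r p) (n : ℕ) :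
    LocalOn s F r fun u x => iteratedFDerivWithin ℝ n (p u) s x := by
  induction n with
  | zero =>
    exact hp.comp_contDiff (continuousMultilinearCurryFin0 ℝ E4 W').symm.contDiff
  | succ n ih =>
    exact (ih.fderivWithin hs hr).comp_contDiff
      (continuousMultilinearCurryLeftEquiv ℝ (fun _ : Fin (n + 1) => E4) W').symm.contDiff

/-- Local operators compose. -/
theorem LocalOn.comp (hs : UniqueDiffOn ℝ s) (hr : ∀ u ∈ F, ContDiffOn ℝ ∞ (r u) s) {F' : Set X'}
    {r' : X' → E4 → W'} {f : X → X'} (hf : MapsTo f F F') (hrf : LocalOn s F r fun u => r' (f u))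
    {p : X' → E4 → W₁} (hp : LocalOn s F' r' p) : LocalOn s F r fun u => p (f u) := by
  obtain ⟨N, G, hG, h⟩ := hp
  have hj : LocalOn s F r fun u x => jet s N (r' (f u)) x :=
    LocalOn.pi fun j => hrf.iteratedFDerivWithin hs hr j
  obtain ⟨N', G', hG', h'⟩ := hj
  refine ⟨N', fun q => G (q.1, G' q), hG.comp (contDiff_fst.contDiffOn.prodMk hG')
    fun q hq => ⟨hq.1, mem_univ _⟩, fun u hu x hx => ?_⟩
  simp only [← h' u hu x hx]
  exact h (f u) (hf hu) x hx

theorem LocalOn.extDerivWithin (hs : UniqueDiffOn ℝ s) (hr : ∀ u ∈ F, ContDiffOn ℝ ∞ (r u) s)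
    {n : ℕ} {p : X → E4 → E4 [⋀^Fin n]→L[ℝ] W'} (hp : LocalOn s F r p) :
    LocalOn s F r fun u x => extDerivWithin (p u) s x :=
  (hp.fderivWithin hs hr).clm (ContinuousAlternatingMap.alternatizeUncurryFinCLM ℝ E4 W')

variable [FiniteDimensional ℝ W₁]

theorem LocalOn.mapVal {n : ℕ} {p : X → E4 → E4 [⋀^Fin n]→L[ℝ] W₁} (hp : LocalOn s F r p)
    (f : W₁ →L[ℝ] W₂) : LocalOn s F r fun u x => mapVal f (p u x) :=
  hp.clm (mapValL f n)

variable [FiniteDimensional ℝ W₂]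

theorem LocalOn.wedge {m n : ℕ} {p : X → E4 → E4 [⋀^Fin m]→L[ℝ] W₁}
    {q : X → E4 → E4 [⋀^Fin n]→L[ℝ] W₂} (hp : LocalOn s F r p) (hq : LocalOn s F r q)
    (b : W₁ →L[ℝ] W₂ →L[ℝ] W₃) : LocalOn s F r fun u x => wedge b (p u x) (q u x) :=
  hp.bilin hq (wedgeL b m n)

theorem LocalOn.covDeriv (hs : UniqueDiffOn ℝ s) (hr : ∀ u ∈ F, ContDiffOn ℝ ∞ (r u) s)
    {b : W₁ →L[ℝ] W₂ →L[ℝ] W₂} {p : X → E4 → E4 [⋀^Fin 1]→L[ℝ] W₁}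
    {q : X → E4 → E4 [⋀^Fin 1]→L[ℝ] W₂} (hp : LocalOn s F r p) (hq : LocalOn s F r q) :
    LocalOn s F r fun u x => covDeriv b s (p u) (q u) x :=
  (hq.extDerivWithin hs hr).add (hp.wedge hq b)

theorem LocalOn.curvature (hs : UniqueDiffOn ℝ s) (hr : ∀ u ∈ F, ContDiffOn ℝ ∞ (r u) s)
    {b : W₁ →L[ℝ] W₁ →L[ℝ] W₁} {p : X → E4 → E4 [⋀^Fin 1]→L[ℝ] W₁} (hp : LocalOn s F r p) :
    LocalOn s F r fun u x => curvature b s (p u) x :=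
  (hp.extDerivWithin hs hr).add ((hp.wedge hp b).const_smul _)

end LocalOperators

/-! ### Coordinate domains and changes of patch -/

namespace MinkowskiBundle

variable {H : Type*} [TopologicalSpace H] {I : ModelWithCorners ℝ E4 H}
  {M : Type*} [TopologicalSpace M] [ChartedSpace H M] {ι : Type*}
  (Z : MinkowskiBundle I M ι) {k k' k'' : Patch H M ι} {x y : E4}

theorem isOpen_region (k : Patch H M ι) : IsOpen (Z.region k) :=
  k.2.1.open_source.inter (Z.isOpen_baseSet k.1)

/-- The part of the range of a chart over an open set of `M` is relatively open in the model
domain `range I`. -/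
theorem exists_isOpen_eq_inter_range (k : Patch H M ι) {O : Set M} (hO : IsOpen O) :
    ∃ U : Set E4, IsOpen U ∧ (k.2.1.extend I).target ∩ Z.pt k ⁻¹' O = U ∩ range I := by
  refine ⟨I.symm ⁻¹' (k.2.1.target ∩ k.2.1.symm ⁻¹' O),
    (k.2.1.isOpen_inter_preimage_symm hO).preimage I.continuous_symm, ?_⟩
  rw [OpenPartialHomeomorph.extend_target]
  ext x
  simp only [mem_inter_iff, mem_preimage, pt, OpenPartialHomeomorph.extend_coe_symm,
    Function.comp_apply]
  tauto

theorem exists_dom_eq (k : Patch H M ι) :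
    ∃ U : Set E4, IsOpen U ∧ Z.dom k = U ∩ range I :=
  Z.exists_isOpen_eq_inter_range k (Z.isOpen_baseSet k.1)

theorem exists_overlap_eq (k k' : Patch H M ι) :
    ∃ U : Set E4, IsOpen U ∧ Z.overlap k k' = U ∩ range I := by
  obtain ⟨U, hU, h⟩ := Z.exists_isOpen_eq_inter_range k
    ((Z.isOpen_baseSet k.1).inter (Z.isOpen_region k'))
  exact ⟨U, hU, by rw [← h, overlap, dom, preimage_inter, inter_assoc]⟩

theorem isCalcDomain_inter_range {U : Set E4} (hU : IsOpen U) : IsCalcDomain (U ∩ range I) where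
  uniqueDiffOn := by rw [inter_comm]; exact I.uniqueDiffOn.inter hU
  subset_closure := by
    rw [interior_inter, hU.interior_eq]
    exact (inter_subset_inter_right U I.range_subset_closure_interior).trans hU.inter_closure

theorem isCalcDomain_dom (k : Patch H M ι) : IsCalcDomain (Z.dom k) := by
  obtain ⟨U, hU, h⟩ := Z.exists_dom_eq k
  exact h ▸ isCalcDomain_inter_range hU

theorem isCalcDomain_overlap (k k' : Patch H M ι) : IsCalcDomain (Z.overlap k k') := by
  obtain ⟨U, hU, h⟩ := Z.exists_overlap_eq k k'
  exact h ▸ isCalcDomain_inter_range hU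

theorem measurableSet_dom (k : Patch H M ι) : MeasurableSet (Z.dom k) := by
  obtain ⟨U, hU, h⟩ := Z.exists_dom_eq k
  exact h ▸ hU.measurableSet.inter I.isClosed_range.measurableSet

theorem overlap_subset : Z.overlap k k' ⊆ Z.dom k := inter_subset_left

theorem exists_overlap_eq_inter_dom (k k' : Patch H M ι) :
    ∃ U : Set E4, IsOpen U ∧ Z.overlap k k' = Z.dom k ∩ U := by
  obtain ⟨U, hU, h⟩ := Z.exists_overlap_eq k k'
  obtain ⟨V, hV, h'⟩ := Z.exists_dom_eq k
  refine ⟨U, hU, Subset.antisymm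
    (fun x hx => ⟨Z.overlap_subset hx, (h ▸ hx : x ∈ U ∩ range I).1⟩) fun x hx => ?_⟩
  rw [h]
  exact ⟨hx.2, (h' ▸ hx.1 : x ∈ V ∩ range I).2⟩

/-- Overlaps are relatively open in coordinate domains. -/
theorem fderivWithin_overlap {W : Type*} [NormedAddCommGroup W] [NormedSpace ℝ W] (f : E4 → W)
    (hx : x ∈ Z.overlap k k') :
    fderivWithin ℝ f (Z.overlap k k') x = fderivWithin ℝ f (Z.dom k) x := by
  obtain ⟨U, hU, h⟩ := Z.exists_overlap_eq_inter_dom k k'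
  rw [h] at hx ⊢
  exact fderivWithin_inter (hU.mem_nhds hx.2)

theorem extDerivWithin_overlap {W : Type*} [NormedAddCommGroup W] [NormedSpace ℝ W] {n : ℕ}
    (f : E4 → E4 [⋀^Fin n]→L[ℝ] W) (hx : x ∈ Z.overlap k k') :
    extDerivWithin f (Z.overlap k k') x = extDerivWithin f (Z.dom k) x := by
  rw [extDerivWithin, extDerivWithin, Z.fderivWithin_overlap f hx]

theorem jac_eq (hx : x ∈ Z.overlap k k') :
    Z.jac k k' x = fderivWithin ℝ (Z.trans k k') (Z.overlap k k') x := by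
  obtain ⟨U, hU, h⟩ := Z.exists_overlap_eq k k'
  rw [h] at hx ⊢
  rw [inter_comm, jac, fderivWithin_inter (hU.mem_nhds hx.1)]

theorem dglue_eq (hx : x ∈ Z.overlap k k') :
    Z.dglue k k' x = fderivWithin ℝ (Z.glue k k') (Z.overlap k k') x :=
  (Z.fderivWithin_overlap _ hx).symm

theorem pt_mem_region (hx : x ∈ Z.dom k) : Z.pt k x ∈ Z.region k :=
  ⟨k.2.1.extend_source (I := I) ▸ (k.2.1.extend I).map_target hx.1, hx.2⟩

theorem mem_overlap_self (hx : x ∈ Z.dom k) : x ∈ Z.overlap k k := ⟨hx, Z.pt_mem_region hx⟩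

theorem extend_mem_dom {p : M} (hp : p ∈ Z.region k) : k.2.1.extend I p ∈ Z.dom k := by
  have h1 : p ∈ (k.2.1.extend I).source := by simpa using hp.1
  refine ⟨(k.2.1.extend I).map_source h1, ?_⟩
  rw [mem_preimage, pt, (k.2.1.extend I).left_inv h1]
  exact hp.2

theorem pt_extend {p : M} (hp : p ∈ Z.region k) : Z.pt k (k.2.1.extend I p) = p :=
  (k.2.1.extend I).left_inv (by simpa using hp.1)

theorem pt_trans (hx : x ∈ Z.overlap k k') : Z.pt k' (Z.trans k k' x) = Z.pt k x :=
  Z.pt_extend hx.2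

theorem trans_mem_dom (hx : x ∈ Z.overlap k k') : Z.trans k k' x ∈ Z.dom k' :=
  Z.extend_mem_dom hx.2

theorem trans_mem_overlap (hx : x ∈ Z.overlap k k') (h : Z.pt k x ∈ Z.region k'') :
    Z.trans k k' x ∈ Z.overlap k' k'' :=
  ⟨Z.trans_mem_dom hx, by rw [mem_preimage, Z.pt_trans hx]; exact h⟩

theorem trans_self (hx : x ∈ Z.dom k) : Z.trans k k x = x := (k.2.1.extend I).right_inv hx.1

theorem trans_trans (hx : x ∈ Z.overlap k k') :
    Z.trans k' k'' (Z.trans k k' x) = Z.trans k k'' x :=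
  congrArg (k''.2.1.extend I) (Z.pt_trans hx)

theorem pt_injOn : InjOn (Z.pt k) (Z.dom k) := fun x hx y hy h => by
  rw [← Z.trans_self hx, ← Z.trans_self hy, trans, trans, h]

theorem continuousOn_pt : ContinuousOn (Z.pt k) (Z.dom k) :=
  (k.2.1.continuousOn_extend_symm (I := I)).mono inter_subset_left

theorem glue_self (hx : x ∈ Z.dom k) (v : Mink) : Z.glue k k x v = v :=
  Z.coordChange_self _ _ hx.2 v

theorem glue_glue (hx : x ∈ Z.overlap k k') (h : Z.pt k x ∈ Z.region k'') (v : Mink) :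
    Z.glue k k' x (Z.glue k' k'' (Z.trans k k' x) v) = Z.glue k k'' x v := by
  rw [glue, glue, Z.pt_trans hx]
  exact Z.coordChange_comp _ _ _ _ ⟨⟨h.2, hx.2.2⟩, hx.1.2⟩ v

theorem glue_mem_SO31 (hx : x ∈ Z.overlap k k') : Z.glue k k' x ∈ SO31 :=
  Z.mem_SO31 _ _ _ ⟨hx.2.2, hx.1.2⟩

theorem jac_self (hx : x ∈ Z.dom k) (v : E4) : Z.jac k k x v = v := by
  have hx' := Z.mem_overlap_self hx
  rw [Z.jac_eq hx', fderivWithin_congr (f := fun y => y) (fun y hy => Z.trans_self hy.1)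
    (Z.trans_self hx), fderivWithin_fun_id ((Z.isCalcDomain_overlap k k).uniqueDiffOn x hx')]
  rfl

section Smooth

variable [IsManifold I ∞ M]

theorem contDiffOn_trans : ContDiffOn ℝ ∞ (Z.trans k k') (Z.overlap k k') := by
  refine (I.contDiffOn_extendCoordChange (IsManifold.subset_maximalAtlas k.2.2)
    (IsManifold.subset_maximalAtlas k'.2.2)).mono fun x hx => ⟨hx.1.1, ?_⟩
  rw [mem_preimage, OpenPartialHomeomorph.extend_source]
  exact hx.2.1

theorem contDiffOn_jac : ContDiffOn ℝ ∞ (Z.jac k k') (Z.overlap k k') :=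
  (ContDiffOn.fderivWithin Z.contDiffOn_trans (Z.isCalcDomain_overlap k k').uniqueDiffOn
    (m := ∞) (by simp)).congr fun _ hx => Z.jac_eq hx

theorem hasFDerivWithinAt_trans (hx : x ∈ Z.overlap k k') :
    HasFDerivWithinAt (Z.trans k k') (Z.jac k k' x) (Z.overlap k k') x := by
  rw [Z.jac_eq hx]
  exact ((Z.contDiffOn_trans x hx).differentiableWithinAt (by simp)).hasFDerivWithinAt

theorem contDiffOn_glue : ContDiffOn ℝ ∞ (Z.glue k k') (Z.overlap k k') := by
  have h1 := Z.smooth.contMDiffOn_coordChange k'.1 k.1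
  have h2 := contMDiffOn_extend_symm (I := I) (n := ∞) (IsManifold.subset_maximalAtlas k.2.2)
  rw [← contMDiffOn_iff_contDiffOn]
  refine h1.comp (h2.mono fun x hx => ?_) fun x hx => ⟨hx.2.2, hx.1.2⟩
  rw [← OpenPartialHomeomorph.extend_target']
  exact hx.1.1

theorem jac_jac (hx : x ∈ Z.overlap k k') (h : Z.pt k x ∈ Z.region k'') (v : E4) :
    Z.jac k' k'' (Z.trans k k' x) (Z.jac k k' x v) = Z.jac k k'' x v := by
  obtain ⟨U, hU, hU'⟩ := Z.exists_overlap_eq_inter_dom k k'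
  obtain ⟨U'', hU'', hO''⟩ := Z.exists_overlap_eq_inter_dom k k''
  have hx'' : x ∈ Z.overlap k k'' := ⟨hx.1, h⟩
  set O := Z.dom k ∩ (U ∩ U'') with hO
  have hOs : O = Z.overlap k k' ∩ Z.overlap k k'' := by
    rw [hU', hO'', hO]; ext; simp only [mem_inter_iff]; tauto
  have hxO : x ∈ O := hOs ▸ ⟨hx, hx''⟩
  have hud : UniqueDiffWithinAt ℝ O x :=
    ((Z.isCalcDomain_dom k).uniqueDiffOn.inter (hU.inter hU'')) x hxO
  have h1 := (Z.hasFDerivWithinAt_trans (Z.trans_mem_overlap hx h)).comp x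
    ((Z.hasFDerivWithinAt_trans hx).mono (hOs.le.trans inter_subset_left)) fun y hy => by
      rw [hOs] at hy
      exact Z.trans_mem_overlap hy.1 hy.2.2
  have h2 := (Z.hasFDerivWithinAt_trans hx'').mono (hOs.le.trans inter_subset_right)
  have h3 := h2.congr (f₁ := Z.trans k' k'' ∘ Z.trans k k') (fun y hy => by
    rw [hOs] at hy; exact Z.trans_trans hy.1) (Z.trans_trans hx)
  exact DFunLike.congr_fun (hud.eq h1 h3) v

end Smooth

end MinkowskiBundle

/-! ### Gauge covariance of curvature and covariant derivatives -/

section Gauge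

variable {s : Set E4} {x : E4} {g : E4 → Mink →L[ℝ] Mink}
  {A A' a a' : E4 → E4 [⋀^Fin 1]→L[ℝ] so31}

/-- Evaluation of one-forms at a vector. -/
noncomputable def evalOne (W : Type*) [NormedAddCommGroup W] [NormedSpace ℝ W] (w : E4) :
    (E4 [⋀^Fin 1]→L[ℝ] W) →L[ℝ] W :=
  ContinuousAlternatingMap.apply ℝ E4 W ![w]

theorem evalOne_apply {W : Type*} [NormedAddCommGroup W] [NormedSpace ℝ W] (w : E4)
    (α : E4 [⋀^Fin 1]→L[ℝ] W) : evalOne W w α = α ![w] := rfl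

theorem hasFDerivWithinAt_eval {W W' : Type*} [NormedAddCommGroup W] [NormedSpace ℝ W]
    [NormedAddCommGroup W'] [NormedSpace ℝ W'] (L : W →L[ℝ] W')
    {α : E4 → E4 [⋀^Fin 1]→L[ℝ] W} (hα : DifferentiableWithinAt ℝ α s x) (w : E4) :
    HasFDerivWithinAt (fun y => L (α y ![w]))
      (L ∘L evalOne W w ∘L fderivWithin ℝ α s x) s x :=
  (L ∘L evalOne W w).hasFDerivAt.comp_hasFDerivWithinAt x hα.hasFDerivWithinAt

/-- The derivative of the relation `α g = g α'` between endomorphism-valued one-forms. -/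
theorem fderivWithin_gauge_adjoint (hs : UniqueDiffOn ℝ s) (hx : x ∈ s)
    (hg : DifferentiableWithinAt ℝ g s x) (ha : DifferentiableWithinAt ℝ a s x)
    (ha' : DifferentiableWithinAt ℝ a' s x)
    {r : E4 → E4 → Mink →L[ℝ] Mink} {r' : E4 → E4 →L[ℝ] Mink →L[ℝ] Mink} (w : E4)
    (hr : HasFDerivWithinAt (fun y => r y w) (r' w) s x)
    (h : ∀ y ∈ s, so31.toEnd (a y ![w]) ∘L g y = g y ∘L so31.toEnd (a' y ![w]) - r y w) (v : E4) :
    so31.toEnd (fderivWithin ℝ a s x v ![w]) ∘L g x +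
        so31.toEnd (a x ![w]) ∘L fderivWithin ℝ g s x v =
      g x ∘L so31.toEnd (fderivWithin ℝ a' s x v ![w]) +
        fderivWithin ℝ g s x v ∘L so31.toEnd (a' x ![w]) - r' w v := by
  have h1 := (hasFDerivWithinAt_eval so31.toEnd ha w).clm_comp hg.hasFDerivWithinAt
  have h2 := (hg.hasFDerivWithinAt.clm_comp (hasFDerivWithinAt_eval so31.toEnd ha' w)).sub hr
  have h3 := (hs x hx).eq h1 (h2.congr h (h x hx))
  have h4 := DFunLike.congr_fun h3 v
  rw [add_comm]
  exact h4

/-- The curvature transforms by conjugation under gauge transformations. -/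
theorem curvature_gauge (hs : IsCalcDomain s) (hx : x ∈ s) (hg : ContDiffOn ℝ ∞ g s)
    (hA : ContDiffOn ℝ ∞ A s) (hA' : ContDiffOn ℝ ∞ A' s)
    (h : ∀ y ∈ s, ∀ w, so31.toEnd (A y ![w]) ∘L g y =
      g y ∘L so31.toEnd (A' y ![w]) - fderivWithin ℝ g s y w) (v : Fin 2 → E4) :
    so31.toEnd (curvature bracketG s A x v) ∘L g x =
      g x ∘L so31.toEnd (curvature bracketG s A' x v) := by
  have hgd := (hg x hx).differentiableWithinAt (by simp)
  have hgd2 : DifferentiableWithinAt ℝ (fderivWithin ℝ g s) s x :=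
    ((hg x hx).fderivWithin_right hs.uniqueDiffOn (m := 1) two_le_infty
      hx).differentiableWithinAt (by simp)
  have hsym : IsSymmSndFDerivWithinAt ℝ g s x :=
    (hg x hx).isSymmSndFDerivWithinAt (n := ∞) (by simp [two_le_infty]) hs.uniqueDiffOn
      (hs.subset_closure hx) hx
  have key := fun v w => fderivWithin_gauge_adjoint (a := A) (a' := A')
    (r := fun y w => fderivWithin ℝ g s y w)
    (r' := fun w => fderivWithin ℝ g s x ∘L (0 : E4 →L[ℝ] E4) +
      (fderivWithin ℝ (fderivWithin ℝ g s) s x).flip w)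
    hs.uniqueDiffOn hx hgd ((hA x hx).differentiableWithinAt (by simp))
    ((hA' x hx).differentiableWithinAt (by simp)) w
    (hgd2.hasFDerivWithinAt.clm_apply (hasFDerivWithinAt_const w x s)) (fun y hy => h y hy w) v
  have k1 := key (v 0) (v 1)
  have k2 := key (v 1) (v 0)
  have h0 := h x hx (v 0)
  have h1 := h x hx (v 1)
  have hsy := hsym.eq (v 0) (v 1)
  simp only [ContinuousLinearMap.comp_zero, zero_add, ContinuousLinearMap.flip_apply] at k1 k2
  rw [hsy] at k1
  have e : ∀ B : E4 → E4 [⋀^Fin 1]→L[ℝ] so31, so31.toEnd (curvature bracketG s B x v) =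
      so31.toEnd (fderivWithin ℝ B s x (v 0) ![v 1]) -
          so31.toEnd (fderivWithin ℝ B s x (v 1) ![v 0]) +
          (so31.toEnd (B x ![v 0]) * so31.toEnd (B x ![v 1]) -
          so31.toEnd (B x ![v 1]) * so31.toEnd (B x ![v 0])) := by
    intro B
    rw [curvature, ContinuousAlternatingMap.add_apply, ContinuousAlternatingMap.smul_apply,
      extDerivWithin_one, wedge_one_one]
    have : bracketG (B x ![v 1]) (B x ![v 0]) = -bracketG (B x ![v 0]) (B x ![v 1]) :=
      (lie_skew _ _).symm
    rw [this, sub_neg_eq_add, ← two_smul ℝ, smul_smul]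
    norm_num
    rfl
  rw [e, e]
  simp only [← ContinuousLinearMap.mul_def] at k1 k2 h0 h1 ⊢
  generalize so31.toEnd (A x ![v 0]) = P0 at *
  generalize so31.toEnd (A x ![v 1]) = P1 at *
  generalize so31.toEnd (A' x ![v 0]) = R0 at *
  generalize so31.toEnd (A' x ![v 1]) = R1 at *
  generalize so31.toEnd (fderivWithin ℝ A s x (v 0) ![v 1]) = P01 at *
  generalize so31.toEnd (fderivWithin ℝ A s x (v 1) ![v 0]) = P10 at *
  generalize so31.toEnd (fderivWithin ℝ A' s x (v 0) ![v 1]) = R01 at *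
  generalize so31.toEnd (fderivWithin ℝ A' s x (v 1) ![v 0]) = R10 at *
  generalize fderivWithin ℝ g s x (v 0) = g0 at *
  generalize fderivWithin ℝ g s x (v 1) = g1 at *
  generalize g x = G at *
  have h3 : P0 * P1 * G = P0 * G * R1 - P0 * g1 := by rw [mul_assoc, h1, mul_sub, mul_assoc]
  have h4 : P1 * P0 * G = P1 * G * R0 - P1 * g0 := by rw [mul_assoc, h0, mul_sub, mul_assoc]
  rw [h0] at h3
  rw [h1] at h4
  have k1' := eq_sub_of_add_eq k1
  have k2' := eq_sub_of_add_eq k2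
  simp only [add_mul, sub_mul, h3, h4, k1', k2', mul_add, mul_sub, ← mul_assoc]
  abel

theorem covDeriv_apply {W W₁ : Type*} [NormedAddCommGroup W] [NormedSpace ℝ W]
    [NormedAddCommGroup W₁] [NormedSpace ℝ W₁] (b : W₁ →L[ℝ] W →L[ℝ] W)
    (A : E4 → E4 [⋀^Fin 1]→L[ℝ] W₁) (σ : E4 → E4 [⋀^Fin 1]→L[ℝ] W) (v : Fin 2 → E4) :
    covDeriv b s A σ x v = fderivWithin ℝ σ s x (v 0) ![v 1] - fderivWithin ℝ σ s x (v 1) ![v 0] +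
      (b (A x ![v 0]) (σ x ![v 1]) - b (A x ![v 1]) (σ x ![v 0])) := by
  rw [covDeriv, ContinuousAlternatingMap.add_apply, extDerivWithin_one, wedge_one_one]

/-- The covariant derivative of adjoint-valued one-forms is gauge covariant. -/
theorem covDeriv_bracketG_gauge (hs : IsCalcDomain s) (hx : x ∈ s) (hg : ContDiffOn ℝ ∞ g s)
    (h : ∀ y ∈ s, ∀ w, so31.toEnd (A y ![w]) ∘L g y =
      g y ∘L so31.toEnd (A' y ![w]) - fderivWithin ℝ g s y w)
    (ha : ContDiffOn ℝ ∞ a s) (ha' : ContDiffOn ℝ ∞ a' s)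
    (hh : ∀ y ∈ s, ∀ w, so31.toEnd (a y ![w]) ∘L g y = g y ∘L so31.toEnd (a' y ![w]))
    (v : Fin 2 → E4) :
    so31.toEnd (covDeriv bracketG s A a x v) ∘L g x =
      g x ∘L so31.toEnd (covDeriv bracketG s A' a' x v) := by
  have key := fun v w => fderivWithin_gauge_adjoint (a := a) (a' := a')
    (r := fun _ _ => 0) (r' := fun _ => 0) hs.uniqueDiffOn hx
    ((hg x hx).differentiableWithinAt (by simp)) ((ha x hx).differentiableWithinAt (by simp))
    ((ha' x hx).differentiableWithinAt (by simp)) w (hasFDerivWithinAt_const _ _ _)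
    (fun y hy => (hh y hy w).trans (sub_zero _).symm) v
  have k1 := key (v 0) (v 1)
  have k2 := key (v 1) (v 0)
  have h0 := h x hx (v 0)
  have h1 := h x hx (v 1)
  have i0 := hh x hx (v 0)
  have i1 := hh x hx (v 1)
  rw [zero_apply, sub_zero] at k1 k2
  have e : ∀ X Y, so31.toEnd (bracketG X Y) = so31.toEnd X * so31.toEnd Y -
    so31.toEnd Y * so31.toEnd X := fun _ _ => rfl
  rw [covDeriv_apply, covDeriv_apply]
  simp only [map_add, map_sub, e]
  simp only [← ContinuousLinearMap.mul_def] at k1 k2 h0 h1 i0 i1 ⊢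
  generalize so31.toEnd (A x ![v 0]) = P0 at *
  generalize so31.toEnd (A x ![v 1]) = P1 at *
  generalize so31.toEnd (A' x ![v 0]) = R0 at *
  generalize so31.toEnd (A' x ![v 1]) = R1 at *
  generalize so31.toEnd (a x ![v 0]) = p0 at *
  generalize so31.toEnd (a x ![v 1]) = p1 at *
  generalize so31.toEnd (a' x ![v 0]) = r0 at *
  generalize so31.toEnd (a' x ![v 1]) = r1 at *
  generalize so31.toEnd (fderivWithin ℝ a s x (v 0) ![v 1]) = P01 at *
  generalize so31.toEnd (fderivWithin ℝ a s x (v 1) ![v 0]) = P10 at *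
  generalize so31.toEnd (fderivWithin ℝ a' s x (v 0) ![v 1]) = R01 at *
  generalize so31.toEnd (fderivWithin ℝ a' s x (v 1) ![v 0]) = R10 at *
  generalize fderivWithin ℝ g s x (v 0) = g0 at *
  generalize fderivWithin ℝ g s x (v 1) = g1 at *
  generalize g x = G at *
  have h3 : P0 * p1 * G = (G * R0 - g0) * r1 := by rw [mul_assoc, i1, ← mul_assoc, h0]
  have h4 : P1 * p0 * G = (G * R1 - g1) * r0 := by rw [mul_assoc, i0, ← mul_assoc, h1]
  have h5 : p0 * P1 * G = G * r0 * R1 - p0 * g1 := by rw [mul_assoc, h1, mul_sub, ← mul_assoc, i0]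
  have h6 : p1 * P0 * G = G * r1 * R0 - p1 * g0 := by rw [mul_assoc, h0, mul_sub, ← mul_assoc, i1]
  have k1' := eq_sub_of_add_eq k1
  have k2' := eq_sub_of_add_eq k2
  simp only [add_mul, sub_mul, h3, h4, h5, h6, k1', k2', mul_add, mul_sub, ← mul_assoc]
  abel

/-- The torsion is gauge covariant. -/
theorem covDeriv_toEnd_gauge (hs : IsCalcDomain s) (hx : x ∈ s) (hg : ContDiffOn ℝ ∞ g s)
    (h : ∀ y ∈ s, ∀ w, so31.toEnd (A y ![w]) ∘L g y =
      g y ∘L so31.toEnd (A' y ![w]) - fderivWithin ℝ g s y w)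
    {e e' : E4 → E4 [⋀^Fin 1]→L[ℝ] Mink} (he : ContDiffOn ℝ ∞ e s) (he' : ContDiffOn ℝ ∞ e' s)
    (hh : ∀ y ∈ s, ∀ w, e y ![w] = g y (e' y ![w])) (v : Fin 2 → E4) :
    covDeriv so31.toEnd s A e x v = g x (covDeriv so31.toEnd s A' e' x v) := by
  have hgd := ((hg x hx).differentiableWithinAt (by simp)).hasFDerivWithinAt
  have key : ∀ v w, fderivWithin ℝ e s x v ![w] =
      fderivWithin ℝ g s x v (e' x ![w]) + g x (fderivWithin ℝ e' s x v ![w]) := by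
    intro v w
    have h1 := hasFDerivWithinAt_eval (.id ℝ _) ((he x hx).differentiableWithinAt (by simp)) w
    have h2 := hgd.clm_apply
      (hasFDerivWithinAt_eval (.id ℝ _) ((he' x hx).differentiableWithinAt (by simp)) w)
    have h3 := (hs.uniqueDiffOn x hx).eq h1 (h2.congr (fun y hy => hh y hy w) (hh x hx w))
    rw [add_comm]
    exact DFunLike.congr_fun h3 v
  have hA : ∀ w u, so31.toEnd (A x ![w]) (g x u) =
      g x (so31.toEnd (A' x ![w]) u) - fderivWithin ℝ g s x w u :=
    fun w u => DFunLike.congr_fun (h x hx w) u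
  rw [covDeriv_apply, covDeriv_apply]
  simp only [key, hh x hx, hA, map_add, map_sub]
  abel

theorem toEnd_wedgeG_comp {g : Mink →L[ℝ] Mink} (hg : g ∈ SO31) (v w : Mink) :
    so31.toEnd (wedgeG (g v) (g w)) ∘L g = g ∘L so31.toEnd (wedgeG v w) := by
  ext1 u
  simp [toEnd_wedgeG, hg.1]

/-- If `X g = g Y` for an isometry `g`, then a relation between functionals on `𝔤` can be checked
on the bivectors `g v ∧ g w` and `v ∧ w`. -/
theorem so31Dual_conj {g : Mink →L[ℝ] Mink} (hg : g ∈ SO31) {z z' : so31Dual}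
    (h : ∀ v w, z (wedgeG (g v) (g w)) = z' (wedgeG v w)) {X Y : so31}
    (hXY : so31.toEnd X ∘L g = g ∘L so31.toEnd Y) : z X = z' Y := by
  have hsurj : Function.Surjective g := by
    have hu : IsUnit (LinearMap.det (g : Mink →ₗ[ℝ] Mink)) := hg.2 ▸ isUnit_one
    exact ((Module.End.isUnit_iff _).1 ((LinearMap.isUnit_iff_isUnit_det _).2 hu)).2
  have hX : X = (1 / 2 : ℝ) • (wedgeG (g (mb 0)) (g (so31.toEnd Y (mb 0))) +
      wedgeG (g (mb 1)) (g (so31.toEnd Y (mb 1))) + wedgeG (g (mb 2)) (g (so31.toEnd Y (mb 2))) -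
      wedgeG (g (mb 3)) (g (so31.toEnd Y (mb 3)))) := by
    refine so31.toEnd_injective (ContinuousLinearMap.ext fun u => ?_)
    obtain ⟨u, rfl⟩ := hsurj u
    have h1 := DFunLike.congr_fun hXY u
    have h2 := DFunLike.congr_fun (congrArg so31.toEnd (so31_eq_wedgeG Y)) u
    have h3 := fun v w => DFunLike.congr_fun (toEnd_wedgeG_comp hg v w) u
    simp only [ContinuousLinearMap.comp_apply] at h1 h3
    rw [h1]
    nth_rewrite 1 [h2]
    simp only [map_smul, map_add, map_sub, smul_apply, add_apply, sub_apply, h3]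
  rw [hX]
  conv_rhs => rw [so31_eq_wedgeG Y]
  simp only [map_smul, map_add, map_sub, h]

/-- The covariant derivative of coadjoint-valued one-forms is gauge covariant. -/
theorem covDeriv_coad_gauge (hs : IsCalcDomain s) (hx : x ∈ s) (hg : ContDiffOn ℝ ∞ g s)
    (hg' : ∀ y ∈ s, g y ∈ SO31)
    (h : ∀ y ∈ s, ∀ w, so31.toEnd (A y ![w]) ∘L g y =
      g y ∘L so31.toEnd (A' y ![w]) - fderivWithin ℝ g s y w)
    {S S' : E4 → E4 [⋀^Fin 1]→L[ℝ] so31Dual} (hS : ContDiffOn ℝ ∞ S s) (hS' : ContDiffOn ℝ ∞ S' s)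
    (hh : ∀ y ∈ s, ∀ w X Y, so31.toEnd X ∘L g y = g y ∘L so31.toEnd Y → S y ![w] X = S' y ![w] Y)
    (v : Fin 2 → E4) {X Y : so31} (hXY : so31.toEnd X ∘L g x = g x ∘L so31.toEnd Y) :
    covDeriv coad s A S x v X = covDeriv coad s A' S' x v Y := by
  refine so31Dual_conj (hg' x hx) (fun p q => ?_) hXY
  have hgd := ((hg x hx).differentiableWithinAt (by simp)).hasFDerivWithinAt
  have hSp : ∀ y ∈ s, ∀ w p q, S y ![w] (wedgeG (g y p) (g y q)) = S' y ![w] (wedgeG p q) :=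
    fun y hy w p q => hh y hy w _ _ (toEnd_wedgeG_comp (hg' y hy) p q)
  have key : ∀ v w, fderivWithin ℝ S s x v ![w] (wedgeG (g x p) (g x q)) =
      fderivWithin ℝ S' s x v ![w] (wedgeG p q) -
        S x ![w] (wedgeG (fderivWithin ℝ g s x v p) (g x q) +
          wedgeG (g x p) (fderivWithin ℝ g s x v q)) := by
    intro v w
    have hp := fun u => hgd.clm_apply (hasFDerivWithinAt_const u x s)
    have h1 := (hasFDerivWithinAt_eval (.id ℝ _) ((hS x hx).differentiableWithinAt (by simp))
      w).clm_apply (wedgeG.hasFDerivWithinAt_of_bilinear (hp p) (hp q))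
    have h2 := (hasFDerivWithinAt_eval (.id ℝ _) ((hS' x hx).differentiableWithinAt (by simp))
      w).clm_apply (hasFDerivWithinAt_const (wedgeG p q) x s)
    have h3 := (hs.uniqueDiffOn x hx).eq h1 (h2.congr (fun y hy => hSp y hy w p q)
      (hSp x hx w p q))
    have h4 := DFunLike.congr_fun h3 v
    simp [evalOne_apply] at h4
    rw [map_add]
    linear_combination h4
  have hA : ∀ w u, so31.toEnd (A x ![w]) (g x u) =
      g x (so31.toEnd (A' x ![w]) u) - fderivWithin ℝ g s x w u :=
    fun w u => DFunLike.congr_fun (h x hx w) u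
  rw [covDeriv_apply, covDeriv_apply]
  simp only [add_apply, sub_apply, key, coad_apply, lie_wedgeG, hA, map_sub, map_add, hSp x hx]
  ring

end Gauge

/-! ### Pull-back of forms under changes of patch -/

section FormSmooth

variable {W : Type*} [NormedAddCommGroup W] [NormedSpace ℝ W] [FiniteDimensional ℝ W] {p : ℕ}

theorem contDiff_form_apply :
    ContDiff ℝ ∞ fun q : (E4 [⋀^Fin p]→L[ℝ] W) × (Fin p → E4) => q.1 q.2 := by
  let b := Module.finBasis ℝ (E4 [⋀^Fin p]→L[ℝ] W)
  have h : ∀ q : (E4 [⋀^Fin p]→L[ℝ] W) × (Fin p → E4), q.1 q.2 =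
      ∑ j, LinearMap.toContinuousLinearMap (b.coord j) q.1 •
        (b j).toContinuousMultilinearMap q.2 := by
    intro q
    refine (congrArg (fun α : E4 [⋀^Fin p]→L[ℝ] W => α q.2) (b.sum_repr q.1).symm).trans ?_
    simp only [ContinuousAlternatingMap.sum_apply, ContinuousAlternatingMap.smul_apply]
    rfl
  simp only [h]
  exact ContDiff.sum fun j _ =>
    ((LinearMap.toContinuousLinearMap (b.coord j)).contDiff.comp contDiff_fst).smul
      ((b j).toContinuousMultilinearMap.contDiff.comp contDiff_snd)

/-- A function with values in forms is smooth if all its evaluations are. -/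
theorem contDiffOn_of_forall_apply {s : Set E4} {σ : E4 → E4 [⋀^Fin p]→L[ℝ] W}
    (h : ∀ v, ContDiffOn ℝ ∞ (fun x => σ x v) s) : ContDiffOn ℝ ∞ σ s := by
  let L : (E4 [⋀^Fin p]→L[ℝ] W) →ₗ[ℝ] ((Fin p → Fin 4) → W) :=
    { toFun := fun α c => α fun i => frame (c i)
      map_add' := fun _ _ => rfl
      map_smul' := fun _ _ => rfl }
  have hL : LinearMap.ker L = ⊥ := by
    rw [LinearMap.ker_eq_bot']
    intro α hα
    refine ContinuousAlternatingMap.toAlternatingMap_injective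
      (Module.Basis.ext_alternating (EuclideanSpace.basisFun (Fin 4) ℝ).toBasis fun c _ => ?_)
    have := congrFun hα c
    simpa [L, frame] using this
  obtain ⟨R, hR⟩ := LinearMap.exists_leftInverse_of_injective L hL
  have h1 : ContDiffOn ℝ ∞ (fun x => L (σ x)) s := contDiffOn_pi.2 fun c => h _
  refine ((LinearMap.toContinuousLinearMap R).contDiff.comp_contDiffOn h1).congr fun x _ => ?_
  exact (DFunLike.congr_fun hR (σ x)).symm

theorem contDiffOn_compContinuousLinearMap {s : Set E4} {σ : E4 → E4 [⋀^Fin p]→L[ℝ] W}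
    {J : E4 → E4 →L[ℝ] E4} (hσ : ContDiffOn ℝ ∞ σ s) (hJ : ContDiffOn ℝ ∞ J s) :
    ContDiffOn ℝ ∞ (fun x => (σ x).compContinuousLinearMap (J x)) s :=
  contDiffOn_of_forall_apply fun v => contDiff_form_apply.comp_contDiffOn
    (hσ.prodMk (contDiffOn_pi.2 fun i => hJ.clm_apply (contDiffOn_const (c := v i))))

end FormSmooth

section WedgeMap

variable {W₁ W₂ W₃ W₁' W₂' W₃' V : Type*} [NormedAddCommGroup W₁] [NormedSpace ℝ W₁]
  [NormedAddCommGroup W₂] [NormedSpace ℝ W₂] [NormedAddCommGroup W₃] [NormedSpace ℝ W₃]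
  [NormedAddCommGroup W₁'] [NormedSpace ℝ W₁'] [NormedAddCommGroup W₂'] [NormedSpace ℝ W₂']
  [NormedAddCommGroup W₃'] [NormedSpace ℝ W₃'] [AddCommGroup V] [Module ℝ V]

/-- An intertwining relation between bilinear maps passes to wedge products. -/
theorem wedge_intertwine {b : W₁ →L[ℝ] W₂ →L[ℝ] W₃} {b' : W₁' →L[ℝ] W₂' →L[ℝ] W₃'} {p q : ℕ}
    {α : E4 [⋀^Fin p]→L[ℝ] W₁} {γ : E4 [⋀^Fin q]→L[ℝ] W₂} {α' : E4 [⋀^Fin p]→L[ℝ] W₁'}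
    {γ' : E4 [⋀^Fin q]→L[ℝ] W₂'} (J : E4 → E4) (L : W₃ →ₗ[ℝ] V) (L' : W₃' →ₗ[ℝ] V)
    (h : ∀ u w, L (b (α u) (γ w)) = L' (b' (α' fun i => J (u i)) (γ' fun i => J (w i))))
    (v : Fin (p + q) → E4) :
    L (wedge b α γ v) = L' (wedge b' α' γ' fun i => J (v i)) := by
  simp only [wedge_apply, map_smul, map_sum, Units.smul_def, map_zsmul, h]

end WedgeMap

section Pull

variable {W₁ W₂ W₃ : Type*} [NormedAddCommGroup W₁] [NormedSpace ℝ W₁]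
  [NormedAddCommGroup W₂] [NormedSpace ℝ W₂] [NormedAddCommGroup W₃] [NormedSpace ℝ W₃]

theorem wedge_compContinuousLinearMap (b : W₁ →L[ℝ] W₂ →L[ℝ] W₃) {p q : ℕ}
    (α : E4 [⋀^Fin p]→L[ℝ] W₁) (γ : E4 [⋀^Fin q]→L[ℝ] W₂) (J : E4 →L[ℝ] E4) :
    wedge b (α.compContinuousLinearMap J) (γ.compContinuousLinearMap J) =
      (wedge b α γ).compContinuousLinearMap J := by
  ext v
  exact wedge_intertwine J .id .id (fun _ _ => rfl) v

end Pull

namespace MinkowskiBundle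

variable {H : Type*} [TopologicalSpace H] {I : ModelWithCorners ℝ E4 H}
  {M : Type*} [TopologicalSpace M] [ChartedSpace H M] {ι : Type*}
  (Z : MinkowskiBundle I M ι) {k k' : Patch H M ι} {x : E4}

section Pull

variable [IsManifold I ∞ M]
  {W W₁ : Type*} [NormedAddCommGroup W] [NormedSpace ℝ W]
  [NormedAddCommGroup W₁] [NormedSpace ℝ W₁]

/-- The pull-back to the coordinates of `k` of a form in the coordinates of `k'`. -/
noncomputable def pull (k k' : Patch H M ι) {p : ℕ} (σ : E4 → E4 [⋀^Fin p]→L[ℝ] W) (x : E4) :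
    E4 [⋀^Fin p]→L[ℝ] W :=
  (σ (Z.trans k k' x)).compContinuousLinearMap (Z.jac k k' x)

theorem contDiffOn_pull [FiniteDimensional ℝ W] {p : ℕ} {σ : E4 → E4 [⋀^Fin p]→L[ℝ] W}
    (hσ : ContDiffOn ℝ ∞ σ (Z.dom k')) : ContDiffOn ℝ ∞ (Z.pull k k' σ) (Z.overlap k k') :=
  contDiffOn_compContinuousLinearMap
    (hσ.comp Z.contDiffOn_trans fun _ hx => Z.trans_mem_dom hx) Z.contDiffOn_jac

theorem extDerivWithin_pull {p : ℕ} {σ : E4 → E4 [⋀^Fin p]→L[ℝ] W}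
    (hσ : ContDiffOn ℝ ∞ σ (Z.dom k')) (hx : x ∈ Z.overlap k k') :
    extDerivWithin (Z.pull k k' σ) (Z.overlap k k') x =
      (extDerivWithin σ (Z.dom k') (Z.trans k k' x)).compContinuousLinearMap (Z.jac k k' x) := by
  have hO := Z.isCalcDomain_overlap k k'
  have h1 : EqOn (Z.pull k k' σ) (fun y => (σ (Z.trans k k' y)).compContinuousLinearMap
      (fderivWithin ℝ (Z.trans k k') (Z.overlap k k') y)) (Z.overlap k k') :=
    fun y hy => by simp only [pull, Z.jac_eq hy]
  rw [extDerivWithin, fderivWithin_congr h1 (h1 hx), ← extDerivWithin, Z.jac_eq hx]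
  exact extDerivWithin_pullback (r := ∞)
    ((hσ _ (Z.trans_mem_dom hx)).differentiableWithinAt (by simp))
    (Z.contDiffOn_trans x hx) (by simp [two_le_infty]) hO.uniqueDiffOn
    (hO.subset_closure hx) hx fun y hy => Z.trans_mem_dom hy

theorem curvature_pull {A : E4 → E4 [⋀^Fin 1]→L[ℝ] W} (b : W →L[ℝ] W →L[ℝ] W)
    (hA : ContDiffOn ℝ ∞ A (Z.dom k')) (hx : x ∈ Z.overlap k k') (v : Fin 2 → E4) :
    curvature b (Z.overlap k k') (Z.pull k k' A) x v =
      curvature b (Z.dom k') A (Z.trans k k' x) (fun i => Z.jac k k' x (v i)) := by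
  rw [curvature, Z.extDerivWithin_pull hA hx, pull, wedge_compContinuousLinearMap]
  rfl

theorem covDeriv_pull {A : E4 → E4 [⋀^Fin 1]→L[ℝ] W₁} {σ : E4 → E4 [⋀^Fin 1]→L[ℝ] W}
    (b : W₁ →L[ℝ] W →L[ℝ] W) (hσ : ContDiffOn ℝ ∞ σ (Z.dom k'))
    (hx : x ∈ Z.overlap k k') (v : Fin 2 → E4) :
    covDeriv b (Z.overlap k k') (Z.pull k k' A) (Z.pull k k' σ) x v =
      covDeriv b (Z.dom k') A σ (Z.trans k k' x) (fun i => Z.jac k k' x (v i)) := by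
  rw [covDeriv, Z.extDerivWithin_pull hσ hx, pull, pull, wedge_compContinuousLinearMap]
  rfl

end Pull

/-! ### Tensorial operations -/

variable {Z}

section Tensor

variable {p q : ℕ}

theorem IsFormV.add {σ γ : Reps H M ι (E4 [⋀^Fin p]→L[ℝ] Mink)} (h : Z.IsFormV σ)
    (h' : Z.IsFormV γ) : Z.IsFormV fun k x => σ k x + γ k x := fun k k' x hx v => by
  simp only [ContinuousAlternatingMap.add_apply, map_add, h k k' x hx v, h' k k' x hx v]

theorem IsFormV.smul {σ : Reps H M ι (E4 [⋀^Fin p]→L[ℝ] Mink)} (c : ℝ) (h : Z.IsFormV σ) :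
    Z.IsFormV fun k x => c • σ k x := fun k k' x hx v => by
  simp only [ContinuousAlternatingMap.smul_apply, map_smul, h k k' x hx v]

theorem IsFormG.smul {σ : Reps H M ι (E4 [⋀^Fin p]→L[ℝ] so31)} (c : ℝ) (h : Z.IsFormG σ) :
    Z.IsFormG fun k x => c • σ k x := fun k k' x hx v => by
  simp only [ContinuousAlternatingMap.smul_apply, map_smul, ContinuousLinearMap.smul_comp,
    ContinuousLinearMap.comp_smul, h k k' x hx v]

theorem IsFormGDual.add {σ γ : Reps H M ι (E4 [⋀^Fin p]→L[ℝ] so31Dual)} (h : Z.IsFormGDual σ)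
    (h' : Z.IsFormGDual γ) : Z.IsFormGDual fun k x => σ k x + γ k x := fun k k' x hx v X Y hX => by
  simp only [ContinuousAlternatingMap.add_apply, add_apply, h k k' x hx v X Y hX,
    h' k k' x hx v X Y hX]

theorem IsFormGDual.smul {σ : Reps H M ι (E4 [⋀^Fin p]→L[ℝ] so31Dual)} (c : ℝ)
    (h : Z.IsFormGDual σ) : Z.IsFormGDual fun k x => c • σ k x := fun k k' x hx v X Y hX => by
  simp only [ContinuousAlternatingMap.smul_apply, smul_apply, h k k' x hx v X Y hX]

theorem IsForm.add {σ γ : Reps H M ι (E4 [⋀^Fin p]→L[ℝ] ℝ)} (h : Z.IsForm σ) (h' : Z.IsForm γ) :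
    Z.IsForm fun k x => σ k x + γ k x := fun k k' x hx v => by
  simp only [ContinuousAlternatingMap.add_apply, h k k' x hx v, h' k k' x hx v]

theorem IsForm.smul {σ : Reps H M ι (E4 [⋀^Fin p]→L[ℝ] ℝ)} (c : ℝ) (h : Z.IsForm σ) :
    Z.IsForm fun k x => c • σ k x := fun k k' x hx v => by
  simp only [ContinuousAlternatingMap.smul_apply, h k k' x hx v]

theorem isFormV_zero : Z.IsFormV (p := p) fun _ _ => 0 := fun k k' x hx v => by simp

theorem isFormG_zero : Z.IsFormG (p := p) fun _ _ => 0 := fun k k' x hx v => by simp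

theorem isFormGDual_zero : Z.IsFormGDual (p := p) fun _ _ => 0 := fun k k' x hx v _ _ _ => by simp

theorem IsFormG.mapVal {P : so31 →L[ℝ] so31} (hP : AdEquivariant (P : so31 →ₗ[ℝ] so31))
    {σ : Reps H M ι (E4 [⋀^Fin p]→L[ℝ] so31)} (h : Z.IsFormG σ) :
    Z.IsFormG fun k x => mapVal P (σ k x) := fun k k' x hx v =>
  hP.conj (Z.glue_mem_SO31 hx) (h k k' x hx v)

theorem IsFormGDual.mapVal {T : so31 →ₗ[ℝ] so31} {β : ℝ} (hT : AdEquivariant T)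
    (hu : IsUnit (deform T β)) {σ : Reps H M ι (E4 [⋀^Fin p]→L[ℝ] so31Dual)}
    (h : Z.IsFormGDual σ) : Z.IsFormGDual fun k x => _root_.mapVal (deformInvDual T β) (σ k x) :=
  fun k k' x hx v _ _ hX =>
    h k k' x hx v _ _ ((hT.deformInv hu).conj (Z.glue_mem_SO31 hx) hX)

theorem IsFormV.wedgeV {σ : Reps H M ι (E4 [⋀^Fin p]→L[ℝ] Mink)}
    {γ : Reps H M ι (E4 [⋀^Fin q]→L[ℝ] Mink)} (h : Z.IsFormV σ) (h' : Z.IsFormV γ) :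
    Z.IsFormGDual fun k x => wedge wedgeV (σ k x) (γ k x) := fun k k' x hx v X Y hX =>
  wedge_intertwine (Z.jac k k' x) (ContinuousLinearMap.apply ℝ ℝ X).toLinearMap
    (ContinuousLinearMap.apply ℝ ℝ Y).toLinearMap (fun u w => by
      have h1 : ∀ a, so31.toEnd X (Z.glue k k' x a) = Z.glue k k' x (so31.toEnd Y a) :=
        fun a => DFunLike.congr_fun hX a
      rw [h k k' x hx u, h' k k' x hx w]
      simp [wedgeV_apply, h1, (Z.glue_mem_SO31 hx).1]) v

theorem IsFormV.wedgeG {σ : Reps H M ι (E4 [⋀^Fin p]→L[ℝ] Mink)}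
    {γ : Reps H M ι (E4 [⋀^Fin q]→L[ℝ] Mink)} (h : Z.IsFormV σ) (h' : Z.IsFormV γ) :
    Z.IsFormG fun k x => wedge _root_.wedgeG (σ k x) (γ k x) := fun k k' x hx v =>
  wedge_intertwine (Z.jac k k' x)
    ({ toFun := fun X => so31.toEnd X ∘L Z.glue k k' x
       map_add' := fun _ _ => by simp [ContinuousLinearMap.add_comp]
       map_smul' := fun _ _ => by simp } : so31 →ₗ[ℝ] Mink →L[ℝ] Mink)
    ({ toFun := fun X => Z.glue k k' x ∘L so31.toEnd X
       map_add' := fun _ _ => by simp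
       map_smul' := fun _ _ => by simp } : so31 →ₗ[ℝ] Mink →L[ℝ] Mink)
    (fun u w => by
      rw [h k k' x hx u, h' k k' x hx w]
      exact toEnd_wedgeG_comp (Z.glue_mem_SO31 hx) _ _) v

theorem IsFormG.wedge_pairG {σ : Reps H M ι (E4 [⋀^Fin p]→L[ℝ] so31)}
    {γ : Reps H M ι (E4 [⋀^Fin q]→L[ℝ] so31Dual)} (h : Z.IsFormG σ) (h' : Z.IsFormGDual γ) :
    Z.IsForm fun k x => wedge pairG (σ k x) (γ k x) := fun k k' x hx v =>
  wedge_intertwine (Z.jac k k' x) .id .id (fun u w =>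
    h' k k' x hx w _ _ (h k k' x hx u)) v

/-- The action of adjoint-valued on coadjoint-valued forms is tensorial. -/
theorem IsFormG.wedge_coad {σ : Reps H M ι (E4 [⋀^Fin p]→L[ℝ] so31)}
    {γ : Reps H M ι (E4 [⋀^Fin q]→L[ℝ] so31Dual)} (h : Z.IsFormG σ) (h' : Z.IsFormGDual γ) :
    Z.IsFormGDual fun k x => wedge coad (σ k x) (γ k x) := fun k k' x hx v X Y hX =>
  wedge_intertwine (Z.jac k k' x) (ContinuousLinearMap.apply ℝ ℝ X).toLinearMap
    (ContinuousLinearMap.apply ℝ ℝ Y).toLinearMap (fun u w => by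
      have h1 := h k k' x hx u
      refine congrArg Neg.neg (h' k k' x hx w _ _ ?_)
      change so31.toEnd ⁅(_ : so31), X⁆ ∘L _ = _ ∘L so31.toEnd ⁅(_ : so31), Y⁆
      simp only [so31.toEnd_bracket, ← ContinuousLinearMap.mul_def] at h1 hX ⊢
      rw [sub_mul, mul_sub, mul_assoc, hX, ← mul_assoc, h1, mul_assoc,
        mul_assoc _ _ (Z.glue k k' x), h1, ← mul_assoc (so31.toEnd X), hX,
        mul_assoc (Z.glue k k' x) (so31.toEnd Y)]) v

end Tensor

section Connection

variable {A : Reps H M ι (E4 [⋀^Fin 1]→L[ℝ] so31)}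

theorem IsConnection.gauge (hA : Z.IsConnection A) :
    ∀ y ∈ Z.overlap k k', ∀ w, so31.toEnd (A k y ![w]) ∘L Z.glue k k' y =
      Z.glue k k' y ∘L so31.toEnd (Z.pull k k' (A k') y ![w]) -
        fderivWithin ℝ (Z.glue k k') (Z.overlap k k') y w := fun y hy w => by
  rw [← Z.dglue_eq hy]
  exact hA k k' y hy ![w]

variable [IsManifold I ∞ M]

theorem IsConnection.curvature (hA : Z.IsConnection A) (hs : ∀ k, ContDiffOn ℝ ∞ (A k) (Z.dom k)) :
    Z.IsFormG fun k x => curvature bracketG (Z.dom k) (A k) x := fun k k' x hx v => by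
  have h := curvature_gauge (Z.isCalcDomain_overlap k k') hx Z.contDiffOn_glue
    ((hs k).mono Z.overlap_subset) (Z.contDiffOn_pull (hs k')) hA.gauge v
  rw [Z.curvature_pull _ (hs k') hx, _root_.curvature, Z.extDerivWithin_overlap _ hx] at h
  exact h

theorem IsConnection.covDeriv_bracketG (hA : Z.IsConnection A)
    {a : Reps H M ι (E4 [⋀^Fin 1]→L[ℝ] so31)} (hs : ∀ k, ContDiffOn ℝ ∞ (a k) (Z.dom k))
    (ha : Z.IsFormG a) :
    Z.IsFormG fun k x => covDeriv bracketG (Z.dom k) (A k) (a k) x := fun k k' x hx v => by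
  have h := covDeriv_bracketG_gauge (Z.isCalcDomain_overlap k k') hx Z.contDiffOn_glue
    hA.gauge ((hs k).mono Z.overlap_subset) (Z.contDiffOn_pull (hs k'))
    (fun y hy w => ha k k' y hy ![w]) v
  rw [Z.covDeriv_pull _ (hs k') hx, covDeriv, Z.extDerivWithin_overlap _ hx] at h
  exact h

theorem IsConnection.covDeriv_toEnd (hA : Z.IsConnection A)
    {e : Reps H M ι (E4 [⋀^Fin 1]→L[ℝ] Mink)} (hs : ∀ k, ContDiffOn ℝ ∞ (e k) (Z.dom k))
    (he : Z.IsFormV e) :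
    Z.IsFormV fun k x => covDeriv so31.toEnd (Z.dom k) (A k) (e k) x := fun k k' x hx v => by
  have h := covDeriv_toEnd_gauge (Z.isCalcDomain_overlap k k') hx Z.contDiffOn_glue
    hA.gauge ((hs k).mono Z.overlap_subset) (Z.contDiffOn_pull (hs k'))
    (fun y hy w => he k k' y hy ![w]) v
  rw [Z.covDeriv_pull _ (hs k') hx, covDeriv, Z.extDerivWithin_overlap _ hx] at h
  exact h

theorem IsConnection.covDeriv_coad (hA : Z.IsConnection A)
    {S : Reps H M ι (E4 [⋀^Fin 1]→L[ℝ] so31Dual)} (hs : ∀ k, ContDiffOn ℝ ∞ (S k) (Z.dom k))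
    (hS : Z.IsFormGDual S) :
    Z.IsFormGDual fun k x => covDeriv coad (Z.dom k) (A k) (S k) x :=
  fun k k' x hx v X Y hX => by
  have h := covDeriv_coad_gauge (Z.isCalcDomain_overlap k k') hx Z.contDiffOn_glue
    (fun y hy => Z.glue_mem_SO31 hy) hA.gauge ((hs k).mono Z.overlap_subset)
    (Z.contDiffOn_pull (hs k')) (fun y hy w => hS k k' y hy ![w]) v hX
  rw [Z.covDeriv_pull _ (hs k') hx, covDeriv, Z.extDerivWithin_overlap _ hx] at h
  exact h

end Connection

end MinkowskiBundle

/-! ### Sections with support in a patch -/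

namespace MinkowskiBundle

variable {H : Type*} [TopologicalSpace H] {I : ModelWithCorners ℝ E4 H}
  {M : Type*} [TopologicalSpace M] [ChartedSpace H M] {ι : Type*}
  (Z : MinkowskiBundle I M ι) {k k' : Patch H M ι} {x : E4}

/-- The representatives `χ` vanish off the image in `M` of the subset `K` of the patch `k`. -/
def SupportedIn {W : Type*} [NormedAddCommGroup W] [NormedSpace ℝ W] (k : Patch H M ι)
    (K : Set E4) (χ : Reps H M ι W) : Prop :=
  ∀ k', ∀ y ∈ Z.dom k', Z.pt k' y ∉ Z.pt k '' K → χ k' y = 0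

variable {Z} in
theorem SupportedIn.eq_zero {W : Type*} [NormedAddCommGroup W] [NormedSpace ℝ W] {K : Set E4}
    {χ : Reps H M ι W} (h : Z.SupportedIn k K χ) (hK : K ⊆ Z.dom k) :
    ∀ x ∈ Z.dom k, x ∉ K → χ k x = 0 := fun x hx hxK =>
  h k x hx fun ⟨_, hy, hyx⟩ => hxK (Z.pt_injOn (hK hy) hx hyx ▸ hy)

open scoped Classical in
/-- The section with representative `φ w` in the patch `k`, where `φ` is a bump function and `w` a
constant form, extended by zero. -/
noncomputable def bumpSection (k : Patch H M ι) (φ : E4 → ℝ) {p : ℕ}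
    (w : E4 [⋀^Fin p]→L[ℝ] Mink) : Reps H M ι (E4 [⋀^Fin p]→L[ℝ] Mink) := fun k' y =>
  if y ∈ Z.overlap k' k then
    φ (Z.trans k' k y) • mapVal (Z.glue k' k y) (w.compContinuousLinearMap (Z.jac k' k y))
  else 0

variable {φ : E4 → ℝ} {p : ℕ} {w : E4 [⋀^Fin p]→L[ℝ] Mink}

theorem bumpSection_self (hx : x ∈ Z.dom k) : Z.bumpSection k φ w k x = φ x • w := by
  rw [bumpSection, if_pos (Z.mem_overlap_self hx), Z.trans_self hx]
  refine congrArg (φ x • ·) (ContinuousAlternatingMap.ext fun v => ?_)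
  rw [mapVal_apply, Z.glue_self hx, ContinuousAlternatingMap.compContinuousLinearMap_apply]
  exact congrArg w (funext fun i => Z.jac_self hx _)

theorem supportedIn_bumpSection {K : Set E4} (hK : tsupport φ ⊆ K) :
    Z.SupportedIn k K (Z.bumpSection k φ w) := fun k' y _ hyK => by
  rw [bumpSection]
  split_ifs with h
  · have h0 : φ (Z.trans k' k y) = 0 :=
      image_eq_zero_of_notMem_tsupport fun h' => hyK ⟨_, hK h', Z.pt_trans h⟩
    rw [h0, zero_smul]
  · rfl

theorem isSmooth_bumpSection [IsManifold I ∞ M] [T2Space M] (hφ : ContDiff ℝ ∞ φ)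
    (hc : HasCompactSupport φ) (hs : tsupport φ ⊆ Z.dom k) : Z.IsSmooth (Z.bumpSection k φ w) := by
  refine fun k' => ⟨fun y hy => ?_, fun y hy => ?_⟩
  · by_cases h : Z.pt k' y ∈ Z.region k
    · have hyO : y ∈ Z.overlap k' k := ⟨hy, h⟩
      obtain ⟨U, hU, hUO⟩ := Z.exists_overlap_eq_inter_dom k' k
      have h1 : ContDiffOn ℝ ∞ (fun y => φ (Z.trans k' k y) • mapVal (Z.glue k' k y)
          (w.compContinuousLinearMap (Z.jac k' k y))) (Z.overlap k' k) := by
        refine (hφ.comp_contDiffOn Z.contDiffOn_trans).smul (contDiffOn_of_forall_apply fun v => ?_)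
        exact Z.contDiffOn_glue.clm_apply (w.toContinuousMultilinearMap.contDiff.comp_contDiffOn
          (contDiffOn_pi.2 fun i => Z.contDiffOn_jac.clm_apply (contDiffOn_const (c := v i))))
      have h2 : ContDiffWithinAt ℝ ∞ (Z.bumpSection k φ w k') (Z.overlap k' k) y :=
        (h1 y hyO).congr (fun z hz => if_pos hz) (if_pos hyO)
      refine h2.mono_of_mem_nhdsWithin ?_
      rw [hUO]
      exact inter_mem self_mem_nhdsWithin (mem_nhdsWithin_of_mem_nhds (hU.mem_nhds (hUO ▸ hyO).2))
    · -- near such a point the section vanishes, since its support is closed in `M`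
      have hcl : IsClosed (Z.pt k '' tsupport φ) :=
        (hc.isCompact.image_of_continuousOn (Z.continuousOn_pt.mono hs)).isClosed
      have hyn : Z.pt k' y ∈ (Z.pt k '' tsupport φ)ᶜ := by
        rintro ⟨z, hz, hzy⟩
        exact h (hzy ▸ Z.pt_mem_region (hs hz))
      have h0 : Z.bumpSection k φ w k' =ᶠ[𝓝[Z.dom k'] y] fun _ => 0 := by
        filter_upwards [self_mem_nhdsWithin,
          (Z.continuousOn_pt y hy).preimage_mem_nhdsWithin (hcl.isOpen_compl.mem_nhds hyn)]
        with z hz hz'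
        exact Z.supportedIn_bumpSection subset_rfl k' z hz hz'
      exact contDiffWithinAt_const.congr_of_eventuallyEq h0 (h0.self_of_nhdsWithin hy)
  · exact if_neg fun h => hy h.1

theorem isFormV_bumpSection [IsManifold I ∞ M] : Z.IsFormV (Z.bumpSection k φ w) := by
  intro k₁ k₂ x hx v
  by_cases h : Z.pt k₁ x ∈ Z.region k
  · rw [bumpSection, bumpSection, if_pos ⟨hx.1, h⟩, if_pos (Z.trans_mem_overlap hx h),
      Z.trans_trans hx]
    simp only [ContinuousAlternatingMap.smul_apply, mapVal_apply,
      ContinuousAlternatingMap.compContinuousLinearMap_apply, map_smul, Z.glue_glue hx h]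
    congr 3
    ext1 i
    exact (Z.jac_jac hx h _).symm
  · rw [bumpSection, bumpSection, if_neg fun h' => h h'.2, if_neg fun h' => h ?_]
    · simp
    · have := h'.2
      rwa [mem_preimage, Z.pt_trans hx] at this

end MinkowskiBundle

/-! ### Elimination of auxiliary fields -/

namespace MinkowskiBundle

variable {H : Type*} [TopologicalSpace H] {I : ModelWithCorners ℝ E4 H}
  {M : Type*} [TopologicalSpace M] [ChartedSpace H M] {ι : Type*}
  {Z : MinkowskiBundle I M ι}
  {W : Type*} [NormedAddCommGroup W] [NormedSpace ℝ W]
  {W' : Type*} [NormedAddCommGroup W'] [NormedSpace ℝ W']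
  {E : Type*} [NormedAddCommGroup E] [NormedSpace ℝ E]

theorem IsLocal.localOn {F : Set (Reps H M ι W)} {Q : Reps H M ι W → Reps H M ι W'}
    (h : Z.IsLocal F Q) (k : Patch H M ι) :
    LocalOn (Z.dom k) F (fun u => u k) (fun u => Q u k) := h k

theorem IsLocal.comp {F : Set (Reps H M ι W)} {F' : Set (Reps H M ι W')}
    (hF : ∀ u ∈ F, Z.IsSmooth u) {f : Reps H M ι W → Reps H M ι W'} (hf : Z.IsLocal F f)
    (hFF : MapsTo f F F') {Q : Reps H M ι W' → Reps H M ι E} (hQ : Z.IsLocal F' Q) :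
    Z.IsLocal F fun u => Q (f u) := fun k =>
  LocalOn.comp (Z.isCalcDomain_dom k).uniqueDiffOn (fun u hu => (hF u hu k).1) hFF
    (hf.localOn k) (hQ.localOn k)

end MinkowskiBundle

namespace FieldTheory

open MinkowskiBundle

variable {H : Type*} [TopologicalSpace H] {I : ModelWithCorners ℝ E4 H}
  {M : Type*} [TopologicalSpace M] [ChartedSpace H M] {ι : Type*}
  {Z : MinkowskiBundle I M ι}
  {W : Type*} [NormedAddCommGroup W] [NormedSpace ℝ W]
  {W' : Type*} [NormedAddCommGroup W'] [NormedSpace ℝ W']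
  {P : Type*} [NormedAddCommGroup P] [NormedSpace ℝ P]

/-- Data showing that the theory `𝒯'` arises from `𝒯` by eliminating auxiliary fields.

The fields of `𝒯'` are the components `proj u` of the fields `u` of `𝒯`; the remaining components
are either determined on shell, or arbitrary (the parameters `S`, which are pure gauge), so that
the solutions of `𝒯` are of the form `graph S v`. Up to the factor `sign` and the exact term
`d (bdry u χ)`, the first variation of the Lagrangian of `𝒯` at `u` in the direction `χ` is that
of `𝒯'` at `proj u`, provided that the variation is `Reducible`: either `u` is on shell in the
auxiliary fields, or `χ` preserves their field equations to first order. The vector field `V'` on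
the fields of `𝒯'` has lifts `lift S V'` with the second property, which move the parameters with
velocity `S`. The map `sec` extends variations of the fields of `𝒯'` by zero. -/
structure Reduction (𝒯 : FieldTheory Z W) (𝒯' : FieldTheory Z W') (P : Type*)
    [NormedAddCommGroup P] [NormedSpace ℝ P] where
  proj : W →L[ℝ] W'
  sec : W' →L[ℝ] W
  params : Set (Reps H M ι P)
  graph : Reps H M ι P → Reps H M ι W' → Reps H M ι W
  lift : Reps H M ι P → (Reps H M ι W' → Reps H M ι W') → Reps H M ι W → Reps H M ι W
  sign : ℝ
  bdry : Reps H M ι W → Reps H M ι W → Reps H M ι (E4 [⋀^Fin 3]→L[ℝ] ℝ)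
  Reducible : Reps H M ι W → Reps H M ι W → Prop
  proj_sec : ∀ w, proj (sec w) = w
  sign_ne_zero : sign ≠ 0
  isSmooth_fields : ∀ u ∈ 𝒯.fields, Z.IsSmooth u
  isSmooth_fields' : ∀ v ∈ 𝒯'.fields, Z.IsSmooth v
  proj_fields : ∀ u ∈ 𝒯.fields, (fun k x => proj (u k x)) ∈ 𝒯'.fields
  proj_variations : ∀ χ ∈ 𝒯.variations, (fun k x => proj (χ k x)) ∈ 𝒯'.variations
  sec_variations : ∀ χ ∈ 𝒯'.variations, (fun k x => sec (χ k x)) ∈ 𝒯.variations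
  zero_variations : (0 : Reps H M ι W') ∈ 𝒯'.variations
  zero_params : 0 ∈ params
  smul_params : ∀ t : ℝ, ∀ S ∈ params, t • S ∈ params
  graph_fields : ∀ S ∈ params, ∀ v ∈ 𝒯'.fields, graph S v ∈ 𝒯.fields
  proj_graph : ∀ S ∈ params, ∀ v ∈ 𝒯'.fields, (fun k x => proj (graph S v k x)) = v
  graph_local : ∀ S ∈ params, Z.IsLocal 𝒯'.fields (graph S)
  exists_graph : ∀ u ∈ 𝒯.criticalLocus, ∃ S ∈ params, u = graph S fun k x => proj (u k x)
  reducible_graph : ∀ S ∈ params, ∀ v ∈ 𝒯'.fields, ∀ χ ∈ 𝒯.variations, Reducible (graph S v) χ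
  variation : ∀ u ∈ 𝒯.fields, ∀ χ ∈ 𝒯.variations, Reducible u χ → ∀ k, ∀ x ∈ Z.dom k, ∀ D,
    HasDerivAt (fun t : ℝ => 𝒯'.lagrangian ((fun k x => proj (u k x)) + t • fun k x => proj (χ k x))
      k x) D 0 ↔
    HasDerivAt (fun t : ℝ => 𝒯.lagrangian (u + t • χ) k x)
      (sign • D - extDerivWithin (bdry u χ k) (Z.dom k) x) 0
  differentiable : ∀ v ∈ 𝒯'.fields, ∀ χ ∈ 𝒯'.variations, ∀ k, ∀ x ∈ Z.dom k,
    DifferentiableAt ℝ (fun t : ℝ => 𝒯'.lagrangian (v + t • χ) k x) 0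
  bdry_isForm : ∀ u ∈ 𝒯.fields, ∀ χ ∈ 𝒯.variations, Z.IsForm (bdry u χ)
  bdry_contDiffOn : ∀ u ∈ 𝒯.fields, ∀ χ ∈ 𝒯.variations, ∀ k,
    ContDiffOn ℝ ∞ (bdry u χ k) (Z.dom k)
  bdry_eq_zero : ∀ u ∈ 𝒯.fields, ∀ χ ∈ 𝒯.variations, ∀ k, ∀ K, IsClosed K →
    (∀ x ∈ Z.dom k, x ∉ K → χ k x = 0) → ∀ x ∈ Z.dom k, x ∉ K → bdry u χ k x = 0
  bdry_local : ∀ V : Reps H M ι W → Reps H M ι W, (∀ u ∈ 𝒯.fields, V u ∈ 𝒯.variations) →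
    Z.IsLocal 𝒯.fields V → Z.IsLocal 𝒯.fields fun u => bdry u (V u)
  lift_variations : ∀ S ∈ params, ∀ V', (∀ v ∈ 𝒯'.fields, V' v ∈ 𝒯'.variations) →
    ∀ u ∈ 𝒯.fields, lift S V' u ∈ 𝒯.variations
  lift_local : ∀ S ∈ params, ∀ V', (∀ v ∈ 𝒯'.fields, V' v ∈ 𝒯'.variations) →
    Z.IsLocal 𝒯'.fields V' → Z.IsLocal 𝒯.fields (lift S V')
  proj_lift : ∀ S ∈ params, ∀ V', (∀ v ∈ 𝒯'.fields, V' v ∈ 𝒯'.variations) → ∀ u ∈ 𝒯.fields,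
    (fun k x => proj (lift S V' u k x)) = V' fun k x => proj (u k x)
  reducible_lift : ∀ S ∈ params, ∀ V', (∀ v ∈ 𝒯'.fields, V' v ∈ 𝒯'.variations) →
    ∀ u ∈ 𝒯.fields, Reducible u (lift S V' u)
  path_smooth : ∀ S ∈ params, ∀ γ : ℝ → Reps H M ι W', (∀ t, γ t ∈ 𝒯'.fields) →
    (∀ k, SmoothFamily (Z.dom k) fun t => γ t k) →
    ∀ k, SmoothFamily (Z.dom k) fun t => graph (t • S) (γ t) k
  path_velocity : ∀ S ∈ params, ∀ γ : ℝ → Reps H M ι W', (∀ t, γ t ∈ 𝒯'.fields) →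
    (∀ k, SmoothFamily (Z.dom k) fun t => γ t k) → ∀ V', (∀ v ∈ 𝒯'.fields, V' v ∈ 𝒯'.variations) →
    ∀ s, (∀ k, HasVelocity (Z.dom k) (fun t => γ t k) (V' (γ s) k) s) →
    ∀ k, HasVelocity (Z.dom k) (fun t => graph (t • S) (γ t) k)
      (lift S V' (graph (s • S) (γ s)) k) s

theorem isSymmetry_zero {𝒯 : FieldTheory Z W} (h : (0 : Reps H M ι W) ∈ 𝒯.variations) :
    𝒯.IsSymmetry fun _ => 0 := by
  refine ⟨fun _ _ => h, fun k => localOn_fixed (σ := fun _ => 0) contDiffOn_const, fun _ => 0,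
    fun k => localOn_fixed (σ := fun _ => 0) contDiffOn_const, fun u _ =>
      ⟨fun _ _ _ _ _ => rfl, fun k x hx => ?_⟩⟩
  have h0 : extDerivWithin ((0 : Reps H M ι (E4 [⋀^Fin 3]→L[ℝ] ℝ)) k) (Z.dom k) x = 0 := by
    have := fderivWithin_const_apply (𝕜 := ℝ) (s := Z.dom k) (x := x)
      (c := (0 : E4 [⋀^Fin 3]→L[ℝ] ℝ))
    rw [extDerivWithin]
    erw [this]
    exact map_zero (ContinuousAlternatingMap.alternatizeUncurryFinCLM ℝ E4 ℝ (n := 3))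
  rw [h0]
  simpa using hasDerivAt_const (0 : ℝ) (𝒯.lagrangian u k x)

theorem joined_refl {𝒯 : FieldTheory Z W} (hs : ∀ u ∈ 𝒯.fields, Z.IsSmooth u)
    (h0 : (0 : Reps H M ι W) ∈ 𝒯.variations) (b : 𝒯.criticalLocus) : 𝒯.Joined b b :=
  ⟨fun _ => b.1, rfl, rfl, fun _ => b.2, fun k => smoothFamily_const (hs _ b.2.1 k).1,
    fun _ => ⟨_, isSymmetry_zero h0, fun k => hasVelocity_const (b.1 k)⟩⟩

theorem hasDerivAt_frame {L : ℝ → E4 [⋀^Fin 4]→L[ℝ] ℝ} {D : E4 [⋀^Fin 4]→L[ℝ] ℝ}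
    (h : HasDerivAt L D 0) : HasDerivAt (fun t => L t frame) (D frame) 0 :=
  (ContinuousAlternatingMap.apply ℝ E4 ℝ frame).hasFDerivAt.comp_hasDerivAt 0 h

/-- A weak field equation, obtained from the pointwise first variation of the Lagrangian. -/
theorem integral_eq_zero_of_hasDerivAt {𝒯 : FieldTheory Z W} {u χ : Reps H M ι W}
    (hu : u ∈ 𝒯.criticalLocus) (hχ : χ ∈ 𝒯.variations) {k : Patch H M ι} {K : Set E4}
    (hK : IsCompact K) (hKs : K ⊆ interior (Z.dom k)) (h0 : Z.SupportedIn k K χ) {c : ℝ}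
    (hc : c ≠ 0) {D : E4 → E4 [⋀^Fin 4]→L[ℝ] ℝ}
    (hD : ∀ x ∈ Z.dom k, HasDerivAt (fun t : ℝ => 𝒯.lagrangian (u + t • χ) k x) (c • D x) 0) :
    ∫ x in Z.dom k, D x frame = 0 := by
  have h1 := hu.2 k χ hχ ⟨K, hK, hKs, h0⟩
  have h2 : ∀ x ∈ Z.dom k, deriv (fun t : ℝ => 𝒯.lagrangian (u + t • χ) k x frame) 0 =
      c * D x frame := fun x hx => (hasDerivAt_frame (hD x hx)).deriv
  rw [setIntegral_congr_fun (Z.measurableSet_dom k) h2, integral_const_mul] at h1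
  exact (mul_eq_zero.1 h1).resolve_left hc

namespace Reduction

variable {𝒯 : FieldTheory Z W} {𝒯' : FieldTheory Z W'} (R : Reduction 𝒯 𝒯' P)

/-- The projection of fields. -/
def map (u : Reps H M ι W) : Reps H M ι W' := fun k x => R.proj (u k x)

theorem isLocal_map : Z.IsLocal 𝒯.fields R.map := fun _ => localOn_self.clm R.proj

/-- On shell in the auxiliary fields, the integrated first variations of the two theories agree up
to the factor `sign`. -/
theorem integral_variation {S : Reps H M ι P} (hS : S ∈ R.params) {v : Reps H M ι W'}
    (hv : v ∈ 𝒯'.fields) {k : Patch H M ι} {χ : Reps H M ι W} (hχ : χ ∈ 𝒯.variations) {K : Set E4}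
    (hK : IsCompact K) (hKs : K ⊆ interior (Z.dom k)) (h0 : ∀ x ∈ Z.dom k, x ∉ K → χ k x = 0) :
    ∫ x in Z.dom k, deriv (fun t : ℝ => 𝒯.lagrangian (R.graph S v + t • χ) k x frame) 0 =
      R.sign *
        ∫ x in Z.dom k, deriv (fun t : ℝ => 𝒯'.lagrangian (v + t • R.map χ) k x frame) 0 := by
  have hu := R.graph_fields S hS v hv
  obtain ⟨hi, hz⟩ := integral_extDerivWithin_eq_zero (Z.measurableSet_dom k)
    (R.bdry_contDiffOn _ hu _ hχ k) hK hKs (R.bdry_eq_zero _ hu _ hχ k K hK.isClosed h0)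
  set f : E4 → ℝ := fun x => deriv (fun t : ℝ => 𝒯'.lagrangian (v + t • R.map χ) k x frame) 0
  have h1 : ∀ x ∈ Z.dom k,
      deriv (fun t : ℝ => 𝒯.lagrangian (R.graph S v + t • χ) k x frame) 0 = R.sign * f x -
        (extDerivWithin (R.bdry (R.graph S v) χ k) (Z.dom k) x : E4 [⋀^Fin 4]→L[ℝ] ℝ) frame := by
    intro x hx
    have hd := (R.differentiable v hv _ (R.proj_variations χ hχ) k x hx).hasDerivAt
    have hd' := hd
    rw [← R.proj_graph S hS v hv] at hd'
    have hb := (R.variation _ hu χ hχ (R.reducible_graph S hS v hv χ hχ) k x hx _).1 hd'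
    rw [R.proj_graph S hS v hv] at hb
    rw [(hasDerivAt_frame hb).deriv]
    have : f x = _ := (hasDerivAt_frame hd).deriv
    rw [this]
    rfl
  rw [setIntegral_congr_fun (Z.measurableSet_dom k) h1]
  by_cases hf : IntegrableOn f (Z.dom k)
  · rw [integral_sub (hf.const_mul _) hi, hz, sub_zero, integral_const_mul]
  -- if one of the integrands is not integrable, neither is the other, and both integrals are `0`
  · rw [integral_undef hf, mul_zero, integral_undef]
    intro h2
    have h3 := (h2.add hi).const_mul R.sign⁻¹
    refine hf (h3.congr (Eventually.of_forall fun x => ?_))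
    simp [R.sign_ne_zero]

theorem map_critical {u : Reps H M ι W} (hu : u ∈ 𝒯.criticalLocus) :
    R.map u ∈ 𝒯'.criticalLocus := by
  obtain ⟨S, hS, huS⟩ := R.exists_graph u hu
  have hv := R.proj_fields u hu.1
  refine ⟨hv, fun k χ hχ ⟨K, hK, hKs, h0⟩ => ?_⟩
  have h1 : Z.SupportedIn k K fun k x => R.sec (χ k x) := fun k' y hy hyK => by
    simp only [h0 k' y hy hyK, map_zero]
  have h2 := hu.2 k _ (R.sec_variations χ hχ) ⟨K, hK, hKs, h1⟩
  rw [huS, R.integral_variation hS hv (R.sec_variations χ hχ) hK hKs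
    (h1.eq_zero (hKs.trans interior_subset))] at h2
  have h3 : R.map (fun k x => R.sec (χ k x)) = χ := by
    funext k x
    exact R.proj_sec _
  rw [h3] at h2
  exact (mul_eq_zero.1 h2).resolve_left R.sign_ne_zero

theorem graph_critical {S : Reps H M ι P} (hS : S ∈ R.params) {v : Reps H M ι W'}
    (hv : v ∈ 𝒯'.criticalLocus) : R.graph S v ∈ 𝒯.criticalLocus := by
  refine ⟨R.graph_fields S hS v hv.1, fun k χ hχ ⟨K, hK, hKs, h0⟩ => ?_⟩
  have h1 : Z.SupportedIn k K χ := h0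
  rw [R.integral_variation hS hv.1 hχ hK hKs (h1.eq_zero (hKs.trans interior_subset))]
  refine mul_eq_zero_of_right _ (hv.2 k _ (R.proj_variations χ hχ) ⟨K, hK, hKs, ?_⟩)
  intro k' y hy hyK
  rw [map, h0 k' y hy hyK, map_zero]

theorem differentiableWithinAt_of_local {F : Set (Reps H M ι W)}
    {Y : Reps H M ι W → Reps H M ι (E4 [⋀^Fin 3]→L[ℝ] ℝ)} (hY : Z.IsLocal F Y)
    {u : Reps H M ι W} (hu : u ∈ F) (hs : Z.IsSmooth u) {k : Patch H M ι} {x : E4}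
    (hx : x ∈ Z.dom k) : DifferentiableWithinAt ℝ (Y u k) (Z.dom k) x :=
  ((LocalOn.contDiffOn (Z.isCalcDomain_dom k).uniqueDiffOn (hY k) hu (hs k).1) x
    hx).differentiableWithinAt (by simp)

theorem extDerivWithin_smul_add {s : Set E4} {x : E4} (hs : UniqueDiffOn ℝ s) (hx : x ∈ s)
    {Y Y' : E4 → E4 [⋀^Fin 3]→L[ℝ] ℝ} (hY : DifferentiableWithinAt ℝ Y s x)
    (hY' : DifferentiableWithinAt ℝ Y' s x) (a b : ℝ) :
    extDerivWithin (fun y => a • Y y + b • Y' y) s x =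
      a • extDerivWithin Y s x + b • extDerivWithin Y' s x := by
  have := ((hY.hasFDerivWithinAt.const_smul a).add
    (hY'.hasFDerivWithinAt.const_smul b)).fderivWithin (hs x hx)
  rw [extDerivWithin, extDerivWithin, extDerivWithin]
  erw [this]
  exact ((ContinuousAlternatingMap.alternatizeUncurryFinCLM ℝ E4 ℝ (n := 3)).map_add _ _).trans
    (congrArg₂ _ (ContinuousLinearMap.map_smul _ _ _) (ContinuousLinearMap.map_smul _ _ _))

/-- A symmetry of `𝒯` descends, for each value of the parameters, to a symmetry of `𝒯'`. -/
theorem isSymmetry_descend {S : Reps H M ι P} (hS : S ∈ R.params)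
    {V : Reps H M ι W → Reps H M ι W} (hV : 𝒯.IsSymmetry V) :
    𝒯'.IsSymmetry fun v => R.map (V (R.graph S v)) := by
  obtain ⟨hVv, hVl, Y, hYl, hY⟩ := hV
  have hud := fun k => (Z.isCalcDomain_dom k).uniqueDiffOn
  have hg := R.graph_local S hS
  have hgF : MapsTo (R.graph S) 𝒯'.fields 𝒯.fields := R.graph_fields S hS
  have hbl := R.bdry_local V hVv hVl
  refine ⟨fun v hv => R.proj_variations _ (hVv _ (R.graph_fields S hS v hv)),
    fun k => ((hg.comp R.isSmooth_fields' hgF hVl).localOn k).clm R.proj,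
    fun v k x => R.sign⁻¹ • Y (R.graph S v) k x +
      R.sign⁻¹ • R.bdry (R.graph S v) (V (R.graph S v)) k x,
    fun k => (((hg.comp R.isSmooth_fields' hgF hYl).localOn k).const_smul _).add
      (((hg.comp R.isSmooth_fields' hgF hbl).localOn k).const_smul _), fun v hv => ?_⟩
  have hu := R.graph_fields S hS v hv
  refine ⟨((hY _ hu).1.smul _).add ((R.bdry_isForm _ hu _ (hVv _ hu)).smul _), fun k x hx => ?_⟩
  have h1 := (R.variation _ hu _ (hVv _ hu) (R.reducible_graph S hS v hv _ (hVv _ hu)) k x hx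
    (extDerivWithin (fun x => R.sign⁻¹ • Y (R.graph S v) k x +
      R.sign⁻¹ • R.bdry (R.graph S v) (V (R.graph S v)) k x) (Z.dom k) x)).2
  rw [R.proj_graph S hS v hv] at h1
  apply h1
  rw [extDerivWithin_smul_add (hud k) hx
    (differentiableWithinAt_of_local hYl hu (R.isSmooth_fields _ hu) hx)
    (differentiableWithinAt_of_local hbl hu (R.isSmooth_fields _ hu) hx), smul_add, smul_smul,
    smul_smul, mul_inv_cancel₀ R.sign_ne_zero, one_smul, one_smul, add_sub_cancel_right]
  exact (hY _ hu).2 k x hx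

/-- A symmetry of `𝒯'` lifts to a symmetry of `𝒯`. -/
theorem isSymmetry_lift {S : Reps H M ι P} (hS : S ∈ R.params)
    {V' : Reps H M ι W' → Reps H M ι W'} (hV : 𝒯'.IsSymmetry V') :
    𝒯.IsSymmetry (R.lift S V') := by
  obtain ⟨hVv, hVl, Y, hYl, hY⟩ := hV
  have hud := fun k => (Z.isCalcDomain_dom k).uniqueDiffOn
  have hl := R.lift_variations S hS V' hVv
  have hbl := R.bdry_local _ hl (R.lift_local S hS V' hVv hVl)
  have hYp : Z.IsLocal 𝒯.fields fun u => Y (R.map u) :=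
    R.isLocal_map.comp R.isSmooth_fields R.proj_fields hYl
  refine ⟨hl, R.lift_local S hS V' hVv hVl,
    fun u k x => R.sign • Y (R.map u) k x + (-1 : ℝ) • R.bdry u (R.lift S V' u) k x,
    fun k => ((hYp.localOn k).const_smul _).add
      ((hbl.localOn k).const_smul _), fun u hu => ?_⟩
  have hpu := R.proj_fields u hu
  refine ⟨((hY _ hpu).1.smul _).add ((R.bdry_isForm _ hu _ (hl u hu)).smul _), fun k x hx => ?_⟩
  rw [extDerivWithin_smul_add (hud k) hx
    (differentiableWithinAt_of_local hYp hu (R.isSmooth_fields _ hu) hx)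
    (differentiableWithinAt_of_local hbl hu (R.isSmooth_fields _ hu) hx), neg_one_smul,
    ← sub_eq_add_neg]
  refine (R.variation u hu _ (hl u hu) (R.reducible_lift S hS V' hVv u hu) k x hx _).1 ?_
  rw [R.proj_lift S hS V' hVv u hu]
  exact (hY _ hpu).2 k x hx

theorem joined_map {a b : 𝒯.criticalLocus} (h : 𝒯.Joined a b) :
    𝒯'.Joined ⟨R.map a.1, R.map_critical a.2⟩ ⟨R.map b.1, R.map_critical b.2⟩ := by
  obtain ⟨γ, h0, h1, hc, hs, hv⟩ := h
  refine ⟨fun t => R.map (γ t), congrArg R.map h0, congrArg R.map h1,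
    fun t => R.map_critical (hc t),
    fun k => SmoothFamily.clm (γ := fun t => γ t k) (hs k) R.proj, fun s => ?_⟩
  obtain ⟨V, hV, hVd⟩ := hv s
  -- the symmetry descends along the graph with the parameters of the path at time `s`
  obtain ⟨S, hS, hγ⟩ := R.exists_graph _ (hc s)
  refine ⟨_, R.isSymmetry_descend hS hV, fun k => ?_⟩
  have h2 : R.graph S (R.map (γ s)) = γ s := hγ.symm
  rw [h2]
  exact HasVelocity.clm (γ := fun t => γ t k) (hVd k) R.proj

/-- A path of solutions of `𝒯'` lifts to a path of solutions of `𝒯` whose parameters move from `0`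
to `S` with constant velocity. -/
theorem joined_graph {S : Reps H M ι P} (hS : S ∈ R.params) {a b : 𝒯'.criticalLocus}
    (h : 𝒯'.Joined a b) :
    𝒯.Joined ⟨R.graph 0 a.1, R.graph_critical R.zero_params a.2⟩
      ⟨R.graph S b.1, R.graph_critical hS b.2⟩ := by
  obtain ⟨γ, h0, h1, hc, hs, hv⟩ := h
  refine ⟨fun t => R.graph (t • S) (γ t), by simp [h0], by simp [h1],
    fun t => R.graph_critical (R.smul_params t S hS) (hc t),
    R.path_smooth S hS γ (fun t => (hc t).1) hs, fun s => ?_⟩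
  obtain ⟨V, hV, hVd⟩ := hv s
  exact ⟨_, R.isSymmetry_lift hS hV,
    R.path_velocity S hS γ (fun t => (hc t).1) hs V hV.1 s hVd⟩

/-- The parameters are pure gauge, so that the projection and the graph over the zero parameter are
inverse to each other up to symmetries. -/
theorem isClassicalEquivalence : 𝒯.IsClassicalEquivalence 𝒯' R.map (R.graph 0) where
  mapsTo_fields := R.proj_fields
  mapsTo_fields' := R.graph_fields 0 R.zero_params
  isLocal := R.isLocal_map
  isLocal' := R.graph_local 0 R.zero_params
  mapsTo_critical _ := R.map_critical
  mapsTo_critical' _ := R.graph_critical R.zero_params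
  moduli := by
    refine ⟨{ toFun := Quot.map (fun a => ⟨R.map a.1, R.map_critical a.2⟩)
                fun a b h => R.joined_map h
              invFun := Quot.map (fun b => ⟨R.graph 0 b.1, R.graph_critical R.zero_params b.2⟩)
                fun a b h => R.joined_graph R.zero_params h
              left_inv := ?_
              right_inv := ?_ }, fun _ => rfl, fun _ => rfl⟩
    · rintro ⟨a⟩
      -- the parameters of `a` are scaled down to zero along symmetries
      obtain ⟨S, hS, ha⟩ := R.exists_graph _ a.2
      refine Quot.sound ?_
      have h := R.joined_graph hS (joined_refl R.isSmooth_fields' R.zero_variations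
        ⟨R.map a.1, R.map_critical a.2⟩)
      convert h
      exact ha
    · rintro ⟨b⟩
      refine congrArg (Quot.mk _) (Subtype.ext ?_)
      exact R.proj_graph 0 R.zero_params b.1 b.2.1

end Reduction

end FieldTheory

/-! ### Fields of quadratically extended General Relativity on a coordinate domain -/

section Local

variable {s : Set E4} {x : E4} {t : ℝ}

theorem covDeriv_eq_zero {W W₁ : Type*} [NormedAddCommGroup W] [NormedSpace ℝ W]
    [NormedAddCommGroup W₁] [NormedSpace ℝ W₁] [FiniteDimensional ℝ W] [FiniteDimensional ℝ W₁]
    (b : W₁ →L[ℝ] W →L[ℝ] W)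
    (A : E4 → E4 [⋀^Fin 1]→L[ℝ] W₁) {σ : E4 → E4 [⋀^Fin 1]→L[ℝ] W} (hx : x ∈ s)
    (h : σ =ᶠ[𝓝[s] x] fun _ => 0) : covDeriv b s A σ x = 0 := by
  rw [covDeriv, extDerivWithin, h.fderivWithin_eq (h.self_of_nhdsWithin hx),
    h.self_of_nhdsWithin hx, fderivWithin_const_apply]
  have h1 := map_zero (ContinuousAlternatingMap.alternatizeUncurryFinCLM ℝ E4 W (n := 1))
  have h2 := map_zero (wedgeL b 1 1 (A x))
  exact (congrArg₂ (· + ·) h1 h2).trans (add_zero _)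

theorem covDeriv_congr {W W₁ : Type*} [NormedAddCommGroup W] [NormedSpace ℝ W]
    [NormedAddCommGroup W₁] [NormedSpace ℝ W₁] (b : W₁ →L[ℝ] W →L[ℝ] W)
    {A A' : E4 → E4 [⋀^Fin 1]→L[ℝ] W₁} {σ σ' : E4 → E4 [⋀^Fin 1]→L[ℝ] W}
    (hA : EqOn A A' s) (hσ : EqOn σ σ' s) (hx : x ∈ s) :
    covDeriv b s A σ x = covDeriv b s A' σ' x := by
  rw [covDeriv, covDeriv, extDerivWithin, fderivWithin_congr hσ (hσ hx), hA hx, hσ hx,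
    ← extDerivWithin]

theorem curvature_congr {W : Type*} [NormedAddCommGroup W] [NormedSpace ℝ W]
    (b : W →L[ℝ] W →L[ℝ] W) {A A' : E4 → E4 [⋀^Fin 1]→L[ℝ] W} (hA : EqOn A A' s) (hx : x ∈ s) :
    curvature b s A x = curvature b s A' x := by
  rw [curvature, curvature, extDerivWithin, fderivWithin_congr hA (hA hx), hA hx, ← extDerivWithin]

/-- The `𝔡`-valued form with given components, as a continuous linear map. -/
noncomputable def joinL (p : ℕ) : ((E4 [⋀^Fin p]→L[ℝ] so31) × (E4 [⋀^Fin p]→L[ℝ] Mink) ×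
    (E4 [⋀^Fin p]→L[ℝ] so31Dual)) →L[ℝ] E4 [⋀^Fin p]→L[ℝ] dAlg :=
  mapValL (ContinuousLinearMap.inl ℝ so31 (Mink × so31Dual)) p ∘L ContinuousLinearMap.fst ℝ _ _ +
    (mapValL (ContinuousLinearMap.inr ℝ so31 (Mink × so31Dual) ∘L
        ContinuousLinearMap.inl ℝ Mink so31Dual) p ∘L ContinuousLinearMap.fst ℝ _ _ +
      mapValL (ContinuousLinearMap.inr ℝ so31 (Mink × so31Dual) ∘L
        ContinuousLinearMap.inr ℝ Mink so31Dual) p ∘L ContinuousLinearMap.snd ℝ _ _) ∘L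
      ContinuousLinearMap.snd ℝ _ _

theorem joinL_apply {p : ℕ} (a : E4 [⋀^Fin p]→L[ℝ] so31) (e : E4 [⋀^Fin p]→L[ℝ] Mink)
    (S : E4 [⋀^Fin p]→L[ℝ] so31Dual) : joinL p (a, e, S) = a.prod (e.prod S) := by
  ext1 v
  change ((a v, 0) : dAlg) + ((0, (e v, 0)) + (0, (0, S v))) = (a v, e v, S v)
  simp

theorem prod_comp_eq {p : ℕ} (α : E4 [⋀^Fin p]→L[ℝ] dAlg) :
    (compG α).prod ((compV α).prod (compGDual α)) = α := rfl

/-- The component `𝔸` of the fields `(𝔸, 𝔹)`. -/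
noncomputable def connL : FibQeGR →L[ℝ] E4 [⋀^Fin 1]→L[ℝ] dAlg :=
  ContinuousLinearMap.fst ℝ (E4 [⋀^Fin 1]→L[ℝ] dAlg) (E4 [⋀^Fin 2]→L[ℝ] dAlg)

/-- The component `𝔹` of the fields `(𝔸, 𝔹)`. -/
noncomputable def auxL : FibQeGR →L[ℝ] E4 [⋀^Fin 2]→L[ℝ] dAlg :=
  ContinuousLinearMap.snd ℝ (E4 [⋀^Fin 1]→L[ℝ] dAlg) (E4 [⋀^Fin 2]→L[ℝ] dAlg)

/-- The component `A` of the connection. -/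
noncomputable def connGL : FibQeGR →L[ℝ] E4 [⋀^Fin 1]→L[ℝ] so31 :=
  mapValL (ContinuousLinearMap.fst ℝ so31 (Mink × so31Dual)) 1 ∘L connL

/-- The component `e` of the connection. -/
noncomputable def connVL : FibQeGR →L[ℝ] E4 [⋀^Fin 1]→L[ℝ] Mink :=
  mapValL (ContinuousLinearMap.fst ℝ Mink so31Dual ∘L
    ContinuousLinearMap.snd ℝ so31 (Mink × so31Dual)) 1 ∘L connL

/-- The component `S` of the connection. -/
noncomputable def connGDualL : FibQeGR →L[ℝ] E4 [⋀^Fin 1]→L[ℝ] so31Dual :=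
  mapValL (ContinuousLinearMap.snd ℝ Mink so31Dual ∘L
    ContinuousLinearMap.snd ℝ so31 (Mink × so31Dual)) 1 ∘L connL

/-- The component `c` of the auxiliary two-form. -/
noncomputable def auxGL : FibQeGR →L[ℝ] E4 [⋀^Fin 2]→L[ℝ] so31 :=
  mapValL (ContinuousLinearMap.fst ℝ so31 (Mink × so31Dual)) 2 ∘L auxL

/-- The component `τ` of the auxiliary two-form. -/
noncomputable def auxVL : FibQeGR →L[ℝ] E4 [⋀^Fin 2]→L[ℝ] Mink :=
  mapValL (ContinuousLinearMap.fst ℝ Mink so31Dual ∘L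
    ContinuousLinearMap.snd ℝ so31 (Mink × so31Dual)) 2 ∘L auxL

/-- The component `B` of the auxiliary two-form. -/
noncomputable def auxGDualL : FibQeGR →L[ℝ] E4 [⋀^Fin 2]→L[ℝ] so31Dual :=
  mapValL (ContinuousLinearMap.snd ℝ Mink so31Dual ∘L
    ContinuousLinearMap.snd ℝ so31 (Mink × so31Dual)) 2 ∘L auxL

/-- The projection `((A, e, S), (c, τ, B)) ↦ (e, A, τ)` on the values of fields. -/
noncomputable def projL : FibQeGR →L[ℝ] FibQgH := connVL.prod (connGL.prod auxVL)

theorem projL_apply (U : FibQeGR) : projL U = (compV U.1, compG U.1, compV U.2) := rfl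

/-- The inclusion `(e, A, τ) ↦ ((A, e, 0), (0, τ, 0))` on the values of fields. -/
noncomputable def secL : FibQgH →L[ℝ] FibQeGR :=
  (joinL 1 ∘L ((ContinuousLinearMap.fst ℝ _ _ ∘L ContinuousLinearMap.snd ℝ _ _).prod
      ((ContinuousLinearMap.fst ℝ _ _).prod 0))).prod
    (joinL 2 ∘L ((0 : FibQgH →L[ℝ] _).prod
      ((ContinuousLinearMap.snd ℝ _ _ ∘L ContinuousLinearMap.snd ℝ _ _).prod 0)))

theorem secL_apply (v : FibQgH) :
    secL v = (v.2.1.prod (v.1.prod 0), (0 : E4 [⋀^Fin 2]→L[ℝ] so31).prod (v.2.2.prod 0)) :=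
  Prod.ext (joinL_apply _ _ _) (joinL_apply _ _ _)

variable (T : so31 →ₗ[ℝ] so31) (β : ℝ)

/-- The fields of quadratically extended General Relativity determined by `v = (e, A, τ)` and
`S`: the forms `c` and `B` solve their own field equations. -/
noncomputable def graphField (s : Set E4) (S : E4 → E4 [⋀^Fin 1]→L[ℝ] so31Dual) (v : E4 → FibQgH)
    (x : E4) : FibQeGR :=
  ((v x).2.1.prod ((v x).1.prod (S x)),
    (-mapVal (deformInv T β) (curvature bracketG s (fun y => (v y).2.1) x)).prod
      ((v x).2.2.prod (-mapVal (deformInvDual T β) (covDeriv coad s (fun y => (v y).2.1) S x +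
        (1 / 2 : ℝ) • wedge wedgeV (v x).1 (v x).1))))

/-- The first variation of `graphField` at `U` if `(e, A, τ)` varies by `w` and `S` by `σ`. -/
noncomputable def liftField (s : Set E4) (σ : E4 → E4 [⋀^Fin 1]→L[ℝ] so31Dual) (w : E4 → FibQgH)
    (U : E4 → FibQeGR) (x : E4) : FibQeGR :=
  ((w x).2.1.prod ((w x).1.prod (σ x)),
    (-mapVal (deformInv T β) (covDeriv bracketG s (fun y => compG (U y).1)
        (fun y => (w y).2.1) x)).prod
      ((w x).2.2.prod (-mapVal (deformInvDual T β)
        (covDeriv coad s (fun y => compG (U y).1) σ x + wedge coad (w x).2.1 (compGDual (U x).1) +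
          (1 / 2 : ℝ) • (wedge wedgeV (w x).1 (compV (U x).1) +
            wedge wedgeV (compV (U x).1) (w x).1)))))

variable {T β}

theorem residC_congr {U U' : E4 → FibQeGR} (h : EqOn U U' s) (hx : x ∈ s) :
    residC T β s U x = residC T β s U' x := by
  rw [residC, residC, h hx,
    curvature_congr bracketG (A' := fun y => compG (U' y).1) (fun y hy => by simp only [h hy]) hx]

theorem residB_congr {U U' : E4 → FibQeGR} (h : EqOn U U' s) (hx : x ∈ s) :
    residB T β s U x = residB T β s U' x := by
  rw [residB, residB, h hx,
    covDeriv_congr coad (A' := fun y => compG (U' y).1) (σ' := fun y => compGDual (U' y).1)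
      (fun y hy => by simp only [h hy]) (fun y hy => by simp only [h hy]) hx]

theorem residC_graphField (S : E4 → E4 [⋀^Fin 1]→L[ℝ] so31Dual) (v : E4 → FibQgH) :
    residC T β s (graphField T β s S v) x = 0 :=
  neg_add_cancel _

theorem residB_graphField (S : E4 → E4 [⋀^Fin 1]→L[ℝ] so31Dual) (v : E4 → FibQgH) :
    residB T β s (graphField T β s S v) x = 0 :=
  neg_add_cancel (mapVal (deformInvDual T β) (covDeriv coad s (fun y => (v y).2.1) S x +
    (1 / 2 : ℝ) • wedge wedgeV (v x).1 (v x).1))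

theorem eq_graphField {U : E4 → FibQeGR} (hC : residC T β s U x = 0) (hB : residB T β s U x = 0) :
    U x = graphField T β s (fun y => compGDual (U y).1) (fun y => projL (U y)) x := by
  have h1 : compG (U x).2 = _ := eq_neg_of_add_eq_zero_left hC
  have h2 : compGDual (U x).2 = _ := eq_neg_of_add_eq_zero_left hB
  refine Prod.ext (prod_comp_eq _).symm ?_
  rw [← prod_comp_eq (U x).2, h1, h2]
  rfl

section Velocity

variable {U : ℝ → E4 → FibQeGR} {X : E4 → FibQeGR}

theorem line_zero {W : Type*} [NormedAddCommGroup W] [NormedSpace ℝ W] (f g : E4 → W) :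
    (fun y => f y + (0 : ℝ) • g y) = f := by
  funext y
  rw [zero_smul, add_zero]

theorem SmoothFamily.connG (hU : SmoothFamily s U) : SmoothFamily s fun t x => compG (U t x).1 :=
  SmoothFamily.clm (W' := E4 [⋀^Fin 1]→L[ℝ] so31) hU connGL

theorem SmoothFamily.connGDual (hU : SmoothFamily s U) :
    SmoothFamily s fun t x => compGDual (U t x).1 :=
  SmoothFamily.clm (W' := E4 [⋀^Fin 1]→L[ℝ] so31Dual) hU connGDualL

theorem HasVelocity.connG (h : HasVelocity s U X t) :
    HasVelocity s (fun t x => compG (U t x).1) (fun x => compG (X x).1) t :=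
  HasVelocity.clm (W' := E4 [⋀^Fin 1]→L[ℝ] so31) h connGL

theorem HasVelocity.connV (h : HasVelocity s U X t) :
    HasVelocity s (fun t x => compV (U t x).1) (fun x => compV (X x).1) t :=
  HasVelocity.clm (W' := E4 [⋀^Fin 1]→L[ℝ] Mink) h connVL

theorem HasVelocity.connGDual (h : HasVelocity s U X t) :
    HasVelocity s (fun t x => compGDual (U t x).1) (fun x => compGDual (X x).1) t :=
  HasVelocity.clm (W' := E4 [⋀^Fin 1]→L[ℝ] so31Dual) h connGDualL

theorem HasVelocity.auxG (h : HasVelocity s U X t) :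
    HasVelocity s (fun t x => compG (U t x).2) (fun x => compG (X x).2) t :=
  HasVelocity.clm (W' := E4 [⋀^Fin 2]→L[ℝ] so31) h auxGL

theorem HasVelocity.auxGDual (h : HasVelocity s U X t) :
    HasVelocity s (fun t x => compGDual (U t x).2) (fun x => compGDual (X x).2) t :=
  HasVelocity.clm (W' := E4 [⋀^Fin 2]→L[ℝ] so31Dual) h auxGDualL

theorem HasVelocity.residC (hs : IsCalcDomain s) (hU : SmoothFamily s U)
    (h : HasVelocity s U X t) :
    HasVelocity s (fun t x => residC T β s (U t) x) (fun x => compG (X x).2 +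
      _root_.mapVal (deformInv T β) (_root_.covDeriv bracketG s (fun y => compG (U t y).1)
        (fun y => compG (X y).1) x)) t := by
  have h1 := (HasVelocity.curvature hs hU.connG h.connG).mapVal (deformInv T β)
  exact h.auxG.add h1

theorem HasVelocity.residB (hs : IsCalcDomain s) (hU : SmoothFamily s U)
    (h : HasVelocity s U X t) :
    HasVelocity s (fun t x => residB T β s (U t) x) (fun x => compGDual (X x).2 +
      _root_.mapVal (deformInvDual T β) (_root_.covDeriv coad s (fun y => compG (U t y).1)
          (fun y => compGDual (X y).1) x + _root_.wedge coad (compG (X x).1) (compGDual (U t x).1) +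
        (1 / 2 : ℝ) • (_root_.wedge wedgeV (compV (X x).1) (compV (U t x).1) +
          _root_.wedge wedgeV (compV (U t x).1) (compV (X x).1)))) t := by
  have h1 := HasVelocity.covDeriv (b := coad) hs hU.connGDual h.connG h.connGDual
  have h2 := (h.connV.wedge h.connV wedgeV).const_smul (1 / 2)
  have h3 := (h1.add h2).mapVal (deformInvDual T β)
  exact h.auxGDual.add h3

/-- The variation of the three-form `⟨(id + β T)⁻¹ F_A, S⟩`. -/
noncomputable def bdryOn (T : so31 →ₗ[ℝ] so31) (β : ℝ) (s : Set E4) (U X : E4 → FibQeGR) (x : E4) :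
    E4 [⋀^Fin 3]→L[ℝ] ℝ :=
  wedge pairG (mapVal (deformInv T β) (covDeriv bracketG s (fun y => compG (U y).1)
      (fun y => compG (X y).1) x)) (compGDual (U x).1) +
    wedge pairG (mapVal (deformInv T β) (curvature bracketG s (fun y => compG (U y).1) x))
      (compGDual (X x).1)

theorem hasVelocity_bdryOn (hs : IsCalcDomain s) (hU : SmoothFamily s U)
    (h : HasVelocity s U X t) :
    HasVelocity s (fun t x => (wedge pairG (mapVal (deformInv T β)
        (curvature bracketG s (fun y => compG (U t y).1) x)) (compGDual (U t x).1) :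
          E4 [⋀^Fin 3]→L[ℝ] ℝ)) (bdryOn T β s (U t) X) t :=
  ((HasVelocity.curvature hs hU.connG h.connG).mapVal _).wedge h.connGDual pairG

/-- The Lagrangian density of quadratically extended General Relativity on a domain. -/
noncomputable def lagQeGR (T : so31 →ₗ[ℝ] so31) (β : ℝ) (s : Set E4) (U : E4 → FibQeGR) (x : E4) :
    E4 [⋀^Fin 4]→L[ℝ] ℝ :=
  wedge pairD (U x).2 (curvature bracketD s (fun y => (U y).1) x) +
    (1 / 2 : ℝ) • (wedge pairD (U x).2 (U x).2 + β • wedge (pairTwisted T) (U x).2 (U x).2)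

/-- The Lagrangian density of quadratic generalised Holst theory on a domain. -/
noncomputable def lagQgH (T : so31 →ₗ[ℝ] so31) (β : ℝ) (s : Set E4) (v : E4 → FibQgH) (x : E4) :
    E4 [⋀^Fin 4]→L[ℝ] ℝ :=
  (1 / 2 : ℝ) • wedge pairG
      (mapVal (deformInv T β) (curvature bracketG s (fun y => (v y).2.1) x))
      (wedge wedgeV (v x).1 (v x).1) -
    wedge eta (v x).2.2 (covDeriv so31.toEnd s (fun y => (v y).2.1) (fun y => (v y).1) x) -
    ((1 + β) / 2) • wedge eta (v x).2.2 (v x).2.2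

/-- The part of the Lagrangian that is quadratic in the field equations of `c` and `B`. -/
noncomputable def residPair (T : so31 →ₗ[ℝ] so31) (β : ℝ) (s : Set E4) (U : E4 → FibQeGR)
    (x : E4) : E4 [⋀^Fin 4]→L[ℝ] ℝ :=
  wedge pairG (mapVal (deformL T β) (residC T β s U x)) (residB T β s U x)

set_option maxRecDepth 10000 in
/-- The Lagrangian of quadratically extended General Relativity is minus that of quadratic Holst
theory, up to an exact term and a term that is quadratic in the field equations of `c` and `B`. -/
theorem lagQeGR_eq (hT : AdEquivariant T) (h : IsUnit (deform T β)) (hs : IsCalcDomain s)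
    {U : E4 → FibQeGR} (hU : ContDiffOn ℝ ∞ U s) (hx : x ∈ s) :
    lagQeGR T β s U x = residPair T β s U x -
      extDerivWithin (fun x => (wedge pairG (mapVal (deformInv T β)
        (curvature bracketG s (fun y => compG (U y).1) x)) (compGDual (U x).1) :
          E4 [⋀^Fin 3]→L[ℝ] ℝ)) s x - lagQgH T β s (fun y => projL (U y)) x := by
  have hc := smoothFamily_const hU
  have h1 := extDerivWithin_pairG_curvature (hT.deformInv h) hs.uniqueDiffOn hx
    (hs.subset_closure hx) (hc.connG.contDiffOn 0) (hc.connGDual.contDiffOn 0)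
    (((hc.connG.curvature (b := bracketG) hs).contDiffOn 0 x hx).differentiableWithinAt (by simp))
  have h2 : SmoothFamily s fun _ : ℝ => fun y => (U y).1 :=
    SmoothFamily.clm (W' := E4 [⋀^Fin 1]→L[ℝ] dAlg) hc connL
  have h2 := (h2.contDiffOn 0 x hx).differentiableWithinAt (by simp)
  rw [lagQeGR, lagrangian_eq_completed_square h (hs.uniqueDiffOn x hx) h2, residPair, h1, lagQgH]
  simp only [projL_apply]

/-- The first variations of the two Lagrangians agree up to sign, an exact term, and the variation
`q` of the quadratic term. -/
theorem hasDerivAt_lagQgH_iff (hT : AdEquivariant T) (h : IsUnit (deform T β))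
    (hs : IsCalcDomain s) {U X : E4 → FibQeGR} (hU : ContDiffOn ℝ ∞ U s) (hX : ContDiffOn ℝ ∞ X s)
    (hx : x ∈ s) {q : E4 [⋀^Fin 4]→L[ℝ] ℝ}
    (hq : HasDerivAt (fun t : ℝ => residPair T β s (fun y => U y + t • X y) x) q 0)
    (D : E4 [⋀^Fin 4]→L[ℝ] ℝ) :
    HasDerivAt (fun t : ℝ => lagQgH T β s (fun y => projL (U y + t • X y)) x) D 0 ↔
      HasDerivAt (fun t : ℝ => lagQeGR T β s (fun y => U y + t • X y) x)
        (q - extDerivWithin (bdryOn T β s U X) s x - D) 0 := by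
  have hf := smoothFamily_line hU hX
  have hv := hasVelocity_line (s := s) (t := 0) U X
  have hb := hasVelocity_bdryOn (T := T) (β := β) hs hf hv
  have hbs : SmoothFamily s fun t x => (wedge pairG (mapVal (deformInv T β)
      (curvature bracketG s (fun y => compG (U y + t • X y).1) x)) (compGDual (U x + t • X x).1) :
        E4 [⋀^Fin 3]→L[ℝ] ℝ) :=
    ((hf.connG.curvature hs).mapVal _).wedge hf.connGDual pairG
  have hy := HasVelocity.extDerivWithin hs hbs hb x hx
  rw [line_zero U X] at hy
  have he : ∀ t : ℝ, lagQeGR T β s (fun y => U y + t • X y) x = _ := fun t =>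
    lagQeGR_eq hT h hs (hf.contDiffOn t) hx
  constructor
  · intro hD
    exact ((hq.sub hy).sub hD).congr_of_eventuallyEq (Eventually.of_forall he)
  · intro hD
    have h1 := ((hq.sub hy).sub hD).congr_of_eventuallyEq (Eventually.of_forall fun t =>
      show lagQgH T β s (fun y => projL (U y + t • X y)) x = _ from
        eq_sub_of_add_eq ((congrArg (_ + ·) (he t)).trans (add_sub_cancel _ _)))
    rwa [sub_sub_cancel] at h1

theorem hasDerivAt_residPair (hs : IsCalcDomain s) (hU : SmoothFamily s U)
    (h : HasVelocity s U X t) (hx : x ∈ s)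
    {V : E4 → FibQeGR} (hV : U t = V) {c : E4 [⋀^Fin 2]→L[ℝ] so31}
    {b : E4 [⋀^Fin 2]→L[ℝ] so31Dual} (hc : compG (X x).2 +
      mapVal (deformInv T β) (covDeriv bracketG s (fun y => compG (V y).1)
        (fun y => compG (X y).1) x) = c)
    (hb : compGDual (X x).2 +
      mapVal (deformInvDual T β) (covDeriv coad s (fun y => compG (V y).1)
          (fun y => compGDual (X y).1) x + wedge coad (compG (X x).1) (compGDual (V x).1) +
        (1 / 2 : ℝ) • (wedge wedgeV (compV (X x).1) (compV (V x).1) +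
          wedge wedgeV (compV (V x).1) (compV (X x).1))) = b) :
    HasDerivAt (fun t => residPair T β s (U t) x)
      (wedge pairG (mapVal (deformL T β) c) (_root_.residB T β s V x) +
        wedge pairG (mapVal (deformL T β) (_root_.residC T β s V x)) b) t := by
  subst hV hc hb
  exact (((HasVelocity.residC hs hU h).mapVal (deformL T β)).wedge
    (HasVelocity.residB hs hU h) pairG) x hx

end Velocity

end Local

/-! ### Families and locality of reconstructed fields -/

section Local

variable {s : Set E4} {x : E4} {t : ℝ} {T : so31 →ₗ[ℝ] so31} {β : ℝ}

/-- The component `e` of the fields `(e, A, τ)`. -/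
noncomputable def coframeL : FibQgH →L[ℝ] E4 [⋀^Fin 1]→L[ℝ] Mink :=
  ContinuousLinearMap.fst ℝ (E4 [⋀^Fin 1]→L[ℝ] Mink)
    ((E4 [⋀^Fin 1]→L[ℝ] so31) × (E4 [⋀^Fin 2]→L[ℝ] Mink))

/-- The component `A` of the fields `(e, A, τ)`. -/
noncomputable def gaugeL : FibQgH →L[ℝ] E4 [⋀^Fin 1]→L[ℝ] so31 :=
  ContinuousLinearMap.fst ℝ (E4 [⋀^Fin 1]→L[ℝ] so31) (E4 [⋀^Fin 2]→L[ℝ] Mink) ∘L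
    ContinuousLinearMap.snd ℝ (E4 [⋀^Fin 1]→L[ℝ] Mink)
      ((E4 [⋀^Fin 1]→L[ℝ] so31) × (E4 [⋀^Fin 2]→L[ℝ] Mink))

/-- The component `τ` of the fields `(e, A, τ)`. -/
noncomputable def torsionL : FibQgH →L[ℝ] E4 [⋀^Fin 2]→L[ℝ] Mink :=
  ContinuousLinearMap.snd ℝ (E4 [⋀^Fin 1]→L[ℝ] so31) (E4 [⋀^Fin 2]→L[ℝ] Mink) ∘L
    ContinuousLinearMap.snd ℝ (E4 [⋀^Fin 1]→L[ℝ] Mink)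
      ((E4 [⋀^Fin 1]→L[ℝ] so31) × (E4 [⋀^Fin 2]→L[ℝ] Mink))

section Join

variable {p : ℕ}

theorem SmoothFamily.join {a : ℝ → E4 → E4 [⋀^Fin p]→L[ℝ] so31}
    {e : ℝ → E4 → E4 [⋀^Fin p]→L[ℝ] Mink} {S : ℝ → E4 → E4 [⋀^Fin p]→L[ℝ] so31Dual}
    (ha : SmoothFamily s a) (he : SmoothFamily s e) (hS : SmoothFamily s S) :
    SmoothFamily s fun t x => (a t x).prod ((e t x).prod (S t x)) := by
  simp only [← joinL_apply]
  exact SmoothFamily.clm (W' := E4 [⋀^Fin p]→L[ℝ] dAlg) (ha.prodMk (he.prodMk hS)) (joinL p)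

theorem HasVelocity.join {a : ℝ → E4 → E4 [⋀^Fin p]→L[ℝ] so31}
    {e : ℝ → E4 → E4 [⋀^Fin p]→L[ℝ] Mink} {S : ℝ → E4 → E4 [⋀^Fin p]→L[ℝ] so31Dual}
    {a' : E4 → E4 [⋀^Fin p]→L[ℝ] so31}
    {e' : E4 → E4 [⋀^Fin p]→L[ℝ] Mink} {S' : E4 → E4 [⋀^Fin p]→L[ℝ] so31Dual}
    (ha : HasVelocity s a a' t) (he : HasVelocity s e e' t) (hS : HasVelocity s S S' t) :
    HasVelocity s (fun t x => (a t x).prod ((e t x).prod (S t x)))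
      (fun x => (a' x).prod ((e' x).prod (S' x))) t := by
  simp only [← joinL_apply]
  exact HasVelocity.clm (W' := E4 [⋀^Fin p]→L[ℝ] dAlg) (ha.prodMk (he.prodMk hS)) (joinL p)

theorem LocalOn.join {X W : Type*} [NormedAddCommGroup W] [NormedSpace ℝ W] {F : Set X}
    {r : X → E4 → W} {a : X → E4 → E4 [⋀^Fin p]→L[ℝ] so31}
    {e : X → E4 → E4 [⋀^Fin p]→L[ℝ] Mink} {S : X → E4 → E4 [⋀^Fin p]→L[ℝ] so31Dual}
    (ha : LocalOn s F r a) (he : LocalOn s F r e) (hS : LocalOn s F r S) :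
    LocalOn s F r fun u x => (a u x).prod ((e u x).prod (S u x)) := by
  simp only [← joinL_apply]
  exact LocalOn.clm (W₂ := E4 [⋀^Fin p]→L[ℝ] dAlg) (ha.prodMk (he.prodMk hS)) (joinL p)

end Join

section Families

variable {U : ℝ → E4 → FibQeGR} {S : ℝ → E4 → E4 [⋀^Fin 1]→L[ℝ] so31Dual} {v : ℝ → E4 → FibQgH}
  {σ : E4 → E4 [⋀^Fin 1]→L[ℝ] so31Dual} {w : E4 → FibQgH}

theorem SmoothFamily.connV (hU : SmoothFamily s U) : SmoothFamily s fun t x => compV (U t x).1 :=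
  SmoothFamily.clm (W' := E4 [⋀^Fin 1]→L[ℝ] Mink) hU connVL

theorem SmoothFamily.auxG (hU : SmoothFamily s U) : SmoothFamily s fun t x => compG (U t x).2 :=
  SmoothFamily.clm (W' := E4 [⋀^Fin 2]→L[ℝ] so31) hU auxGL

theorem SmoothFamily.auxGDual (hU : SmoothFamily s U) :
    SmoothFamily s fun t x => compGDual (U t x).2 :=
  SmoothFamily.clm (W' := E4 [⋀^Fin 2]→L[ℝ] so31Dual) hU auxGDualL

theorem SmoothFamily.residC (hs : IsCalcDomain s) (hU : SmoothFamily s U) :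
    SmoothFamily s fun t x => residC T β s (U t) x := by
  have h1 := (hU.connG.curvature (b := bracketG) hs).mapVal (deformInv T β)
  exact hU.auxG.add h1

theorem SmoothFamily.residB (hs : IsCalcDomain s) (hU : SmoothFamily s U) :
    SmoothFamily s fun t x => residB T β s (U t) x := by
  have h1 := SmoothFamily.covDeriv (b := coad) hs hU.connG hU.connGDual
  have h2 := (hU.connV.wedge hU.connV wedgeV).const_smul (1 / 2)
  have h3 := (h1.add h2).mapVal (deformInvDual T β)
  exact hU.auxGDual.add h3

theorem smoothFamily_graphField (hs : IsCalcDomain s) (hS : SmoothFamily s S)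
    (hv : SmoothFamily s v) : SmoothFamily s fun t => graphField T β s (S t) (v t) := by
  have he : SmoothFamily s fun t x => (v t x).1 :=
    SmoothFamily.clm (W' := E4 [⋀^Fin 1]→L[ℝ] Mink) hv coframeL
  have hA : SmoothFamily s fun t x => (v t x).2.1 :=
    SmoothFamily.clm (W' := E4 [⋀^Fin 1]→L[ℝ] so31) hv gaugeL
  have ht : SmoothFamily s fun t x => (v t x).2.2 :=
    SmoothFamily.clm (W' := E4 [⋀^Fin 2]→L[ℝ] Mink) hv torsionL
  have h1 := ((hA.curvature (b := bracketG) hs).mapVal (deformInv T β)).neg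
  have h2 := SmoothFamily.covDeriv (b := coad) hs hA hS
  have h3 := (he.wedge he wedgeV).const_smul (1 / 2)
  have h4 := ((h2.add h3).mapVal (deformInvDual T β)).neg
  exact (hA.join he hS).prodMk (h1.join ht h4)

/-- The velocity of a family of graphs is the lift of the velocity of the base. -/
theorem hasVelocity_graphField (hs : IsCalcDomain s) (hS : SmoothFamily s S)
    (hv : SmoothFamily s v) (hS' : HasVelocity s S σ t) (hv' : HasVelocity s v w t) :
    HasVelocity s (fun t => graphField T β s (S t) (v t))
      (liftField T β s σ w (graphField T β s (S t) (v t))) t := by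
  have hA : SmoothFamily s fun t x => (v t x).2.1 :=
    SmoothFamily.clm (W' := E4 [⋀^Fin 1]→L[ℝ] so31) hv gaugeL
  have he' : HasVelocity s (fun t x => (v t x).1) (fun x => (w x).1) t :=
    HasVelocity.clm (W' := E4 [⋀^Fin 1]→L[ℝ] Mink) hv' coframeL
  have hA' : HasVelocity s (fun t x => (v t x).2.1) (fun x => (w x).2.1) t :=
    HasVelocity.clm (W' := E4 [⋀^Fin 1]→L[ℝ] so31) hv' gaugeL
  have ht' : HasVelocity s (fun t x => (v t x).2.2) (fun x => (w x).2.2) t :=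
    HasVelocity.clm (W' := E4 [⋀^Fin 2]→L[ℝ] Mink) hv' torsionL
  have h1 := ((HasVelocity.curvature hs hA hA').mapVal (deformInv T β)).neg
  have h2 := HasVelocity.covDeriv (b := coad) hs hS hA' hS'
  have h3 := (he'.wedge he' wedgeV).const_smul (1 / 2)
  have h4 := ((h2.add h3).mapVal (deformInvDual T β)).neg
  exact (hA'.join he' hS').prodMk (h1.join ht' h4)

end Families

section Locality

variable {X W : Type*} [NormedAddCommGroup W] [NormedSpace ℝ W] {F : Set X} {r : X → E4 → W}
  {U Y : X → E4 → FibQeGR} {S σ : X → E4 → E4 [⋀^Fin 1]→L[ℝ] so31Dual} {v w : X → E4 → FibQgH}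

theorem localOn_graphField (hs : UniqueDiffOn ℝ s) (hr : ∀ u ∈ F, ContDiffOn ℝ ∞ (r u) s)
    (hS : LocalOn s F r S) (hv : LocalOn s F r v) :
    LocalOn s F r fun u => graphField T β s (S u) (v u) := by
  have he : LocalOn s F r fun u x => (v u x).1 :=
    LocalOn.clm (W₂ := E4 [⋀^Fin 1]→L[ℝ] Mink) hv coframeL
  have hA : LocalOn s F r fun u x => (v u x).2.1 :=
    LocalOn.clm (W₂ := E4 [⋀^Fin 1]→L[ℝ] so31) hv gaugeL
  have ht : LocalOn s F r fun u x => (v u x).2.2 :=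
    LocalOn.clm (W₂ := E4 [⋀^Fin 2]→L[ℝ] Mink) hv torsionL
  have h1 := ((hA.curvature hs hr (b := bracketG)).mapVal (deformInv T β)).neg
  have h2 := LocalOn.covDeriv hs hr (b := coad) hA hS
  have h3 := (he.wedge he wedgeV).const_smul (1 / 2)
  have h4 := ((h2.add h3).mapVal (deformInvDual T β)).neg
  exact (hA.join he hS).prodMk (h1.join ht h4)

set_option maxHeartbeats 800000 in
theorem localOn_liftField (hs : UniqueDiffOn ℝ s) (hr : ∀ u ∈ F, ContDiffOn ℝ ∞ (r u) s)
    (hσ : LocalOn s F r σ) (hw : LocalOn s F r w) (hU : LocalOn s F r U) :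
    LocalOn s F r fun u => liftField T β s (σ u) (w u) (U u) := by
  have he : LocalOn s F r fun u x => (w u x).1 :=
    LocalOn.clm (W₂ := E4 [⋀^Fin 1]→L[ℝ] Mink) hw coframeL
  have hA : LocalOn s F r fun u x => (w u x).2.1 :=
    LocalOn.clm (W₂ := E4 [⋀^Fin 1]→L[ℝ] so31) hw gaugeL
  have ht : LocalOn s F r fun u x => (w u x).2.2 :=
    LocalOn.clm (W₂ := E4 [⋀^Fin 2]→L[ℝ] Mink) hw torsionL
  have hUA : LocalOn s F r fun u x => compG (U u x).1 :=
    LocalOn.clm (W₂ := E4 [⋀^Fin 1]→L[ℝ] so31) hU connGL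
  have hUe : LocalOn s F r fun u x => compV (U u x).1 :=
    LocalOn.clm (W₂ := E4 [⋀^Fin 1]→L[ℝ] Mink) hU connVL
  have hUS : LocalOn s F r fun u x => compGDual (U u x).1 :=
    LocalOn.clm (W₂ := E4 [⋀^Fin 1]→L[ℝ] so31Dual) hU connGDualL
  have h1 := ((LocalOn.covDeriv hs hr (b := bracketG) hUA hA).mapVal (deformInv T β)).neg
  have h2 := (LocalOn.covDeriv hs hr (b := coad) hUA hσ).add (hA.wedge hUS coad)
  have h3 := ((he.wedge hUe wedgeV).add (hUe.wedge he wedgeV)).const_smul (1 / 2)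
  have h4 := ((h2.add h3).mapVal (deformInvDual T β)).neg
  exact (hA.join he hσ).prodMk (h1.join ht h4)

theorem localOn_bdryOn (hs : UniqueDiffOn ℝ s) (hr : ∀ u ∈ F, ContDiffOn ℝ ∞ (r u) s)
    (hU : LocalOn s F r U) (hY : LocalOn s F r Y) :
    LocalOn s F r fun u => bdryOn T β s (U u) (Y u) := by
  have hUA := LocalOn.clm (W₂ := E4 [⋀^Fin 1]→L[ℝ] so31) hU connGL
  have hUS := LocalOn.clm (W₂ := E4 [⋀^Fin 1]→L[ℝ] so31Dual) hU connGDualL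
  have hYA := LocalOn.clm (W₂ := E4 [⋀^Fin 1]→L[ℝ] so31) hY connGL
  have hYS := LocalOn.clm (W₂ := E4 [⋀^Fin 1]→L[ℝ] so31Dual) hY connGDualL
  have h1 := (LocalOn.covDeriv hs hr (b := bracketG) hUA hYA).mapVal (deformInv T β)
  have h2 := (hUA.curvature hs hr (b := bracketG)).mapVal (deformInv T β)
  exact (h1.wedge hUS pairG).add (h2.wedge hYS pairG)

end Locality

end Local

/-! ### Pointwise form of the field equations of `c` and `B` -/

section Local

variable {s : Set E4} {x : E4} {t : ℝ} {T : so31 →ₗ[ℝ] so31} {β : ℝ}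

theorem lagQgH_congr {v v' : E4 → FibQgH} (h : EqOn v v' s) (hx : x ∈ s) :
    lagQgH T β s v x = lagQgH T β s v' x := by
  rw [lagQgH, lagQgH, h hx,
    curvature_congr bracketG (A' := fun y => (v' y).2.1) (fun y hy => by simp only [h hy]) hx,
    covDeriv_congr so31.toEnd (A' := fun y => (v' y).2.1) (σ' := fun y => (v' y).1)
      (fun y hy => by simp only [h hy]) (fun y hy => by simp only [h hy]) hx]

theorem lagQeGR_congr {U U' : E4 → FibQeGR} (h : EqOn U U' s) (hx : x ∈ s) :
    lagQeGR T β s U x = lagQeGR T β s U' x := by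
  rw [lagQeGR, lagQeGR, h hx,
    curvature_congr bracketD (A' := fun y => (U' y).1) (fun y hy => by simp only [h hy]) hx]

theorem residPair_congr {U U' : E4 → FibQeGR} (h : EqOn U U' s) (hx : x ∈ s) :
    residPair T β s U x = residPair T β s U' x := by
  rw [residPair, residPair, residC_congr h hx, residB_congr h hx]

theorem extDerivWithin_eq_zero {W : Type*} [NormedAddCommGroup W] [NormedSpace ℝ W] {n : ℕ}
    {Y : E4 → E4 [⋀^Fin n]→L[ℝ] W} (h : ∀ y ∈ s, Y y = 0) (hx : x ∈ s) :
    extDerivWithin Y s x = 0 := by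
  rw [extDerivWithin, fderivWithin_congr (f := fun _ => (0 : E4 [⋀^Fin n]→L[ℝ] W)) h (h x hx),
    fderivWithin_const_apply]
  exact map_zero (ContinuousAlternatingMap.alternatizeUncurryFinCLM ℝ E4 W)

theorem mapVal_zero {W W' : Type*} [NormedAddCommGroup W] [NormedSpace ℝ W]
    [NormedAddCommGroup W'] [NormedSpace ℝ W'] (f : W →L[ℝ] W') {p : ℕ} :
    mapVal f (0 : E4 [⋀^Fin p]→L[ℝ] W) = 0 :=
  ContinuousAlternatingMap.ext fun _ => f.map_zero

theorem wedge_zero_left {W₁ W₂ W₃ : Type*} [NormedAddCommGroup W₁] [NormedSpace ℝ W₁]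
    [NormedAddCommGroup W₂] [NormedSpace ℝ W₂] [NormedAddCommGroup W₃] [NormedSpace ℝ W₃]
    [FiniteDimensional ℝ W₁] [FiniteDimensional ℝ W₂] (b : W₁ →L[ℝ] W₂ →L[ℝ] W₃) {p q : ℕ}
    (γ : E4 [⋀^Fin q]→L[ℝ] W₂) : wedge b (0 : E4 [⋀^Fin p]→L[ℝ] W₁) γ = 0 := by
  have h := (wedgeL b p q).map_zero
  exact congrArg (fun f => f γ) h

theorem wedge_zero_right {W₁ W₂ W₃ : Type*} [NormedAddCommGroup W₁] [NormedSpace ℝ W₁]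
    [NormedAddCommGroup W₂] [NormedSpace ℝ W₂] [NormedAddCommGroup W₃] [NormedSpace ℝ W₃]
    [FiniteDimensional ℝ W₁] [FiniteDimensional ℝ W₂] (b : W₁ →L[ℝ] W₂ →L[ℝ] W₃) {p q : ℕ}
    (α : E4 [⋀^Fin p]→L[ℝ] W₁) : wedge b α (0 : E4 [⋀^Fin q]→L[ℝ] W₂) = 0 :=
  (wedgeL b p q α).map_zero

theorem bdryOn_eq_zero {U Y : E4 → FibQeGR} (h : (fun y => (Y y).1) =ᶠ[𝓝[s] x] fun _ => 0)
    (hx : x ∈ s) : bdryOn T β s U Y x = 0 := by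
  have h1 : (fun y => compG (Y y).1) =ᶠ[𝓝[s] x] fun _ => 0 := h.mono fun y hy =>
    (congrArg compG hy).trans (mapVal_zero _)
  have h2 : compGDual (Y x).1 = 0 :=
    (congrArg compGDual (h.self_of_nhdsWithin hx)).trans (mapVal_zero _)
  rw [bdryOn, covDeriv_eq_zero bracketG _ hx h1, h2, wedge_zero_right, mapVal_zero,
    wedge_zero_left, add_zero]

section Critical

variable {U Y : E4 → FibQeGR}

/-- The first variation of `lagQeGR` in the direction of `c` and `B`. -/
theorem hasDerivAt_lagQeGR (hT : AdEquivariant T) (h : IsUnit (deform T β))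
    (hs : IsCalcDomain s) (hU : ContDiffOn ℝ ∞ U s) (hY : ContDiffOn ℝ ∞ Y s)
    (h1 : ∀ y ∈ s, (Y y).1 = 0) (h2 : ∀ y ∈ s, compV (Y y).2 = 0) (hx : x ∈ s) :
    HasDerivAt (fun t : ℝ => lagQeGR T β s (fun y => U y + t • Y y) x)
      (wedge pairG (mapVal (deformL T β) (compG (Y x).2)) (residB T β s U x) +
        wedge pairG (mapVal (deformL T β) (residC T β s U x)) (compGDual (Y x).2)) 0 := by
  have hf := smoothFamily_line hU hY
  have hv := hasVelocity_line (s := s) (t := 0) U Y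
  have hzG : (fun y => compG (Y y).1) =ᶠ[𝓝[s] x] fun _ => 0 :=
    eventually_of_mem self_mem_nhdsWithin fun y hy =>
      (congrArg compG (h1 y hy)).trans (mapVal_zero _)
  have hzD : (fun y => compGDual (Y y).1) =ᶠ[𝓝[s] x] fun _ => 0 :=
    eventually_of_mem self_mem_nhdsWithin fun y hy =>
      (congrArg compGDual (h1 y hy)).trans (mapVal_zero _)
  have hq := hasDerivAt_residPair (T := T) (β := β) hs hf hv hx (line_zero U Y) (c := compG (Y x).2)
    (b := compGDual (Y x).2)
    (by rw [covDeriv_eq_zero bracketG _ hx hzG, mapVal_zero, add_zero])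
    (by rw [covDeriv_eq_zero coad _ hx hzD, h1 x hx,
          show compG (0 : E4 [⋀^Fin 1]→L[ℝ] dAlg) = 0 from mapVal_zero _,
          show compV (0 : E4 [⋀^Fin 1]→L[ℝ] dAlg) = 0 from mapVal_zero _,
          wedge_zero_left, wedge_zero_left,
          wedge_zero_right, add_zero, smul_zero, add_zero,
          mapVal_zero]; exact add_zero (compGDual (Y x).2))
  have hD : HasDerivAt (fun t : ℝ => lagQgH T β s (fun y => projL (U y + t • Y y)) x) 0 0 := by
    refine (hasDerivAt_const (0 : ℝ) (lagQgH T β s (fun y => projL (U y)) x)).congr_of_eventuallyEq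
      (Eventually.of_forall fun t => lagQgH_congr (fun y hy => ?_) hx)
    have h0 : projL (Y y) = 0 := by
      rw [projL_apply, h1 y hy, h2 y hy]
      exact Prod.ext (mapVal_zero _) (Prod.ext (mapVal_zero _) rfl)
    exact (map_add projL (U y) (t • Y y)).trans
      (by rw [map_smul, h0, smul_zero, add_zero])
  have := (hasDerivAt_lagQgH_iff hT h hs hU hY hx hq 0).1 hD
  rwa [extDerivWithin_eq_zero (fun y hy => ?_) hx, sub_zero, sub_zero] at this
  exact bdryOn_eq_zero (eventually_of_mem self_mem_nhdsWithin h1) hy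

/-- The field equations of `c` and `B`, tested against decomposable two-forms. -/
theorem residC_eq_zero_of_forall (h : IsUnit (deform T β))
    (h0 : ∀ i j u u', (wedge pairG (mapVal (deformL T β) (residC T β s U x))
      (wedge wedgeV (coordForm i u) (coordForm j u') : E4 [⋀^Fin 2]→L[ℝ] so31Dual) :
        E4 [⋀^Fin 4]→L[ℝ] ℝ) frame = 0) : residC T β s U x = 0 := by
  have h1 := two_form_eq_zero pairG wedgeV (fun X hX => so31.ext_eta fun v w => by
    rw [map_zero, zero_apply, map_zero, zero_apply]
    exact hX v w) _ h0
  ext1 v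
  have h2 : deformL T β (residC T β s U x v) = 0 := congrArg (fun α => α v) h1
  rw [← show deformInv T β (deformL T β (residC T β s U x v)) = residC T β s U x v from
    deformInv_deform h _, h2, map_zero]
  rfl

/-- The pairing `(z, X) ↦ z ((id + β T) X)`. -/
noncomputable def pairDeform (T : so31 →ₗ[ℝ] so31) (β : ℝ) : so31Dual →L[ℝ] so31 →L[ℝ] ℝ :=
  (ContinuousLinearMap.compL ℝ so31 so31 ℝ).flip (deformL T β)

theorem pairDeform_apply (z : so31Dual) (X : so31) : pairDeform T β z X = z (deformL T β X) := rfl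

theorem wedge_pairDeform (z : E4 [⋀^Fin 2]→L[ℝ] so31Dual) (γ : E4 [⋀^Fin 2]→L[ℝ] so31) :
    (wedge (pairDeform T β) z γ : E4 [⋀^Fin 4]→L[ℝ] ℝ) =
      wedge pairG (mapVal (deformL T β) γ) z := by
  ext v
  simp only [wedge_two_two, mapVal_apply, pairG_apply, pairDeform_apply]
  ring

theorem residB_eq_zero_of_forall (h : IsUnit (deform T β))
    (h0 : ∀ i j u u', (wedge (pairDeform T β) (residB T β s U x)
      (wedge wedgeG (coordForm i u) (coordForm j u') : E4 [⋀^Fin 2]→L[ℝ] so31) :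
        E4 [⋀^Fin 4]→L[ℝ] ℝ) frame = 0) : residB T β s U x = 0 :=
  two_form_eq_zero (pairDeform T β) wedgeG (fun z hz => by
    have h1 : z ∘L deformL T β = 0 := so31Dual_ext hz
    ext X
    have h2 := congrArg (fun f => f (deformInv T β X)) h1
    have h3 : deformL T β (deformInv T β X) = X := deform_deformInv h X
    simpa [h3] using h2) _ h0

end Critical

end Local

/-! ### Tensorial operations on global fields -/

namespace MinkowskiBundle

variable {H : Type*} [TopologicalSpace H] {I : ModelWithCorners ℝ E4 H}
  {M : Type*} [TopologicalSpace M] [ChartedSpace H M] {ι : Type*}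
  {Z : MinkowskiBundle I M ι} {W W' W₁ W₂ W₃ : Type*} [NormedAddCommGroup W] [NormedSpace ℝ W]
  [NormedAddCommGroup W'] [NormedSpace ℝ W'] {p q : ℕ}
  [NormedAddCommGroup W₁] [NormedSpace ℝ W₁] [NormedAddCommGroup W₂] [NormedSpace ℝ W₂]
  [NormedAddCommGroup W₃] [NormedSpace ℝ W₃]

theorem IsFormV.congr {σ σ' : Reps H M ι (E4 [⋀^Fin p]→L[ℝ] Mink)} (h : Z.IsFormV σ)
    (h' : ∀ k, EqOn (σ' k) (σ k) (Z.dom k)) : Z.IsFormV σ' := fun k k' x hx v => by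
  rw [h' k hx.1, h' k' (Z.trans_mem_dom hx)]
  exact h k k' x hx v

theorem IsFormG.congr {σ σ' : Reps H M ι (E4 [⋀^Fin p]→L[ℝ] so31)} (h : Z.IsFormG σ)
    (h' : ∀ k, EqOn (σ' k) (σ k) (Z.dom k)) : Z.IsFormG σ' := fun k k' x hx v => by
  rw [h' k hx.1, h' k' (Z.trans_mem_dom hx)]
  exact h k k' x hx v

theorem IsFormGDual.congr {σ σ' : Reps H M ι (E4 [⋀^Fin p]→L[ℝ] so31Dual)} (h : Z.IsFormGDual σ)
    (h' : ∀ k, EqOn (σ' k) (σ k) (Z.dom k)) : Z.IsFormGDual σ' := fun k k' x hx v => by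
  rw [h' k hx.1, h' k' (Z.trans_mem_dom hx)]
  exact h k k' x hx v

theorem IsConnection.congr {σ σ' : Reps H M ι (E4 [⋀^Fin 1]→L[ℝ] so31)} (h : Z.IsConnection σ)
    (h' : ∀ k, EqOn (σ' k) (σ k) (Z.dom k)) : Z.IsConnection σ' := fun k k' x hx v => by
  rw [h' k hx.1, h' k' (Z.trans_mem_dom hx)]
  exact h k k' x hx v

theorem isSmooth_indicator {u : Reps H M ι W} (h : ∀ k, ContDiffOn ℝ ∞ (u k) (Z.dom k)) :
    Z.IsSmooth fun k => (Z.dom k).indicator (u k) := fun k =>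
  ⟨(h k).congr fun _ hx => indicator_of_mem hx _, fun _ hx => indicator_of_notMem hx _⟩

theorem IsSmooth.clm {u : Reps H M ι W} (h : Z.IsSmooth u) (L : W →L[ℝ] W') :
    Z.IsSmooth fun k x => L (u k x) := fun k =>
  ⟨L.contDiff.comp_contDiffOn (h k).1, fun x hx =>
    (congrArg L ((h k).2 x hx)).trans L.map_zero⟩

theorem IsSmooth.prodMk {u : Reps H M ι W} {v : Reps H M ι W'} (h : Z.IsSmooth u)
    (h' : Z.IsSmooth v) : Z.IsSmooth fun k x => (u k x, v k x) := fun k =>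
  ⟨(h k).1.prodMk (h' k).1, fun x hx => Prod.ext ((h k).2 x hx) ((h' k).2 x hx)⟩

theorem isSmooth_zero : Z.IsSmooth fun _ _ => (0 : W) := fun _ =>
  ⟨contDiffOn_const, fun _ _ => rfl⟩

theorem IsSmooth.wedge [FiniteDimensional ℝ W₁] [FiniteDimensional ℝ W₂]
    {σ : Reps H M ι (E4 [⋀^Fin p]→L[ℝ] W₁)} {γ : Reps H M ι (E4 [⋀^Fin q]→L[ℝ] W₂)}
    (h : Z.IsSmooth σ) (h' : Z.IsSmooth γ) (b : W₁ →L[ℝ] W₂ →L[ℝ] W₃) :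
    Z.IsSmooth fun k x => wedge b (σ k x) (γ k x) := fun k =>
  ⟨((smoothFamily_const (h k).1).wedge (smoothFamily_const (h' k).1) b).contDiffOn 0, fun x hx => by
    simp only [(h k).2 x hx, wedge_zero_left]⟩

theorem IsSmooth.join {a : Reps H M ι (E4 [⋀^Fin p]→L[ℝ] so31)}
    {e : Reps H M ι (E4 [⋀^Fin p]→L[ℝ] Mink)} {S : Reps H M ι (E4 [⋀^Fin p]→L[ℝ] so31Dual)}
    (ha : Z.IsSmooth a) (he : Z.IsSmooth e) (hS : Z.IsSmooth S) :
    Z.IsSmooth fun k x => (a k x).prod ((e k x).prod (S k x)) := by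
  simp only [← joinL_apply]
  exact IsSmooth.clm (W' := E4 [⋀^Fin p]→L[ℝ] dAlg) (ha.prodMk (he.prodMk hS)) (joinL p)

variable {T : so31 →ₗ[ℝ] so31} {β : ℝ}

/-- Variations of the forms `c` and `B` alone. -/
theorem aux_mem_variations {c : Reps H M ι (E4 [⋀^Fin 2]→L[ℝ] so31)}
    {B : Reps H M ι (E4 [⋀^Fin 2]→L[ℝ] so31Dual)} (hc : Z.IsSmooth c) (hc' : Z.IsFormG c)
    (hB : Z.IsSmooth B) (hB' : Z.IsFormGDual B) :
    (fun k x => ((0 : E4 [⋀^Fin 1]→L[ℝ] dAlg),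
      (c k x).prod ((0 : E4 [⋀^Fin 2]→L[ℝ] Mink).prod (B k x)))) ∈ (qeGR Z T β).variations :=
  ⟨isSmooth_zero.prodMk (hc.join isSmooth_zero hB),
    ⟨isFormG_zero, isFormV_zero, isFormGDual_zero⟩, hc', isFormV_zero, hB'⟩

theorem compG_prod (a : E4 [⋀^Fin p]→L[ℝ] so31) (b : E4 [⋀^Fin p]→L[ℝ] (Mink × so31Dual)) :
    compG (a.prod b) = a := rfl

theorem compV_prod (a : E4 [⋀^Fin p]→L[ℝ] so31) (e : E4 [⋀^Fin p]→L[ℝ] Mink)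
    (S : E4 [⋀^Fin p]→L[ℝ] so31Dual) : compV (a.prod (e.prod S)) = e := rfl

theorem compGDual_prod (a : E4 [⋀^Fin p]→L[ℝ] so31) (e : E4 [⋀^Fin p]→L[ℝ] Mink)
    (S : E4 [⋀^Fin p]→L[ℝ] so31Dual) : compGDual (a.prod (e.prod S)) = S := rfl

theorem qeGR_lagrangian (u χ : Reps H M ι FibQeGR) (t : ℝ) (k : Patch H M ι) (x : E4) :
    (qeGR Z T β).lagrangian (u + t • χ) k x =
      lagQeGR T β (Z.dom k) (fun y => u k y + t • χ k y) x := by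
  simp only [qeGR, lagQeGR, Pi.add_apply, Pi.smul_apply]

/-- The field equations of `c` and `B`, in weak form. -/
theorem integral_resid_eq_zero [T2Space M] [IsManifold I ∞ M] (hT : AdEquivariant T)
    (h : IsUnit (deform T β))
    {u : Reps H M ι FibQeGR} (hu : u ∈ (qeGR Z T β).criticalLocus)
    {c : Reps H M ι (E4 [⋀^Fin 2]→L[ℝ] so31)}
    {B : Reps H M ι (E4 [⋀^Fin 2]→L[ℝ] so31Dual)} (hc : Z.IsSmooth c) (hc' : Z.IsFormG c)
    (hB : Z.IsSmooth B) (hB' : Z.IsFormGDual B) {k : Patch H M ι} {K : Set E4} (hK : IsCompact K)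
    (hKs : K ⊆ interior (Z.dom k)) (hcK : Z.SupportedIn k K c) (hBK : Z.SupportedIn k K B) :
    ∫ x in Z.dom k, ((wedge pairG (mapVal (deformL T β) (c k x)) (residB T β (Z.dom k) (u k) x) +
      wedge pairG (mapVal (deformL T β) (residC T β (Z.dom k) (u k) x)) (B k x) :
        E4 [⋀^Fin 4]→L[ℝ] ℝ)) frame = 0 := by
  have hχ := aux_mem_variations (T := T) (β := β) hc hc' hB hB'
  refine FieldTheory.integral_eq_zero_of_hasDerivAt hu hχ hK hKs (fun k' y hy hyK => ?_)
    one_ne_zero fun x hx => ?_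
  · simp only [hcK k' y hy hyK, hBK k' y hy hyK]
    rfl
  · have := hasDerivAt_lagQeGR hT h (Z.isCalcDomain_dom k) (hu.1.1 k).1 (hχ.1 k).1
      (fun _ _ => rfl) (fun _ _ => compV_prod _ _ _) hx
    simp only [compG_prod, compGDual_prod] at this
    simp only [qeGR_lagrangian, one_smul]
    exact this

theorem wedge_smul_smul {W₁ W₂ W₃ : Type*} [NormedAddCommGroup W₁] [NormedSpace ℝ W₁]
    [NormedAddCommGroup W₂] [NormedSpace ℝ W₂] [NormedAddCommGroup W₃] [NormedSpace ℝ W₃]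
    [FiniteDimensional ℝ W₁] [FiniteDimensional ℝ W₂] (b : W₁ →L[ℝ] W₂ →L[ℝ] W₃) {p q : ℕ}
    (a a' : ℝ) (α : E4 [⋀^Fin p]→L[ℝ] W₁) (γ : E4 [⋀^Fin q]→L[ℝ] W₂) :
    wedge b (a • α) (a' • γ) = (a * a') • wedge b α γ := by
  rw [show wedge b (a • α) (a' • γ) = wedgeL b p q (a • α) (a' • γ) from rfl, map_smul, map_smul,
    smul_apply, smul_smul, mul_comm a']
  rfl

theorem eqOn_zero_of_forall_integral_mul_eq_zero {s : Set E4} (hs : IsCalcDomain s) {f : E4 → ℝ}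
    (hf : ContinuousOn f s)
    (h : ∀ φ φ' : E4 → ℝ, ContDiff ℝ ∞ φ → HasCompactSupport φ → tsupport φ ⊆ interior s →
      ContDiff ℝ ∞ φ' → HasCompactSupport φ' → tsupport φ' ⊆ interior s →
      ∫ x in s, φ x * φ' x * f x = 0) : ∀ x ∈ s, f x = 0 := by
  refine eqOn_zero_of_forall_integral_eq_zero hs hf fun φ' h1' h2' h3' => ?_
  have h0 := eqOn_zero_of_forall_integral_eq_zero hs
    (f := fun x => φ' x * f x) (h1'.continuous.continuousOn.mul hf) fun φ h1 h2 h3 => by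
      simpa only [mul_assoc] using h φ φ' h1 h2 h3 h1' h2' h3'
  exact setIntegral_eq_zero_of_forall_eq_zero h0

section

variable [T2Space M] [IsManifold I ∞ M]

theorem continuousOn_form_frame {s : Set E4} {α : E4 → E4 [⋀^Fin 4]→L[ℝ] ℝ}
    (h : ContDiffOn ℝ ∞ α s) : ContinuousOn (fun x => α x frame) s :=
  (ContinuousAlternatingMap.apply ℝ E4 ℝ frame).continuous.comp_continuousOn h.continuousOn

/-- Products of two bump functions suffice to localise the weak field equations of a two-form. -/
theorem wedge_eq_zero_of_forall_bumpSection [FiniteDimensional ℝ W₁] [FiniteDimensional ℝ W₂]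
    {k : Patch H M ι} (b : W₁ →L[ℝ] W₂ →L[ℝ] ℝ) (m : Mink →L[ℝ] Mink →L[ℝ] W₂)
    {R : E4 → E4 [⋀^Fin 2]→L[ℝ] W₁} (hR : ContDiffOn ℝ ∞ R (Z.dom k))
    (h : ∀ (K : Set E4) (σ σ' : Reps H M ι (E4 [⋀^Fin 1]→L[ℝ] Mink)), IsCompact K →
      K ⊆ interior (Z.dom k) → Z.SupportedIn k K σ → Z.IsSmooth σ → Z.IsFormV σ →
      Z.IsSmooth σ' → Z.IsFormV σ' → ∫ x in Z.dom k, (wedge b (R x)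
        (wedge m (σ k x) (σ' k x) : E4 [⋀^Fin 2]→L[ℝ] W₂) : E4 [⋀^Fin 4]→L[ℝ] ℝ) frame = 0)
    {x : E4} (hx : x ∈ Z.dom k) (α γ : E4 [⋀^Fin 1]→L[ℝ] Mink) :
    (wedge b (R x) (wedge m α γ : E4 [⋀^Fin 2]→L[ℝ] W₂) : E4 [⋀^Fin 4]→L[ℝ] ℝ) frame = 0 := by
  refine eqOn_zero_of_forall_integral_mul_eq_zero (Z.isCalcDomain_dom k)
    (f := fun x => (wedge b (R x) (wedge m α γ : E4 [⋀^Fin 2]→L[ℝ] W₂) :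
      E4 [⋀^Fin 4]→L[ℝ] ℝ) frame)
    (continuousOn_form_frame (((smoothFamily_const hR).wedge
      (smoothFamily_const contDiffOn_const) b).contDiffOn 0))
    (fun φ φ' h1 h2 h3 h1' h2' h3' => ?_) x hx
  rw [← h _ (Z.bumpSection k φ α) (Z.bumpSection k φ' γ) h2 h3
    (supportedIn_bumpSection Z subset_rfl)
    (isSmooth_bumpSection Z h1 h2 (h3.trans interior_subset)) (isFormV_bumpSection Z)
    (isSmooth_bumpSection Z h1' h2' (h3'.trans interior_subset)) (isFormV_bumpSection Z)]
  refine setIntegral_congr_fun (Z.measurableSet_dom k) fun y hy => ?_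
  have e := wedge_smul_smul b 1 (φ y * φ' y) (R y) (wedge m α γ : E4 [⋀^Fin 2]→L[ℝ] W₂)
  rw [one_smul, one_mul, ← wedge_smul_smul] at e
  simp only [bumpSection_self Z hy]
  exact (congrArg (fun α : E4 [⋀^Fin 4]→L[ℝ] ℝ => α frame) e).symm

theorem residC_eq_zero (hT : AdEquivariant T) (h : IsUnit (deform T β))
    {u : Reps H M ι FibQeGR} (hu : u ∈ (qeGR Z T β).criticalLocus) {k : Patch H M ι} {x : E4}
    (hx : x ∈ Z.dom k) : residC T β (Z.dom k) (u k) x = 0 := by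
  have hr := ((smoothFamily_const (hu.1.1 k).1).residC (T := T) (β := β)
    (Z.isCalcDomain_dom k)).mapVal (deformL T β)
  refine residC_eq_zero_of_forall h fun i j w w' => wedge_eq_zero_of_forall_bumpSection pairG wedgeV
    (hr.contDiffOn 0) (fun K b b' hK hKs hbK hb hb1 hb' hb1' => ?_) hx _ _
  rw [← integral_resid_eq_zero hT h hu isSmooth_zero isFormG_zero (hb.wedge hb' wedgeV)
    (hb1.wedgeV hb1') hK hKs (fun _ _ _ _ => rfl) fun k' y hy hyK => by
      simp only [hbK k' y hy hyK, wedge_zero_left]]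
  refine setIntegral_congr_fun (Z.measurableSet_dom k) fun y hy => ?_
  simp only [mapVal_zero, wedge_zero_left, zero_add]

theorem residB_eq_zero (hT : AdEquivariant T) (h : IsUnit (deform T β))
    {u : Reps H M ι FibQeGR} (hu : u ∈ (qeGR Z T β).criticalLocus) {k : Patch H M ι} {x : E4}
    (hx : x ∈ Z.dom k) : residB T β (Z.dom k) (u k) x = 0 := by
  have hr := (smoothFamily_const (hu.1.1 k).1).residB (T := T) (β := β) (Z.isCalcDomain_dom k)
  refine residB_eq_zero_of_forall h fun i j w w' => wedge_eq_zero_of_forall_bumpSection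
    (pairDeform T β) wedgeG
    (hr.contDiffOn 0) (fun K b b' hK hKs hbK hb hb1 hb' hb1' => ?_) hx _ _
  rw [← integral_resid_eq_zero hT h hu (hb.wedge hb' wedgeG) (hb1.wedgeG hb1') isSmooth_zero
    isFormGDual_zero hK hKs (fun k' y hy hyK => by
      simp only [hbK k' y hy hyK, wedge_zero_left]) fun _ _ _ _ => rfl]
  refine setIntegral_congr_fun (Z.measurableSet_dom k) fun y hy => ?_
  simp only [wedge_pairDeform, wedge_zero_right, add_zero]

end

end MinkowskiBundle

/-! ### Reduction of quadratically extended General Relativity -/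

section Local

variable {s : Set E4} {x : E4} {T : so31 →ₗ[ℝ] so31} {β : ℝ}

theorem SmoothFamily.differentiableAt {W : Type*} [NormedAddCommGroup W] [NormedSpace ℝ W]
    {γ : ℝ → E4 → W} (h : SmoothFamily s γ) (hx : x ∈ s) (t : ℝ) :
    DifferentiableAt ℝ (fun t => γ t x) t := by
  have h1 : ContDiffOn ℝ ∞ (fun t => γ t x) univ :=
    h.comp (contDiff_prodMk_left x).contDiffOn fun t _ => ⟨mem_univ t, hx⟩
  exact ((contDiffOn_univ.1 h1).differentiable (by simp)) t

set_option maxRecDepth 10000 in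
theorem SmoothFamily.lagQgH (hs : IsCalcDomain s) {v : ℝ → E4 → FibQgH} (hv : SmoothFamily s v) :
    SmoothFamily s fun t => lagQgH T β s (v t) := by
  have he : SmoothFamily s fun t x => (v t x).1 :=
    SmoothFamily.clm (W' := E4 [⋀^Fin 1]→L[ℝ] Mink) hv coframeL
  have hA : SmoothFamily s fun t x => (v t x).2.1 :=
    SmoothFamily.clm (W' := E4 [⋀^Fin 1]→L[ℝ] so31) hv gaugeL
  have ht : SmoothFamily s fun t x => (v t x).2.2 :=
    SmoothFamily.clm (W' := E4 [⋀^Fin 2]→L[ℝ] Mink) hv torsionL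
  have h1 := (hA.curvature (b := bracketG) hs).mapVal (deformInv T β)
  have h2 := (h1.wedge (he.wedge he wedgeV) pairG).const_smul (1 / 2)
  have h3 := ht.wedge (hA.covDeriv hs (b := so31.toEnd) he) eta
  have h4 := (ht.wedge ht eta).const_smul ((1 + β) / 2)
  exact (h2.sub h3).sub h4

theorem liftField_congr {σ : E4 → E4 [⋀^Fin 1]→L[ℝ] so31Dual} {w w' : E4 → FibQgH}
    {U U' : E4 → FibQeGR} (hw : EqOn w w' s) (hU : EqOn U U' s) (hx : x ∈ s) :
    liftField T β s σ w U x = liftField T β s σ w' U' x := by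
  have hA : EqOn (fun y => compG (U y).1) (fun y => compG (U' y).1) s := fun y hy => by
    simp only [hU hy]
  rw [liftField, liftField, covDeriv_congr bracketG hA (σ' := fun y => (w' y).2.1)
    (fun y hy => by simp only [hw hy]) hx, covDeriv_congr coad hA (eqOn_refl σ s) hx, hU hx, hw hx]

end Local

namespace MinkowskiBundle

variable {H : Type*} [TopologicalSpace H] {I : ModelWithCorners ℝ E4 H}
  {M : Type*} [TopologicalSpace M] [ChartedSpace H M] {ι : Type*}
  {Z : MinkowskiBundle I M ι} {p : ℕ} {T : so31 →ₗ[ℝ] so31} {β : ℝ}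

theorem IsFormG.neg {σ : Reps H M ι (E4 [⋀^Fin p]→L[ℝ] so31)} (h : Z.IsFormG σ) :
    Z.IsFormG fun k x => -σ k x :=
  (h.smul (-1)).congr fun _ _ _ => ContinuousAlternatingMap.ext fun _ => (neg_one_smul ℝ _).symm

theorem IsFormGDual.neg {σ : Reps H M ι (E4 [⋀^Fin p]→L[ℝ] so31Dual)} (h : Z.IsFormGDual σ) :
    Z.IsFormGDual fun k x => -σ k x :=
  (h.smul (-1)).congr fun _ _ _ => ContinuousAlternatingMap.ext fun _ => (neg_one_smul ℝ _).symm

theorem IsFormD.of_eqOn {α : Reps H M ι (E4 [⋀^Fin p]→L[ℝ] dAlg)}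
    {a : Reps H M ι (E4 [⋀^Fin p]→L[ℝ] so31)} {e : Reps H M ι (E4 [⋀^Fin p]→L[ℝ] Mink)}
    {S : Reps H M ι (E4 [⋀^Fin p]→L[ℝ] so31Dual)} (ha : Z.IsFormG a) (he : Z.IsFormV e)
    (hS : Z.IsFormGDual S)
    (h : ∀ k, ∀ x ∈ Z.dom k, α k x = (a k x).prod ((e k x).prod (S k x))) : Z.IsFormD α :=
  ⟨ha.congr fun k x hx => by simp only [h k x hx, compG_prod],
    he.congr fun k x hx => by simp only [h k x hx, compV_prod],
    hS.congr fun k x hx => by simp only [h k x hx, compGDual_prod]⟩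

theorem IsConnectionD.of_eqOn {α : Reps H M ι (E4 [⋀^Fin 1]→L[ℝ] dAlg)}
    {a : Reps H M ι (E4 [⋀^Fin 1]→L[ℝ] so31)} {e : Reps H M ι (E4 [⋀^Fin 1]→L[ℝ] Mink)}
    {S : Reps H M ι (E4 [⋀^Fin 1]→L[ℝ] so31Dual)} (ha : Z.IsConnection a) (he : Z.IsFormV e)
    (hS : Z.IsFormGDual S)
    (h : ∀ k, ∀ x ∈ Z.dom k, α k x = (a k x).prod ((e k x).prod (S k x))) : Z.IsConnectionD α :=
  ⟨ha.congr fun k x hx => by simp only [h k x hx, compG_prod],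
    he.congr fun k x hx => by simp only [h k x hx, compV_prod],
    hS.congr fun k x hx => by simp only [h k x hx, compGDual_prod]⟩

variable (Z T β) in
/-- The extension of `graphField` to global fields. -/
noncomputable def graphQeGR (S : Reps H M ι (E4 [⋀^Fin 1]→L[ℝ] so31Dual))
    (v : Reps H M ι FibQgH) : Reps H M ι FibQeGR := fun k =>
  (Z.dom k).indicator (graphField T β (Z.dom k) (S k) (v k))

variable (Z T β) in
/-- The extension of `liftField` to global fields. -/
noncomputable def liftQeGR (S : Reps H M ι (E4 [⋀^Fin 1]→L[ℝ] so31Dual))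
    (V : Reps H M ι FibQgH → Reps H M ι FibQgH) (u : Reps H M ι FibQeGR) : Reps H M ι FibQeGR :=
  fun k => (Z.dom k).indicator
    (liftField T β (Z.dom k) (S k) (V (fun k x => projL (u k x)) k) (u k))

variable {S : Reps H M ι (E4 [⋀^Fin 1]→L[ℝ] so31Dual)} {v : Reps H M ι FibQgH}
  {u : Reps H M ι FibQeGR} {V : Reps H M ι FibQgH → Reps H M ι FibQgH}

theorem proj_mem_fields (hu : u ∈ (qeGR Z T β).fields) :
    (fun k x => projL (u k x)) ∈ (qgH Z T β).fields :=
  ⟨hu.1.clm projL, hu.2.1.2.1, hu.2.1.1, hu.2.2.2.1⟩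

theorem proj_mem_variations (hu : u ∈ (qeGR Z T β).variations) :
    (fun k x => projL (u k x)) ∈ (qgH Z T β).variations :=
  ⟨hu.1.clm projL, hu.2.1.2.1, hu.2.1.1, hu.2.2.2.1⟩

theorem sec_mem_variations (hv : v ∈ (qgH Z T β).variations) :
    (fun k x => secL (v k x)) ∈ (qeGR Z T β).variations :=
  ⟨IsSmooth.clm (W' := FibQeGR) hv.1 secL,
    IsFormD.of_eqOn hv.2.2.1 hv.2.1 isFormGDual_zero fun k x _ => by
      simp only [secL_apply],
    IsFormD.of_eqOn isFormG_zero hv.2.2.2 isFormGDual_zero fun k x _ => by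
      simp only [secL_apply]⟩

theorem graphQeGR_mem_fields [IsManifold I ∞ M] (hT : AdEquivariant T)
    (h : IsUnit (deform T β)) (hS : Z.IsSmooth S)
    (hS' : Z.IsFormGDual S) (hv : v ∈ (qgH Z T β).fields) :
    graphQeGR Z T β S v ∈ (qeGR Z T β).fields := by
  have hA : Z.IsSmooth fun k x => (v k x).2.1 :=
    IsSmooth.clm (W' := E4 [⋀^Fin 1]→L[ℝ] so31) hv.1 gaugeL
  have hc := (hv.2.2.1.curvature fun k => (hA k).1).mapVal (hT.deformInv h)
  have hB := ((hv.2.2.1.covDeriv_coad (fun k => (hS k).1) hS').add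
    ((hv.2.1.wedgeV hv.2.1).smul (1 / 2))).mapVal hT h
  refine ⟨isSmooth_indicator fun k => (smoothFamily_graphField (Z.isCalcDomain_dom k)
    (smoothFamily_const (hS k).1) (smoothFamily_const (hv.1 k).1)).contDiffOn 0,
    IsConnectionD.of_eqOn hv.2.2.1 hv.2.1 hS' fun k x hx => ?_,
    IsFormD.of_eqOn hc.neg hv.2.2.2 hB.neg fun k x hx => ?_⟩
  · simp only [graphQeGR, indicator_of_mem hx, graphField]
  · simp only [graphQeGR, indicator_of_mem hx, graphField]

theorem proj_graphQeGR (hv : v ∈ (qgH Z T β).fields) :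
    (fun k x => projL (graphQeGR Z T β S v k x)) = v := by
  funext k x
  by_cases hx : x ∈ Z.dom k
  · rw [graphQeGR, indicator_of_mem hx, graphField, projL_apply, compV_prod, compG_prod, compV_prod]
  · rw [graphQeGR, indicator_of_notMem hx, map_zero, (hv.1 k).2 x hx]

theorem graphQeGR_local (hS : Z.IsSmooth S) :
    Z.IsLocal (qgH Z T β).fields (graphQeGR Z T β S) := fun k =>
  LocalOn.congr (localOn_graphField (Z.isCalcDomain_dom k).uniqueDiffOn (fun _ hv => (hv.1 k).1)
    (localOn_fixed (hS k).1) localOn_self) fun _ _ _ hx => indicator_of_mem hx _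

theorem exists_graphQeGR [T2Space M] [IsManifold I ∞ M] (hT : AdEquivariant T)
    (h : IsUnit (deform T β)) (hu : u ∈ (qeGR Z T β).criticalLocus) :
    ∃ S ∈ {S | Z.IsSmooth S ∧ Z.IsFormGDual S},
      u = graphQeGR Z T β S fun k x => projL (u k x) := by
  refine ⟨fun k x => compGDual (u k x).1,
    ⟨IsSmooth.clm (W' := E4 [⋀^Fin 1]→L[ℝ] so31Dual) hu.1.1 connGDualL, hu.1.2.1.2.2⟩, ?_⟩
  funext k x
  by_cases hx : x ∈ Z.dom k
  · rw [graphQeGR, indicator_of_mem hx]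
    exact eq_graphField (residC_eq_zero hT h hu hx) (residB_eq_zero hT h hu hx)
  · rw [graphQeGR, indicator_of_notMem hx, (hu.1.1 k).2 x hx]

end MinkowskiBundle

/-! ### Lifts of variations -/

namespace MinkowskiBundle

variable {H : Type*} [TopologicalSpace H] {I : ModelWithCorners ℝ E4 H}
  {M : Type*} [TopologicalSpace M] [ChartedSpace H M] {ι : Type*}
  {Z : MinkowskiBundle I M ι} {p : ℕ} {T : so31 →ₗ[ℝ] so31} {β : ℝ}
  {S : Reps H M ι (E4 [⋀^Fin 1]→L[ℝ] so31Dual)} {v : Reps H M ι FibQgH}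
  {u χ : Reps H M ι FibQeGR} {V : Reps H M ι FibQgH → Reps H M ι FibQgH}

theorem isLocal_clm {W W' : Type*} [NormedAddCommGroup W] [NormedSpace ℝ W]
    [NormedAddCommGroup W'] [NormedSpace ℝ W'] (F : Set (Reps H M ι W)) (L : W →L[ℝ] W') :
    Z.IsLocal F fun u k x => L (u k x) := fun _ => localOn_self.clm L

theorem contDiffOn_liftField {s : Set E4} (hs : UniqueDiffOn ℝ s)
    {σ : E4 → E4 [⋀^Fin 1]→L[ℝ] so31Dual} {w : E4 → FibQgH} {U : E4 → FibQeGR}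
    (hσ : ContDiffOn ℝ ∞ σ s) (hw : ContDiffOn ℝ ∞ w s) (hU : ContDiffOn ℝ ∞ U s) :
    ContDiffOn ℝ ∞ (liftField T β s σ w U) s := by
  have h0 := localOn_liftField (T := T) (β := β) (F := (univ : Set Unit)) (r := fun _ _ => (0 : ℝ))
    hs
    (fun _ _ => contDiffOn_const) (localOn_fixed hσ) (localOn_fixed hw) (localOn_fixed hU)
  exact h0.contDiffOn hs (mem_univ ()) contDiffOn_const

theorem liftQeGR_mem_variations [IsManifold I ∞ M] (hT : AdEquivariant T)
    (h : IsUnit (deform T β)) (hS : Z.IsSmooth S)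
    (hS' : Z.IsFormGDual S) (hV : ∀ v ∈ (qgH Z T β).fields, V v ∈ (qgH Z T β).variations)
    (hu : u ∈ (qeGR Z T β).fields) : liftQeGR Z T β S V u ∈ (qeGR Z T β).variations := by
  have hw := hV _ (proj_mem_fields hu)
  set w := V fun k x => projL (u k x) with hwdef
  have ha : Z.IsSmooth fun k x => (w k x).2.1 :=
    IsSmooth.clm (W' := E4 [⋀^Fin 1]→L[ℝ] so31) hw.1 gaugeL
  have hc := (hu.2.1.1.covDeriv_bracketG (fun k => (ha k).1) hw.2.2.1).mapVal (hT.deformInv h)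
  have hB := (((hu.2.1.1.covDeriv_coad (fun k => (hS k).1) hS').add
    (hw.2.2.1.wedge_coad hu.2.1.2.2)).add
    (((hw.2.1.wedgeV hu.2.1.2.1).add (hu.2.1.2.1.wedgeV hw.2.1)).smul (1 / 2))).mapVal hT h
  refine ⟨isSmooth_indicator fun k => contDiffOn_liftField (Z.isCalcDomain_dom k).uniqueDiffOn
    (hS k).1 (hw.1 k).1 (hu.1 k).1,
    IsFormD.of_eqOn hw.2.2.1 hw.2.1 hS' fun k x hx => ?_,
    IsFormD.of_eqOn hc.neg hw.2.2.2 hB.neg fun k x hx => ?_⟩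
  · simp only [liftQeGR, indicator_of_mem hx, liftField, ← hwdef]
  · simp only [liftQeGR, indicator_of_mem hx, liftField, ← hwdef]

theorem liftQeGR_local (hS : Z.IsSmooth S)
    (hV' : Z.IsLocal (qgH Z T β).fields V) :
    Z.IsLocal (qeGR Z T β).fields (liftQeGR Z T β S V) := fun k => by
  have hp : Z.IsLocal (qeGR Z T β).fields fun u k x => projL (u k x) :=
    isLocal_clm (W := FibQeGR) (W' := FibQgH) _ projL
  have hV1 := (hp.comp (fun u hu => hu.1) (fun u hu => proj_mem_fields hu) hV').localOn k
  exact LocalOn.congr (localOn_liftField (Z.isCalcDomain_dom k).uniqueDiffOn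
    (fun _ hu => (hu.1 k).1) (localOn_fixed (hS k).1) hV1 localOn_self)
    fun _ _ _ hx => indicator_of_mem hx _

theorem proj_liftQeGR (hV : ∀ v ∈ (qgH Z T β).fields, V v ∈ (qgH Z T β).variations)
    (hu : u ∈ (qeGR Z T β).fields) :
    (fun k x => projL (liftQeGR Z T β S V u k x)) = V fun k x => projL (u k x) := by
  have hw := hV _ (proj_mem_fields hu)
  funext k x
  by_cases hx : x ∈ Z.dom k
  · rw [liftQeGR, indicator_of_mem hx, liftField, projL_apply, compV_prod, compG_prod, compV_prod]
  · rw [liftQeGR, indicator_of_notMem hx, map_zero, (hw.1 k).2 x hx]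

variable (T β) in
/-- The variation `χ` of `u` does not change, to first order, the part of the Lagrangian that is
quadratic in the field equations of `c` and `B`. -/
def ReducibleQeGR (u χ : Reps H M ι FibQeGR) : Prop := ∀ k, ∀ x ∈ Z.dom k,
  HasDerivAt (fun t : ℝ => residPair T β (Z.dom k) (fun y => u k y + t • χ k y) x) 0 0

set_option maxRecDepth 10000 in
theorem reducible_graphQeGR (hS : Z.IsSmooth S) (hv : v ∈ (qgH Z T β).fields)
    (hχ : χ ∈ (qeGR Z T β).variations) :
    ReducibleQeGR (Z := Z) T β (graphQeGR Z T β S v) χ := fun k x hx => by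
  have hs := Z.isCalcDomain_dom k
  have hg : EqOn (graphQeGR Z T β S v k) (graphField T β (Z.dom k) (S k) (v k)) (Z.dom k) :=
    fun y hy => indicator_of_mem hy _
  have hU : ContDiffOn ℝ ∞ (graphQeGR Z T β S v k) (Z.dom k) :=
    ((smoothFamily_graphField hs (smoothFamily_const (hS k).1)
      (smoothFamily_const (hv.1 k).1)).contDiffOn 0).congr hg
  have h1 := hasDerivAt_residPair (T := T) (β := β) hs (smoothFamily_line hU (hχ.1 k).1)
    (hasVelocity_line _ _) hx (line_zero _ _) rfl rfl
  rwa [residC_congr hg hx, residB_congr hg hx, residC_graphField, residB_graphField, mapVal_zero,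
    wedge_zero_left, wedge_zero_right, add_zero] at h1

set_option maxRecDepth 10000 in
theorem reducible_liftQeGR (hS : Z.IsSmooth S)
    (hV : ∀ v ∈ (qgH Z T β).fields, V v ∈ (qgH Z T β).variations)
    (hu : u ∈ (qeGR Z T β).fields) :
    ReducibleQeGR (Z := Z) T β u (liftQeGR Z T β S V u) := fun k x hx => by
  have hs := Z.isCalcDomain_dom k
  have hw := hV _ (proj_mem_fields hu)
  have hX := contDiffOn_liftField (T := T) (β := β) hs.uniqueDiffOn (hS k).1 (hw.1 k).1 (hu.1 k).1
  have h1 := hasDerivAt_residPair (T := T) (β := β) hs (smoothFamily_line (hu.1 k).1 hX)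
    (hasVelocity_line _ _) hx (line_zero _ _) (c := 0) (b := 0) (neg_add_cancel _)
    (neg_add_cancel (mapVal (deformInvDual T β)
      (covDeriv coad (Z.dom k) (fun y => compG (u k y).1) (S k) x +
        wedge coad (V (fun k x => projL (u k x)) k x).2.1 (compGDual (u k x).1) +
          (1 / 2 : ℝ) • (wedge wedgeV (V (fun k x => projL (u k x)) k x).1 (compV (u k x).1) +
            wedge wedgeV (compV (u k x).1) (V (fun k x => projL (u k x)) k x).1))))
  rw [mapVal_zero, wedge_zero_left, wedge_zero_right, add_zero] at h1
  refine h1.congr_of_eventuallyEq (Eventually.of_forall fun t =>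
    residPair_congr (fun y hy => ?_) hx)
  simp only [liftQeGR, indicator_of_mem hy]

end MinkowskiBundle

/-! ### Quadratically extended General Relativity as an extension of quadratic Holst theory -/

section

variable {W : Type*} [NormedAddCommGroup W] [NormedSpace ℝ W] {s : Set E4} {t : ℝ}

theorem smoothFamily_smul {f : E4 → W} (hf : ContDiffOn ℝ ∞ f s) :
    SmoothFamily s fun t x => t • f x :=
  contDiff_fst.contDiffOn.smul (smoothFamily_const hf)

theorem hasVelocity_smul (f : E4 → W) : HasVelocity s (fun t x => t • f x) f t := fun x _ => by
  simpa using (hasDerivAt_id t).smul_const (f x)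

end

namespace MinkowskiBundle

variable {H : Type*} [TopologicalSpace H] {I : ModelWithCorners ℝ E4 H}
  {M : Type*} [TopologicalSpace M] [ChartedSpace H M] {ι : Type*}
  {Z : MinkowskiBundle I M ι} {p : ℕ} {T : so31 →ₗ[ℝ] so31} {β : ℝ}
  {S : Reps H M ι (E4 [⋀^Fin 1]→L[ℝ] so31Dual)} {v : Reps H M ι FibQgH}
  {u χ : Reps H M ι FibQeGR} {V : Reps H M ι FibQgH → Reps H M ι FibQgH}

theorem isForm_bdryField [IsManifold I ∞ M] (hT : AdEquivariant T) (h : IsUnit (deform T β))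
    (hu : u ∈ (qeGR Z T β).fields) (hχ : χ ∈ (qeGR Z T β).variations) :
    Z.IsForm fun k => bdryOn T β (Z.dom k) (u k) (χ k) := by
  have hA : Z.IsSmooth fun k x => compG (u k x).1 :=
    IsSmooth.clm (W' := E4 [⋀^Fin 1]→L[ℝ] so31) hu.1 connGL
  have ha : Z.IsSmooth fun k x => compG (χ k x).1 :=
    IsSmooth.clm (W' := E4 [⋀^Fin 1]→L[ℝ] so31) hχ.1 connGL
  have h1 := (hu.2.1.1.covDeriv_bracketG (fun k => (ha k).1) hχ.2.1.1).mapVal (hT.deformInv h)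
  have h2 := (hu.2.1.1.curvature fun k => (hA k).1).mapVal (hT.deformInv h)
  exact (h1.wedge_pairG hu.2.1.2.2).add (h2.wedge_pairG hχ.2.1.2.2)

theorem hasDerivAt_qgH_iff (hT : AdEquivariant T) (h : IsUnit (deform T β))
    (hu : u ∈ (qeGR Z T β).fields) (hχ : χ ∈ (qeGR Z T β).variations)
    (hr : ReducibleQeGR (Z := Z) T β u χ) {k : Patch H M ι} {x : E4} (hx : x ∈ Z.dom k)
    (D : E4 [⋀^Fin 4]→L[ℝ] ℝ) {L L' : ℝ → E4 [⋀^Fin 4]→L[ℝ] ℝ}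
    (hL' : ∀ t, L' t = lagQgH T β (Z.dom k) (fun y => projL (u k y) + t • projL (χ k y)) x)
    (hL : ∀ t, L t = lagQeGR T β (Z.dom k) (fun y => u k y + t • χ k y) x) :
    HasDerivAt L' D 0 ↔ HasDerivAt L
      ((-1 : ℝ) • D - extDerivWithin (bdryOn T β (Z.dom k) (u k) (χ k)) (Z.dom k) x) 0 := by
  have h1 := hasDerivAt_lagQgH_iff hT h (Z.isCalcDomain_dom k) (hu.1 k).1 (hχ.1 k).1 hx
    (hr k x hx) D
  have e2 : ∀ a b : E4 [⋀^Fin 4]→L[ℝ] ℝ, 0 - b - a = (-1 : ℝ) • a - b := fun a b => by module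
  rw [funext hL', funext hL]
  simp only [← map_smul, ← map_add]
  rw [h1]
  exact iff_of_eq (congrArg (fun w => HasDerivAt _ w 0) (e2 _ _))

theorem differentiable_qgH {χ : Reps H M ι FibQgH} (hv : v ∈ (qgH Z T β).fields)
    (hχ : χ ∈ (qgH Z T β).variations) {k : Patch H M ι} {x : E4} (hx : x ∈ Z.dom k)
    {L : ℝ → E4 [⋀^Fin 4]→L[ℝ] ℝ}
    (hL : ∀ t, L t = lagQgH T β (Z.dom k) (fun y => v k y + t • χ k y) x) :
    DifferentiableAt ℝ L 0 := by
  rw [funext hL]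
  exact (SmoothFamily.lagQgH (Z.isCalcDomain_dom k)
    (smoothFamily_line (hv.1 k).1 (hχ.1 k).1)).differentiableAt hx 0

theorem bdryField_eq_zero {k : Patch H M ι} {K : Set E4} (hK : IsClosed K)
    (h : ∀ x ∈ Z.dom k, x ∉ K → χ k x = 0) {x : E4} (hx : x ∈ Z.dom k) (hxK : x ∉ K) :
    bdryOn T β (Z.dom k) (u k) (χ k) x = 0 := by
  refine bdryOn_eq_zero ?_ hx
  filter_upwards [self_mem_nhdsWithin, mem_nhdsWithin_of_mem_nhds (hK.isOpen_compl.mem_nhds hxK)]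
    with y hy hyK
  rw [h y hy hyK]
  rfl

theorem path_smooth_graphQeGR (hS : Z.IsSmooth S) {γ : ℝ → Reps H M ι FibQgH} {k : Patch H M ι}
    (hγ : SmoothFamily (Z.dom k) fun t => γ t k) :
    SmoothFamily (Z.dom k) fun t => graphQeGR Z T β (t • S) (γ t) k := by
  have hSt : SmoothFamily (Z.dom k) fun t : ℝ => (t • S) k :=
    smoothFamily_smul (hS k).1
  exact ContDiffOn.congr (smoothFamily_graphField (Z.isCalcDomain_dom k) hSt hγ)
    fun q hq => indicator_of_mem hq.2 _

theorem path_velocity_graphQeGR (hS : Z.IsSmooth S) {γ : ℝ → Reps H M ι FibQgH}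
    (hγf : ∀ t, γ t ∈ (qgH Z T β).fields) {k : Patch H M ι}
    (hγ : SmoothFamily (Z.dom k) fun t => γ t k) {s : ℝ}
    (hv : HasVelocity (Z.dom k) (fun t => γ t k) (V (γ s) k) s) :
    HasVelocity (Z.dom k) (fun t => graphQeGR Z T β (t • S) (γ t) k)
      (liftQeGR Z T β S V (graphQeGR Z T β (s • S) (γ s)) k) s := by
  have hSt : SmoothFamily (Z.dom k) fun t : ℝ => (t • S) k :=
    smoothFamily_smul (hS k).1
  have hSv : HasVelocity (Z.dom k) (fun t : ℝ => (t • S) k) (S k) s := hasVelocity_smul (S k)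
  have h1 := hasVelocity_graphField (T := T) (β := β) (Z.isCalcDomain_dom k) hSt hγ hSv hv
  refine (h1.congr fun x hx => ?_).congr_family fun t x hx => indicator_of_mem hx _
  rw [liftQeGR, indicator_of_mem hx, proj_graphQeGR (hγf s)]
  exact liftField_congr (eqOn_refl _ _) (fun y hy => (indicator_of_mem hy _).symm) hx

end MinkowskiBundle

namespace FieldTheory

open MinkowskiBundle

variable {H : Type*} [TopologicalSpace H] {I : ModelWithCorners ℝ E4 H}
  {M : Type*} [TopologicalSpace M] [ChartedSpace H M] {ι : Type*}
  {Z : MinkowskiBundle I M ι} {T : so31 →ₗ[ℝ] so31} {β : ℝ}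

set_option maxRecDepth 10000 in
/-- The elimination of `c`, `B` and `S`, where `S` remains as a free parameter of the solutions. -/
noncomputable def reductionQeGR [IsManifold I ∞ M] [T2Space M] (hT : AdEquivariant T)
    (h : IsUnit (deform T β)) :
    Reduction (qeGR Z T β) (qgH Z T β) (E4 [⋀^Fin 1]→L[ℝ] so31Dual) where
  proj := projL
  sec := secL
  params := {S | Z.IsSmooth S ∧ Z.IsFormGDual S}
  graph := graphQeGR Z T β
  lift := liftQeGR Z T β
  sign := -1
  bdry u χ k := bdryOn T β (Z.dom k) (u k) (χ k)
  Reducible := ReducibleQeGR T β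
  proj_sec v := by rw [secL_apply, projL_apply, compV_prod, compG_prod, compV_prod]
  sign_ne_zero := by norm_num
  isSmooth_fields _ hu := hu.1
  isSmooth_fields' _ hv := hv.1
  proj_fields _ := proj_mem_fields
  proj_variations _ := proj_mem_variations
  sec_variations _ := sec_mem_variations
  zero_variations := ⟨isSmooth_zero, isFormV_zero, isFormG_zero, isFormV_zero⟩
  zero_params := ⟨isSmooth_zero, isFormGDual_zero⟩
  smul_params t S hS := ⟨hS.1.clm (t • ContinuousLinearMap.id ℝ _), hS.2.smul t⟩
  graph_fields _ hS _ hv := graphQeGR_mem_fields hT h hS.1 hS.2 hv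
  proj_graph _ _ _ hv := proj_graphQeGR hv
  graph_local _ hS := graphQeGR_local hS.1
  exists_graph _ hu := exists_graphQeGR hT h hu
  reducible_graph _ hS _ hv _ hχ := reducible_graphQeGR hS.1 hv hχ
  variation _ hu _ hχ hr _ _ hx D :=
    hasDerivAt_qgH_iff hT h hu hχ hr hx D (fun t => by
      simp only [qgH, lagQgH, Pi.add_apply, Pi.smul_apply]) (fun t => by
      simp only [qeGR, lagQeGR, Pi.add_apply, Pi.smul_apply])
  differentiable _ hv _ hχ _ _ hx := differentiable_qgH hv hχ hx fun t => by
    simp only [qgH, lagQgH, Pi.add_apply, Pi.smul_apply]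
  bdry_isForm _ hu _ hχ := isForm_bdryField hT h hu hχ
  bdry_contDiffOn _ hu _ hχ k :=
    (localOn_bdryOn (F := (univ : Set Unit)) (r := fun _ _ => (0 : ℝ))
      (Z.isCalcDomain_dom k).uniqueDiffOn (fun _ _ => contDiffOn_const) (localOn_fixed (hu.1 k).1)
      (localOn_fixed (hχ.1 k).1)).contDiffOn (Z.isCalcDomain_dom k).uniqueDiffOn (mem_univ ())
        contDiffOn_const
  bdry_eq_zero _ _ _ _ _ _ hK h _ := bdryField_eq_zero hK h
  bdry_local _ _ hV k := localOn_bdryOn (Z.isCalcDomain_dom k).uniqueDiffOn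
    (fun _ hu => (hu.1 k).1) localOn_self (hV.localOn k)
  lift_variations _ hS _ hV _ hu := liftQeGR_mem_variations hT h hS.1 hS.2 hV hu
  lift_local _ hS _ _ hV' := liftQeGR_local hS.1 hV'
  proj_lift _ _ _ hV _ hu := proj_liftQeGR hV hu
  reducible_lift _ hS _ hV _ hu := reducible_liftQeGR hS.1 hV hu
  path_smooth _ hS _ _ hγ k := path_smooth_graphQeGR hS.1 (hγ k)
  path_velocity _ hS _ hγf hγ _ _ _ hv k := path_velocity_graphQeGR hS.1 hγf (hγ k) (hv k)

end FieldTheory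

/-! ### Reduction of quadratic generalised Holst theory -/

section Local

variable {s : Set E4} {x : E4} {t : ℝ} {T : so31 →ₗ[ℝ] so31} {β : ℝ}

/-- The projection `(e, A, τ) ↦ (e, A)` on the values of fields. -/
noncomputable def projHolstL : FibQgH →L[ℝ] FibGH := coframeL.prod gaugeL

theorem projHolstL_apply (v : FibQgH) : projHolstL v = (v.1, v.2.1) := rfl

/-- The inclusion `(e, A) ↦ (e, A, 0)` on the values of fields. -/
noncomputable def secHolstL : FibGH →L[ℝ] FibQgH :=
  (ContinuousLinearMap.fst ℝ (E4 [⋀^Fin 1]→L[ℝ] Mink) (E4 [⋀^Fin 1]→L[ℝ] so31)).prod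
    ((ContinuousLinearMap.snd ℝ (E4 [⋀^Fin 1]→L[ℝ] Mink) (E4 [⋀^Fin 1]→L[ℝ] so31)).prod 0)

/-- The component `e` of the fields `(e, A)`. -/
noncomputable def holstCoframeL : FibGH →L[ℝ] E4 [⋀^Fin 1]→L[ℝ] Mink :=
  ContinuousLinearMap.fst ℝ (E4 [⋀^Fin 1]→L[ℝ] Mink) (E4 [⋀^Fin 1]→L[ℝ] so31)

/-- The component `A` of the fields `(e, A)`. -/
noncomputable def holstGaugeL : FibGH →L[ℝ] E4 [⋀^Fin 1]→L[ℝ] so31 :=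
  ContinuousLinearMap.snd ℝ (E4 [⋀^Fin 1]→L[ℝ] Mink) (E4 [⋀^Fin 1]→L[ℝ] so31)

/-- The Lagrangian density of generalised Holst theory on a domain. -/
noncomputable def lagGH (T : so31 →ₗ[ℝ] so31) (β : ℝ) (s : Set E4) (v : E4 → FibGH) (x : E4) :
    E4 [⋀^Fin 4]→L[ℝ] ℝ :=
  (1 / 2 : ℝ) • (wedge pairG
      (mapVal (deformInv T β) (curvature bracketG s (fun y => (v y).2) x))
      (wedge wedgeV (v x).1 (v x).1) +
    (1 / (1 + β)) • wedge eta
      (covDeriv so31.toEnd s (fun y => (v y).2) (fun y => (v y).1) x)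
      (covDeriv so31.toEnd s (fun y => (v y).2) (fun y => (v y).1) x))

/-- The tensor `τ + (1 + β)⁻¹ d_A e`, whose vanishing is the field equation of `τ`. -/
noncomputable def residTau (β : ℝ) (s : Set E4) (v : E4 → FibQgH) (x : E4) :
    E4 [⋀^Fin 2]→L[ℝ] Mink :=
  (v x).2.2 + (1 / (1 + β)) • covDeriv so31.toEnd s (fun y => (v y).2.1) (fun y => (v y).1) x

/-- The square of `residTau`. -/
noncomputable def residSq (β : ℝ) (s : Set E4) (v : E4 → FibQgH) (x : E4) :
    E4 [⋀^Fin 4]→L[ℝ] ℝ :=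
  wedge eta (residTau β s v x) (residTau β s v x)

theorem wedge_eta_comm (α γ : E4 [⋀^Fin 2]→L[ℝ] Mink) :
    (wedge eta α γ : E4 [⋀^Fin 4]→L[ℝ] ℝ) = wedge eta γ α := by
  ext v
  simp only [wedge_two_two, eta_comm (α _)]
  ring

/-- Completing the square in `τ`. -/
theorem lagQgH_eq (hβ : β ≠ -1) (v : E4 → FibQgH) :
    lagQgH T β s v x = lagGH T β s (fun y => projHolstL (v y)) x -
      ((1 + β) / 2) • residSq β s v x := by
  have h1 : 1 + β ≠ 0 := fun h => hβ (by linarith)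
  have hsymm := wedge_eta_comm
    (covDeriv so31.toEnd s (fun y => (v y).2.1) (fun y => (v y).1) x) (v x).2.2
  rw [lagQgH, lagGH, residSq, residTau]
  simp only [projHolstL_apply]
  generalize covDeriv so31.toEnd s (fun y => (v y).2.1) (fun y => (v y).1) x = D at *
  generalize (v x).2.2 = τ at *
  have h2 : (wedge eta (τ + (1 / (1 + β)) • D) (τ + (1 / (1 + β)) • D) : E4 [⋀^Fin 4]→L[ℝ] ℝ) =
      wedge eta τ τ + (2 / (1 + β)) • wedge eta τ D + (1 / (1 + β)) ^ 2 • wedge eta D D := by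
    ext w
    have := congrArg (fun f : E4 [⋀^Fin 4]→L[ℝ] ℝ => f w) hsymm
    simp only [wedge_two_two, ContinuousAlternatingMap.add_apply,
      ContinuousAlternatingMap.smul_apply, map_add, map_smul, add_apply, smul_apply,
      smul_eq_mul] at this ⊢
    linear_combination (1 / (1 + β)) * this
  rw [h2]
  generalize (wedge eta τ τ : E4 [⋀^Fin 4]→L[ℝ] ℝ) = a
  generalize (wedge eta τ D : E4 [⋀^Fin 4]→L[ℝ] ℝ) = b
  generalize (wedge eta D D : E4 [⋀^Fin 4]→L[ℝ] ℝ) = c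
  ext w
  simp only [ContinuousAlternatingMap.add_apply, ContinuousAlternatingMap.sub_apply,
    ContinuousAlternatingMap.smul_apply, smul_eq_mul]
  field_simp
  ring

theorem residTau_congr {v v' : E4 → FibQgH} (h : EqOn v v' s) (hx : x ∈ s) :
    residTau β s v x = residTau β s v' x := by
  rw [residTau, residTau, h hx,
    covDeriv_congr so31.toEnd (A' := fun y => (v' y).2.1) (σ' := fun y => (v' y).1)
      (fun y hy => by simp only [h hy]) (fun y hy => by simp only [h hy]) hx]

section Families

variable {V : ℝ → E4 → FibQgH} {w : E4 → FibQgH}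

theorem SmoothFamily.residTau (hs : IsCalcDomain s) (hV : SmoothFamily s V) :
    SmoothFamily s fun t => residTau β s (V t) := by
  have he : SmoothFamily s fun t x => (V t x).1 :=
    SmoothFamily.clm (W' := E4 [⋀^Fin 1]→L[ℝ] Mink) hV coframeL
  have hA : SmoothFamily s fun t x => (V t x).2.1 :=
    SmoothFamily.clm (W' := E4 [⋀^Fin 1]→L[ℝ] so31) hV gaugeL
  have ht : SmoothFamily s fun t x => (V t x).2.2 :=
    SmoothFamily.clm (W' := E4 [⋀^Fin 2]→L[ℝ] Mink) hV torsionL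
  exact ht.add ((hA.covDeriv hs (b := so31.toEnd) he).const_smul (1 / (1 + β)))

set_option maxRecDepth 10000 in
theorem SmoothFamily.lagGH (hs : IsCalcDomain s) {v : ℝ → E4 → FibGH} (hv : SmoothFamily s v) :
    SmoothFamily s fun t => lagGH T β s (v t) := by
  have he : SmoothFamily s fun t x => (v t x).1 :=
    SmoothFamily.clm (W' := E4 [⋀^Fin 1]→L[ℝ] Mink) hv holstCoframeL
  have hA : SmoothFamily s fun t x => (v t x).2 :=
    SmoothFamily.clm (W' := E4 [⋀^Fin 1]→L[ℝ] so31) hv holstGaugeL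
  have h1 := (hA.curvature (b := bracketG) hs).mapVal (deformInv T β)
  have h2 := h1.wedge (he.wedge he wedgeV) pairG
  have h3 := hA.covDeriv hs (b := so31.toEnd) he
  have h4 := (h3.wedge h3 eta).const_smul (1 / (1 + β))
  exact (h2.add h4).const_smul (1 / 2)

theorem HasVelocity.residTau (hs : IsCalcDomain s) (hV : SmoothFamily s V)
    (h : HasVelocity s V w t) :
    HasVelocity s (fun t x => residTau β s (V t) x) (fun x => (w x).2.2 + (1 / (1 + β)) •
      (_root_.covDeriv so31.toEnd s (fun y => (V t y).2.1) (fun y => (w y).1) x +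
        _root_.wedge so31.toEnd (w x).2.1 (V t x).1)) t := by
  have he : SmoothFamily s fun t x => (V t x).1 :=
    SmoothFamily.clm (W' := E4 [⋀^Fin 1]→L[ℝ] Mink) hV coframeL
  have he' : HasVelocity s (fun t x => (V t x).1) (fun x => (w x).1) t :=
    HasVelocity.clm (W' := E4 [⋀^Fin 1]→L[ℝ] Mink) h coframeL
  have hA' : HasVelocity s (fun t x => (V t x).2.1) (fun x => (w x).2.1) t :=
    HasVelocity.clm (W' := E4 [⋀^Fin 1]→L[ℝ] so31) h gaugeL
  have ht' : HasVelocity s (fun t x => (V t x).2.2) (fun x => (w x).2.2) t :=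
    HasVelocity.clm (W' := E4 [⋀^Fin 2]→L[ℝ] Mink) h torsionL
  exact ht'.add ((HasVelocity.covDeriv hs (b := so31.toEnd) he hA' he').const_smul (1 / (1 + β)))

theorem hasDerivAt_residSq (hs : IsCalcDomain s) (hV : SmoothFamily s V)
    (h : HasVelocity s V w t) (hx : x ∈ s) {v : E4 → FibQgH} (hv : V t = v)
    {d : E4 [⋀^Fin 2]→L[ℝ] Mink} (hd : (w x).2.2 + (1 / (1 + β)) •
      (covDeriv so31.toEnd s (fun y => (v y).2.1) (fun y => (w y).1) x +
        wedge so31.toEnd (w x).2.1 (v x).1) = d) :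
    HasDerivAt (fun t => residSq β s (V t) x)
      (wedge eta d (_root_.residTau β s v x) + wedge eta (_root_.residTau β s v x) d) t := by
  subst hv hd
  exact ((HasVelocity.residTau hs hV h).wedge (HasVelocity.residTau hs hV h) eta) x hx

end Families

variable (β) in
/-- The fields `(e, A, τ)` determined by `(e, A)`, with `τ` on shell. -/
noncomputable def holstGraphField (s : Set E4) (v : E4 → FibGH) (x : E4) : FibQgH :=
  ((v x).1, (v x).2,
    -((1 / (1 + β)) • covDeriv so31.toEnd s (fun y => (v y).2) (fun y => (v y).1) x))

variable (β) in
/-- The variation of `v` along which `residTau` is constant to first order, where `(e, A)` varies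
by `w`. -/
noncomputable def holstLiftField (s : Set E4) (w : E4 → FibGH) (v : E4 → FibQgH) (x : E4) :
    FibQgH :=
  ((w x).1, (w x).2, -((1 / (1 + β)) •
    (covDeriv so31.toEnd s (fun y => (v y).2.1) (fun y => (w y).1) x +
      wedge so31.toEnd (w x).2 (v x).1)))

theorem holstLiftField_congr {w w' : E4 → FibGH} {v v' : E4 → FibQgH} (hw : EqOn w w' s)
    (hv : EqOn v v' s) (hx : x ∈ s) :
    holstLiftField β s w v x = holstLiftField β s w' v' x := by
  rw [holstLiftField, holstLiftField, covDeriv_congr so31.toEnd (A' := fun y => (v' y).2.1)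
    (σ' := fun y => (w' y).1) (fun y hy => by simp only [hv hy])
    (fun y hy => by simp only [hw hy]) hx, hw hx, hv hx]

theorem residTau_holstGraphField (v : E4 → FibGH) :
    residTau β s (holstGraphField β s v) x = 0 :=
  neg_add_cancel ((1 / (1 + β)) • covDeriv so31.toEnd s (fun y => (v y).2) (fun y => (v y).1) x)

theorem eq_holstGraphField {v : E4 → FibQgH} (h : residTau β s v x = 0) :
    v x = holstGraphField β s (fun y => projHolstL (v y)) x :=
  Prod.ext rfl (Prod.ext rfl (eq_neg_of_add_eq_zero_left h))

theorem hasVelocity_holstGraphField (hs : IsCalcDomain s) {v : ℝ → E4 → FibGH} {w : E4 → FibGH}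
    (hv : SmoothFamily s v) (hw : HasVelocity s v w t) :
    HasVelocity s (fun t => holstGraphField β s (v t))
      (holstLiftField β s w (holstGraphField β s (v t))) t := by
  have he : SmoothFamily s fun t x => (v t x).1 :=
    SmoothFamily.clm (W' := E4 [⋀^Fin 1]→L[ℝ] Mink) hv holstCoframeL
  have he' : HasVelocity s (fun t x => (v t x).1) (fun x => (w x).1) t :=
    HasVelocity.clm (W' := E4 [⋀^Fin 1]→L[ℝ] Mink) hw holstCoframeL
  have hA' : HasVelocity s (fun t x => (v t x).2) (fun x => (w x).2) t :=
    HasVelocity.clm (W' := E4 [⋀^Fin 1]→L[ℝ] so31) hw holstGaugeL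
  have hD := (HasVelocity.covDeriv hs (b := so31.toEnd) he hA' he').const_smul (1 / (1 + β))
  exact he'.prodMk (hA'.prodMk hD.neg)

theorem smoothFamily_holstGraphField (hs : IsCalcDomain s) {v : ℝ → E4 → FibGH}
    (hv : SmoothFamily s v) : SmoothFamily s fun t => holstGraphField β s (v t) := by
  have he : SmoothFamily s fun t x => (v t x).1 :=
    SmoothFamily.clm (W' := E4 [⋀^Fin 1]→L[ℝ] Mink) hv holstCoframeL
  have hA : SmoothFamily s fun t x => (v t x).2 :=
    SmoothFamily.clm (W' := E4 [⋀^Fin 1]→L[ℝ] so31) hv holstGaugeL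
  have hD := (hA.covDeriv hs (b := so31.toEnd) he).const_smul (1 / (1 + β))
  exact he.prodMk (hA.prodMk hD.neg)

section Locality

variable {X W : Type*} [NormedAddCommGroup W] [NormedSpace ℝ W] {F : Set X} {r : X → E4 → W}

theorem localOn_holstGraphField (hs : UniqueDiffOn ℝ s) (hr : ∀ u ∈ F, ContDiffOn ℝ ∞ (r u) s)
    {v : X → E4 → FibGH} (hv : LocalOn s F r v) :
    LocalOn s F r fun u => holstGraphField β s (v u) := by
  have he : LocalOn s F r fun u x => (v u x).1 :=
    LocalOn.clm (W₂ := E4 [⋀^Fin 1]→L[ℝ] Mink) hv holstCoframeL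
  have hA : LocalOn s F r fun u x => (v u x).2 :=
    LocalOn.clm (W₂ := E4 [⋀^Fin 1]→L[ℝ] so31) hv holstGaugeL
  have hD := (LocalOn.covDeriv hs hr (b := so31.toEnd) hA he).const_smul (1 / (1 + β))
  exact he.prodMk (hA.prodMk hD.neg)

theorem localOn_holstLiftField (hs : UniqueDiffOn ℝ s) (hr : ∀ u ∈ F, ContDiffOn ℝ ∞ (r u) s)
    {w : X → E4 → FibGH} {v : X → E4 → FibQgH} (hw : LocalOn s F r w) (hv : LocalOn s F r v) :
    LocalOn s F r fun u => holstLiftField β s (w u) (v u) := by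
  have he : LocalOn s F r fun u x => (w u x).1 :=
    LocalOn.clm (W₂ := E4 [⋀^Fin 1]→L[ℝ] Mink) hw holstCoframeL
  have ha : LocalOn s F r fun u x => (w u x).2 :=
    LocalOn.clm (W₂ := E4 [⋀^Fin 1]→L[ℝ] so31) hw holstGaugeL
  have hve : LocalOn s F r fun u x => (v u x).1 :=
    LocalOn.clm (W₂ := E4 [⋀^Fin 1]→L[ℝ] Mink) hv coframeL
  have hvA : LocalOn s F r fun u x => (v u x).2.1 :=
    LocalOn.clm (W₂ := E4 [⋀^Fin 1]→L[ℝ] so31) hv gaugeL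
  have hD := ((LocalOn.covDeriv hs hr (b := so31.toEnd) hvA he).add
    (ha.wedge hve so31.toEnd)).const_smul (1 / (1 + β))
  exact he.prodMk (ha.prodMk hD.neg)

end Locality

end Local

/-! ### The field equation of `τ` -/

theorem hasDerivAt_sub_smul_iff {W : Type*} [NormedAddCommGroup W] [NormedSpace ℝ W]
    {L L' r : ℝ → W} {c : ℝ} {D d : W} (h : ∀ t, L t = L' t - c • r t) (hr : HasDerivAt r d 0) :
    HasDerivAt L' D 0 ↔ HasDerivAt L (D - c • d) 0 := by
  have h1 := hr.const_smul c
  refine ⟨fun h2 => (h2.sub h1).congr_of_eventuallyEq (Eventually.of_forall h), fun h2 => ?_⟩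
  have h3 := (h2.add h1).congr_of_eventuallyEq
    (Eventually.of_forall fun t => eq_add_of_sub_eq (h t).symm)
  rwa [sub_add_cancel] at h3

theorem hasDerivAt_iff_of_sub_smul {W : Type*} [NormedAddCommGroup W] [NormedSpace ℝ W]
    {L L' r : ℝ → W} {c : ℝ} {D : W} (h : ∀ t, L t = L' t - c • r t) (hr : HasDerivAt r 0 0) :
    HasDerivAt L' D 0 ↔ HasDerivAt L D 0 := by
  have h1 := hasDerivAt_sub_smul_iff (D := D) h hr
  rwa [smul_zero, sub_zero] at h1

theorem hasDerivAt_of_const_sub_smul {W : Type*} [NormedAddCommGroup W] [NormedSpace ℝ W]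
    {L r : ℝ → W} {c : ℝ} {l d : W} (h : ∀ t, L t = l - (c / 2) • r t)
    (hr : HasDerivAt r (d + d) 0) : HasDerivAt L (-c • d) 0 := by
  have h1 := (hasDerivAt_sub_smul_iff h hr).1 (hasDerivAt_const 0 l)
  rwa [show 0 - (c / 2) • (d + d) = -c • d by module] at h1

set_option maxRecDepth 10000 in
/-- The first variation of `lagQgH` in the direction of `τ`. -/
theorem hasDerivAt_lagQgH_torsion {s : Set E4} {x : E4} {T : so31 →ₗ[ℝ] so31} {β : ℝ}
    (hβ : β ≠ -1) (hs : IsCalcDomain s) {v : E4 → FibQgH} {θ : E4 → E4 [⋀^Fin 2]→L[ℝ] Mink}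
    (hv : ContDiffOn ℝ ∞ v s) (hθ : ContDiffOn ℝ ∞ θ s) (hx : x ∈ s)
    {L : ℝ → E4 [⋀^Fin 4]→L[ℝ] ℝ}
    (hL : ∀ t, L t = lagQgH T β s (fun y => v y + t • ((0, 0, θ y) : FibQgH)) x) :
    HasDerivAt L (-(1 + β) • wedge eta (residTau β s v x) (θ x)) 0 := by
  have hχ : ContDiffOn ℝ ∞ (fun y => ((0, 0, θ y) : FibQgH)) s :=
    contDiffOn_const.prodMk (contDiffOn_const.prodMk hθ)
  have h1 := hasDerivAt_residSq (β := β) hs (smoothFamily_line hv hχ) (hasVelocity_line _ _) hx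
    (line_zero _ _) (d := θ x) (by
      rw [covDeriv_eq_zero so31.toEnd _ hx (Eventually.of_forall fun _ => rfl),
        wedge_zero_left, add_zero, smul_zero]
      exact add_zero (θ x))
  rw [wedge_eta_comm (θ x)] at h1
  have h2 : ∀ t, L t = lagGH T β s (fun y => projHolstL (v y)) x -
      ((1 + β) / 2) • residSq β s (fun y => v y + t • ((0, 0, θ y) : FibQgH)) x := fun t => by
    rw [hL, lagQgH_eq hβ]
    have e : ∀ y, projHolstL (v y + t • ((0, 0, θ y) : FibQgH)) = projHolstL (v y) := fun y => by
      rw [map_add, map_smul]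
      exact (congrArg _ (smul_zero t)).trans (add_zero _)
    simp only [e]
  exact hasDerivAt_of_const_sub_smul h2 h1

namespace MinkowskiBundle

variable {H : Type*} [TopologicalSpace H] {I : ModelWithCorners ℝ E4 H}
  {M : Type*} [TopologicalSpace M] [ChartedSpace H M] {ι : Type*}
  {Z : MinkowskiBundle I M ι} {p q : ℕ} {T : so31 →ₗ[ℝ] so31} {β : ℝ}
  {w : Reps H M ι FibGH} {v χ : Reps H M ι FibQgH} {V : Reps H M ι FibGH → Reps H M ι FibGH}

theorem IsFormV.neg {σ : Reps H M ι (E4 [⋀^Fin p]→L[ℝ] Mink)} (h : Z.IsFormV σ) :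
    Z.IsFormV fun k x => -σ k x :=
  (h.smul (-1)).congr fun _ _ _ => ContinuousAlternatingMap.ext fun _ => (neg_one_smul ℝ _).symm

/-- The action of adjoint-valued forms on forms with values in the Minkowski bundle is tensorial. -/
theorem IsFormG.wedge_toEnd {σ : Reps H M ι (E4 [⋀^Fin p]→L[ℝ] so31)}
    {γ : Reps H M ι (E4 [⋀^Fin q]→L[ℝ] Mink)} (h : Z.IsFormG σ) (h' : Z.IsFormV γ) :
    Z.IsFormV fun k x => wedge so31.toEnd (σ k x) (γ k x) := fun k k' x hx v =>
  wedge_intertwine (Z.jac k k' x) .id (Z.glue k k' x).toLinearMap (fun u w => by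
    rw [h' k k' x hx w]
    exact DFunLike.congr_fun (h k k' x hx u) _) v

theorem projHolst_mem_fields (hv : v ∈ (qgH Z T β).fields) :
    (fun k x => projHolstL (v k x)) ∈ (gH Z T β).fields :=
  ⟨IsSmooth.clm (W' := FibGH) hv.1 projHolstL, hv.2.1, hv.2.2.1⟩

theorem projHolst_mem_variations (hv : v ∈ (qgH Z T β).variations) :
    (fun k x => projHolstL (v k x)) ∈ (gH Z T β).variations :=
  ⟨IsSmooth.clm (W' := FibGH) hv.1 projHolstL, hv.2.1, hv.2.2.1⟩

theorem secHolst_mem_variations (hw : w ∈ (gH Z T β).variations) :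
    (fun k x => secHolstL (w k x)) ∈ (qgH Z T β).variations :=
  ⟨IsSmooth.clm (W' := FibQgH) hw.1 secHolstL, hw.2.1, hw.2.2, isFormV_zero⟩

theorem graphMap₂_eqOn (w : Reps H M ι FibGH) (k : Patch H M ι) :
    EqOn (graphMap₂ Z β w k) (holstGraphField β (Z.dom k) (w k)) (Z.dom k) :=
  fun _ hx => indicator_of_mem hx _

theorem graphMap₂_mem_fields [IsManifold I ∞ M] (hw : w ∈ (gH Z T β).fields) :
    graphMap₂ Z β w ∈ (qgH Z T β).fields := by
  have he : Z.IsSmooth fun k x => (w k x).1 :=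
    IsSmooth.clm (W' := E4 [⋀^Fin 1]→L[ℝ] Mink) hw.1 holstCoframeL
  have hD := ((hw.2.2.covDeriv_toEnd (fun k => (he k).1) hw.2.1).smul (1 / (1 + β))).neg
  refine ⟨isSmooth_indicator fun k => (smoothFamily_holstGraphField (Z.isCalcDomain_dom k)
    (smoothFamily_const (hw.1 k).1)).contDiffOn 0,
    hw.2.1.congr fun k x hx => ?_, hw.2.2.congr fun k x hx => ?_, hD.congr fun k x hx => ?_⟩ <;>
  simp only [graphMap₂_eqOn w k hx, holstGraphField]

theorem proj_graphMap₂ (hw : w ∈ (gH Z T β).fields) :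
    (fun k x => projHolstL (graphMap₂ Z β w k x)) = w := by
  funext k x
  by_cases hx : x ∈ Z.dom k
  · rw [graphMap₂_eqOn w k hx]
    rfl
  · rw [graphMap₂, indicator_of_notMem hx, map_zero, (hw.1 k).2 x hx]

theorem graphMap₂_local : Z.IsLocal (gH Z T β).fields (graphMap₂ Z β) := fun k =>
  LocalOn.congr (localOn_holstGraphField (Z.isCalcDomain_dom k).uniqueDiffOn
    (fun _ hw => (hw.1 k).1) localOn_self) fun w _ _ hx => graphMap₂_eqOn w k hx

variable (Z β) in
/-- The extension of `holstLiftField` to global fields. -/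
noncomputable def liftQgH (V : Reps H M ι FibGH → Reps H M ι FibGH) (v : Reps H M ι FibQgH) :
    Reps H M ι FibQgH :=
  fun k => (Z.dom k).indicator
    (holstLiftField β (Z.dom k) (V (fun k x => projHolstL (v k x)) k) (v k))

theorem contDiffOn_holstLiftField {s : Set E4} (hs : UniqueDiffOn ℝ s) {w : E4 → FibGH}
    {v : E4 → FibQgH} (hw : ContDiffOn ℝ ∞ w s) (hv : ContDiffOn ℝ ∞ v s) :
    ContDiffOn ℝ ∞ (holstLiftField β s w v) s :=
  (localOn_holstLiftField (F := (univ : Set Unit)) (r := fun _ _ => (0 : ℝ)) hs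
    (fun _ _ => contDiffOn_const) (localOn_fixed hw) (localOn_fixed hv)).contDiffOn hs (mem_univ ())
      contDiffOn_const

theorem liftQgH_mem_variations [IsManifold I ∞ M]
    (hV : ∀ v ∈ (gH Z T β).fields, V v ∈ (gH Z T β).variations)
    (hv : v ∈ (qgH Z T β).fields) : liftQgH Z β V v ∈ (qgH Z T β).variations := by
  have hw := hV _ (projHolst_mem_fields hv)
  set w := V fun k x => projHolstL (v k x) with hwdef
  have he : Z.IsSmooth fun k x => (w k x).1 :=
    IsSmooth.clm (W' := E4 [⋀^Fin 1]→L[ℝ] Mink) hw.1 holstCoframeL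
  have hD := (((hv.2.2.1.covDeriv_toEnd (fun k => (he k).1) hw.2.1).add
    (hw.2.2.wedge_toEnd hv.2.1)).smul (1 / (1 + β))).neg
  refine ⟨isSmooth_indicator fun k => contDiffOn_holstLiftField
    (Z.isCalcDomain_dom k).uniqueDiffOn (hw.1 k).1 (hv.1 k).1,
    hw.2.1.congr fun k x hx => ?_, hw.2.2.congr fun k x hx => ?_, hD.congr fun k x hx => ?_⟩ <;>
  simp only [liftQgH, indicator_of_mem hx, holstLiftField, ← hwdef]

theorem liftQgH_local (hV' : Z.IsLocal (gH Z T β).fields V) :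
    Z.IsLocal (qgH Z T β).fields (liftQgH Z β V) := fun k => by
  have hp : Z.IsLocal (qgH Z T β).fields fun u k x => projHolstL (u k x) :=
    isLocal_clm (W := FibQgH) (W' := FibGH) _ projHolstL
  have hV1 := (hp.comp (fun u hu => hu.1) (fun u hu => projHolst_mem_fields hu) hV').localOn k
  exact LocalOn.congr (localOn_holstLiftField (Z.isCalcDomain_dom k).uniqueDiffOn
    (fun _ hu => (hu.1 k).1) hV1 localOn_self)
    fun _ _ _ hx => indicator_of_mem hx _

theorem proj_liftQgH (hV : ∀ v ∈ (gH Z T β).fields, V v ∈ (gH Z T β).variations)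
    (hv : v ∈ (qgH Z T β).fields) :
    (fun k x => projHolstL (liftQgH Z β V v k x)) = V fun k x => projHolstL (v k x) := by
  have hw := hV _ (projHolst_mem_fields hv)
  funext k x
  by_cases hx : x ∈ Z.dom k
  · rw [liftQgH, indicator_of_mem hx]
    rfl
  · rw [liftQgH, indicator_of_notMem hx, map_zero, (hw.1 k).2 x hx]

variable (β) in
/-- The variation `χ` of `v` does not change, to first order, the square of the field equation
of `τ`. -/
def ReducibleQgH (v χ : Reps H M ι FibQgH) : Prop := ∀ k, ∀ x ∈ Z.dom k,
  HasDerivAt (fun t : ℝ => residSq β (Z.dom k) (fun y => v k y + t • χ k y) x) 0 0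

theorem reducible_graphMap₂ [IsManifold I ∞ M] (hw : w ∈ (gH Z T β).fields)
    (hχ : χ ∈ (qgH Z T β).variations) :
    ReducibleQgH (Z := Z) β (graphMap₂ Z β w) χ := fun k x hx => by
  have h1 := hasDerivAt_residSq (β := β) (Z.isCalcDomain_dom k)
    (smoothFamily_line ((graphMap₂_mem_fields hw).1 k).1 (hχ.1 k).1)
    (hasVelocity_line _ _) hx (line_zero _ _) rfl
  rwa [residTau_congr (graphMap₂_eqOn w k) hx, residTau_holstGraphField,
    wedge_zero_left, wedge_zero_right, add_zero] at h1

theorem residSq_congr {s : Set E4} {x : E4} {v v' : E4 → FibQgH} (h : EqOn v v' s) (hx : x ∈ s) :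
    residSq β s v x = residSq β s v' x := by
  simp only [residSq, residTau_congr h hx]

theorem reducible_liftQgH (hV : ∀ v ∈ (gH Z T β).fields, V v ∈ (gH Z T β).variations)
    (hv : v ∈ (qgH Z T β).fields) :
    ReducibleQgH (Z := Z) β v (liftQgH Z β V v) := fun k x hx => by
  have hs := Z.isCalcDomain_dom k
  have hw := hV _ (projHolst_mem_fields hv)
  have hX := contDiffOn_holstLiftField (β := β) hs.uniqueDiffOn (hw.1 k).1 (hv.1 k).1
  have h1 := hasDerivAt_residSq (β := β) hs (smoothFamily_line (hv.1 k).1 hX)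
    (hasVelocity_line _ _) hx (line_zero _ _) (d := 0) (neg_add_cancel ((1 / (1 + β)) •
      (covDeriv so31.toEnd (Z.dom k) (fun y => (v k y).2.1)
        (fun y => (V (fun k x => projHolstL (v k x)) k y).1) x +
      wedge so31.toEnd (V (fun k x => projHolstL (v k x)) k x).2 (v k x).1)))
  rw [wedge_zero_left, wedge_zero_right, add_zero] at h1
  refine h1.congr_of_eventuallyEq (Eventually.of_forall fun t => ?_)
  have e : EqOn (fun y => v k y + t • liftQgH Z β V v k y)
      (fun y => v k y + t • holstLiftField β (Z.dom k)
        (V (fun k x => projHolstL (v k x)) k) (v k) y) (Z.dom k) := fun y hy => by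
    simp only [liftQgH, indicator_of_mem hy]
  exact residSq_congr e hx

set_option maxRecDepth 10000 in
theorem hasDerivAt_gH_iff (hβ : β ≠ -1) (hr : ReducibleQgH (Z := Z) β v χ) {k : Patch H M ι}
    {x : E4} (hx : x ∈ Z.dom k) (D : E4 [⋀^Fin 4]→L[ℝ] ℝ) {L L' : ℝ → E4 [⋀^Fin 4]→L[ℝ] ℝ}
    (hL' : ∀ t, L' t = lagGH T β (Z.dom k)
      (fun y => projHolstL (v k y) + t • projHolstL (χ k y)) x)
    (hL : ∀ t, L t = lagQgH T β (Z.dom k) (fun y => v k y + t • χ k y) x) :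
    HasDerivAt L' D 0 ↔ HasDerivAt L D 0 := by
  have h2 : ∀ t, L t = L' t -
      ((1 + β) / 2) • residSq β (Z.dom k) (fun y => v k y + t • χ k y) x := fun t => by
    rw [hL, hL', lagQgH_eq hβ]
    simp only [map_add, map_smul]
  exact hasDerivAt_iff_of_sub_smul h2 (hr k x hx)

/-- The field equation of `τ`, in weak form. -/
theorem integral_residTau_eq_zero [IsManifold I ∞ M] (hβ : β ≠ -1)
    (hv : v ∈ (qgH Z T β).criticalLocus) {θ : Reps H M ι (E4 [⋀^Fin 2]→L[ℝ] Mink)}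
    (hθ : Z.IsSmooth θ) (hθ' : Z.IsFormV θ) {k : Patch H M ι} {K : Set E4} (hK : IsCompact K)
    (hKs : K ⊆ interior (Z.dom k)) (hθK : Z.SupportedIn k K θ) :
    ∫ x in Z.dom k, (wedge eta (residTau β (Z.dom k) (v k) x) (θ k x) :
      E4 [⋀^Fin 4]→L[ℝ] ℝ) frame = 0 := by
  have h1 : -(1 + β) ≠ 0 := fun h => hβ (by linarith)
  exact FieldTheory.integral_eq_zero_of_hasDerivAt hv (χ := fun k x => (0, 0, θ k x))
    ⟨isSmooth_zero.prodMk (isSmooth_zero.prodMk hθ), isFormV_zero, isFormG_zero, hθ'⟩ hK hKs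
    (fun k' y hy hyK => by
      simp only [hθK k' y hy hyK]
      rfl) h1 fun x hx => hasDerivAt_lagQgH_torsion (T := T) hβ (Z.isCalcDomain_dom k)
        (hv.1.1 k).1 (hθ k).1 hx fun t => by
          simp only [qgH, lagQgH, Pi.add_apply, Pi.smul_apply]

theorem residTau_eq_zero [IsManifold I ∞ M] [T2Space M] (hβ : β ≠ -1)
    (hv : v ∈ (qgH Z T β).criticalLocus) {k : Patch H M ι} {x : E4} (hx : x ∈ Z.dom k) :
    residTau β (Z.dom k) (v k) x = 0 := by
  have hr := (smoothFamily_const (hv.1.1 k).1).residTau (β := β) (Z.isCalcDomain_dom k)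
  have h1 : ∀ γ : E4 [⋀^Fin 2]→L[ℝ] Mink, (wedge eta (residTau β (Z.dom k) (v k) x) γ :
      E4 [⋀^Fin 4]→L[ℝ] ℝ) frame = 0 := fun γ => by
    refine eqOn_zero_of_forall_integral_eq_zero (Z.isCalcDomain_dom k)
      (f := fun x => (wedge eta (residTau β (Z.dom k) (v k) x) γ : E4 [⋀^Fin 4]→L[ℝ] ℝ) frame)
      (continuousOn_form_frame
        ((hr.wedge (smoothFamily_const (contDiffOn_const (c := γ))) eta).contDiffOn 0))
      (fun φ h1 h2 h3 => ?_) x hx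
    rw [← integral_residTau_eq_zero hβ hv (isSmooth_bumpSection Z h1 h2 (h3.trans interior_subset))
      (isFormV_bumpSection Z (w := γ)) h2 h3 (supportedIn_bumpSection Z subset_rfl)]
    refine setIntegral_congr_fun (Z.measurableSet_dom k) fun y hy => ?_
    have := wedge_smul_smul eta 1 (φ y) (residTau β (Z.dom k) (v k) y) γ
    rw [one_smul, one_mul] at this
    simp only [bumpSection_self Z hy]
    exact (congrArg (fun α : E4 [⋀^Fin 4]→L[ℝ] ℝ => α frame) this).symm
  exact two_form_eq_zero_of_forall_wedge eta eta_nondegenerate _ h1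

theorem exists_graphMap₂ [IsManifold I ∞ M] [T2Space M] (hβ : β ≠ -1)
    (hv : v ∈ (qgH Z T β).criticalLocus) :
    v = graphMap₂ Z β fun k x => projHolstL (v k x) := by
  funext k x
  by_cases hx : x ∈ Z.dom k
  · rw [graphMap₂_eqOn _ k hx]
    exact eq_holstGraphField (residTau_eq_zero hβ hv hx)
  · rw [graphMap₂, indicator_of_notMem hx, (hv.1.1 k).2 x hx]

end MinkowskiBundle

/-! ### Quadratic Holst theory as an extension of Holst theory -/

namespace MinkowskiBundle

variable {H : Type*} [TopologicalSpace H] {I : ModelWithCorners ℝ E4 H}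
  {M : Type*} [TopologicalSpace M] [ChartedSpace H M] {ι : Type*}
  {Z : MinkowskiBundle I M ι} {T : so31 →ₗ[ℝ] so31} {β : ℝ}
  {V : Reps H M ι FibGH → Reps H M ι FibGH}

theorem differentiable_gH {v χ : Reps H M ι FibGH} (hv : v ∈ (gH Z T β).fields)
    (hχ : χ ∈ (gH Z T β).variations) {k : Patch H M ι} {x : E4} (hx : x ∈ Z.dom k)
    {L : ℝ → E4 [⋀^Fin 4]→L[ℝ] ℝ}
    (hL : ∀ t, L t = lagGH T β (Z.dom k) (fun y => v k y + t • χ k y) x) :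
    DifferentiableAt ℝ L 0 := by
  rw [funext hL]
  exact (SmoothFamily.lagGH (Z.isCalcDomain_dom k)
    (smoothFamily_line (hv.1 k).1 (hχ.1 k).1)).differentiableAt hx 0

theorem path_smooth_graphMap₂ {γ : ℝ → Reps H M ι FibGH} {k : Patch H M ι}
    (hγ : SmoothFamily (Z.dom k) fun t => γ t k) :
    SmoothFamily (Z.dom k) fun t => graphMap₂ Z β (γ t) k :=
  ContDiffOn.congr (smoothFamily_holstGraphField (Z.isCalcDomain_dom k) hγ)
    fun q hq => graphMap₂_eqOn (γ q.1) k hq.2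

theorem path_velocity_graphMap₂ {γ : ℝ → Reps H M ι FibGH}
    (hγf : ∀ t, γ t ∈ (gH Z T β).fields) {k : Patch H M ι}
    (hγ : SmoothFamily (Z.dom k) fun t => γ t k) {s : ℝ}
    (hv : HasVelocity (Z.dom k) (fun t => γ t k) (V (γ s) k) s) :
    HasVelocity (Z.dom k) (fun t => graphMap₂ Z β (γ t) k)
      (liftQgH Z β V (graphMap₂ Z β (γ s)) k) s := by
  have h1 := hasVelocity_holstGraphField (β := β) (Z.isCalcDomain_dom k) hγ hv
  refine (h1.congr fun x hx => ?_).congr_family fun t x hx => graphMap₂_eqOn (γ t) k hx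
  rw [liftQgH, indicator_of_mem hx, proj_graphMap₂ (hγf s)]
  exact holstLiftField_congr (eqOn_refl _ _) (graphMap₂_eqOn (γ s) k).symm hx

end MinkowskiBundle

namespace FieldTheory

open MinkowskiBundle

variable {H : Type*} [TopologicalSpace H] {I : ModelWithCorners ℝ E4 H}
  {M : Type*} [TopologicalSpace M] [ChartedSpace H M] {ι : Type*}
  {Z : MinkowskiBundle I M ι} {T : so31 →ₗ[ℝ] so31} {β : ℝ}

set_option maxRecDepth 10000 in
/-- The elimination of `τ`, which is determined on shell: there are no parameters. -/
noncomputable def reductionQgH [IsManifold I ∞ M] [T2Space M] (hβ : β ≠ -1) :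
    Reduction (qgH Z T β) (gH Z T β) PUnit.{1} where
  proj := projHolstL
  sec := secHolstL
  params := univ
  graph _ := graphMap₂ Z β
  lift _ := liftQgH Z β
  sign := 1
  bdry _ _ _ _ := 0
  Reducible := ReducibleQgH (Z := Z) β
  proj_sec _ := rfl
  sign_ne_zero := one_ne_zero
  isSmooth_fields _ hu := hu.1
  isSmooth_fields' _ hv := hv.1
  proj_fields _ := projHolst_mem_fields
  proj_variations _ := projHolst_mem_variations
  sec_variations _ := secHolst_mem_variations
  zero_variations := ⟨isSmooth_zero, isFormV_zero, isFormG_zero⟩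
  zero_params := mem_univ _
  smul_params _ _ _ := mem_univ _
  graph_fields _ _ _ hv := graphMap₂_mem_fields hv
  proj_graph _ _ _ hv := proj_graphMap₂ hv
  graph_local _ _ := graphMap₂_local
  exists_graph _ hu := ⟨0, mem_univ _, exists_graphMap₂ hβ hu⟩
  reducible_graph _ _ _ hv _ hχ := reducible_graphMap₂ hv hχ
  variation _ _ _ _ hr _ _ hx D := by
    rw [one_smul, extDerivWithin_eq_zero (fun _ _ => rfl) hx, sub_zero]
    exact hasDerivAt_gH_iff (T := T) hβ hr hx D (fun t => by
      simp only [gH, lagGH, Pi.add_apply, Pi.smul_apply]) (fun t => by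
      simp only [qgH, lagQgH, Pi.add_apply, Pi.smul_apply])
  differentiable _ hv _ hχ _ _ hx := differentiable_gH hv hχ hx fun t => by
    simp only [gH, lagGH, Pi.add_apply, Pi.smul_apply]
  bdry_isForm _ _ _ _ _ _ _ _ _ := rfl
  bdry_contDiffOn _ _ _ _ _ := contDiffOn_const
  bdry_eq_zero _ _ _ _ _ _ _ _ _ _ _ := rfl
  bdry_local _ _ _ _ := localOn_fixed (σ := fun _ => 0) contDiffOn_const
  lift_variations _ _ _ hV _ hu := liftQgH_mem_variations hV hu
  lift_local _ _ _ _ hV' := liftQgH_local hV'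
  proj_lift _ _ _ hV _ hu := proj_liftQgH hV hu
  reducible_lift _ _ _ hV _ hu := reducible_liftQgH hV hu
  path_smooth _ _ _ _ hγ k := path_smooth_graphMap₂ (hγ k)
  path_velocity _ _ _ hγf hγ _ _ _ hv k := path_velocity_graphMap₂ hγf (hγ k) (hv k)

end FieldTheory

/-! ### Pull-back of the Lagrangian densities and actions -/

namespace FieldTheory

open MinkowskiBundle

variable {H : Type*} [TopologicalSpace H] {I : ModelWithCorners ℝ E4 H}
  {M : Type*} [TopologicalSpace M] [ChartedSpace H M] {ι : Type*}
  {Z : MinkowskiBundle I M ι} {T : so31 →ₗ[ℝ] so31} {β : ℝ}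
  {W : Type*} [NormedAddCommGroup W] [NormedSpace ℝ W]
  {W' : Type*} [NormedAddCommGroup W'] [NormedSpace ℝ W']

theorem graphQeGR_zero (v : Reps H M ι FibQgH) : graphQeGR Z T β 0 v = graphMap₁ Z T β v := by
  funext k
  refine indicator_congr fun x hx => ?_
  have h0 : covDeriv coad (Z.dom k) (fun y => (v k y).2.1)
      ((0 : Reps H M ι (E4 [⋀^Fin 1]→L[ℝ] so31Dual)) k) x = 0 :=
    covDeriv_eq_zero coad _ hx (Eventually.of_forall fun _ => rfl)
  have h1 : mapVal (deformInvDual T β) ((1 / 2 : ℝ) • wedge wedgeV (v k x).1 (v k x).1) =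
      (1 / 2 : ℝ) • mapVal (deformInvDual T β) (wedge wedgeV (v k x).1 (v k x).1) :=
    (mapValL (deformInvDual T β) 2).map_smul _ _
  rw [graphField, h0, zero_add, h1]
  rfl

theorem map_reductionQeGR [IsManifold I ∞ M] [T2Space M] (hT : AdEquivariant T)
    (h : IsUnit (deform T β)) :
    (reductionQeGR (Z := Z) hT h).map = forget₁ := rfl

/-- Without the component `S` there is no exact term. -/
theorem lagQeGR_eq_neg (hT : AdEquivariant T) (h : IsUnit (deform T β)) {s : Set E4} {x : E4}
    (hs : IsCalcDomain s) {U : E4 → FibQeGR} (hU : ContDiffOn ℝ ∞ U s) (hx : x ∈ s)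
    (h0 : ∀ y ∈ s, compGDual (U y).1 = 0) (hC : residC T β s U x = 0) :
    lagQeGR T β s U x = -lagQgH T β s (fun y => projL (U y)) x := by
  rw [lagQeGR_eq hT h hs hU hx, residPair, hC, mapVal_zero, wedge_zero_left,
    extDerivWithin_eq_zero (fun y hy => ?_) hx, sub_zero, zero_sub]
  rw [h0 y hy, wedge_zero_right]

theorem lagrangian_qeGR (u : Reps H M ι FibQeGR) (k : Patch H M ι) (x : E4) :
    (qeGR Z T β).lagrangian u k x = lagQeGR T β (Z.dom k) (u k) x := by
  simp only [qeGR, lagQeGR]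

theorem lagrangian_qgH (v : Reps H M ι FibQgH) (k : Patch H M ι) (x : E4) :
    (qgH Z T β).lagrangian v k x = lagQgH T β (Z.dom k) (v k) x := by
  simp only [qgH, lagQgH]

theorem lagrangian_graphMap₁ (hT : AdEquivariant T) (h : IsUnit (deform T β))
    {v : Reps H M ι FibQgH} (hv : v ∈ (qgH Z T β).fields) {k : Patch H M ι} {x : E4}
    (hx : x ∈ Z.dom k) :
    (qeGR Z T β).lagrangian (graphMap₁ Z T β v) k x = -(qgH Z T β).lagrangian v k x := by
  have hs := Z.isCalcDomain_dom k
  have h0 : SmoothFamily (Z.dom k) fun _ : ℝ =>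
      (0 : Reps H M ι (E4 [⋀^Fin 1]→L[ℝ] so31Dual)) k := smoothFamily_const contDiffOn_const
  have hU := (smoothFamily_graphField (T := T) (β := β) hs h0
    (smoothFamily_const (hv.1 k).1)).contDiffOn 0
  have e : EqOn (graphMap₁ Z T β v k)
      (graphField T β (Z.dom k) ((0 : Reps H M ι (E4 [⋀^Fin 1]→L[ℝ] so31Dual)) k) (v k))
      (Z.dom k) := fun y hy => by
    rw [← graphQeGR_zero, graphQeGR, indicator_of_mem hy]
  have h1 := lagQeGR_eq_neg hT h hs hU hx (fun y _ => by rw [graphField, compGDual_prod]; rfl)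
    (residC_graphField _ _)
  have h2 : (fun y => projL (graphField T β (Z.dom k)
      ((0 : Reps H M ι (E4 [⋀^Fin 1]→L[ℝ] so31Dual)) k) (v k) y)) = v k := funext fun y => by
    rw [graphField, projL_apply, compV_prod, compG_prod, compV_prod]
  rw [lagrangian_qeGR, lagrangian_qgH, lagQeGR_congr e hx, h1, h2]

theorem lagrangian_gH (v : Reps H M ι FibGH) (k : Patch H M ι) (x : E4) :
    (gH Z T β).lagrangian v k x = lagGH T β (Z.dom k) (v k) x := by
  simp only [gH, lagGH]

theorem lagrangian_graphMap₂ (hβ : β ≠ -1) {v : Reps H M ι FibGH} {k : Patch H M ι} {x : E4}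
    (hx : x ∈ Z.dom k) :
    (qgH Z T β).lagrangian (graphMap₂ Z β v) k x = (gH Z T β).lagrangian v k x := by
  have h1 := lagQgH_eq (T := T) (s := Z.dom k) (x := x) hβ (holstGraphField β (Z.dom k) (v k))
  rw [residSq, residTau_holstGraphField, wedge_zero_left, smul_zero, sub_zero] at h1
  rw [lagrangian_qgH, lagrangian_gH, lagQgH_congr (graphMap₂_eqOn v k) hx, h1]
  rfl

theorem action_congr {𝒯 : FieldTheory Z W} {𝒯' : FieldTheory Z W'}
    (ρ : SmoothPartitionOfUnity (Patch H M ι) I M) {u : Reps H M ι W} {v : Reps H M ι W'}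
    (h : ∀ k, ∀ x ∈ Z.dom k, 𝒯.lagrangian u k x = 𝒯'.lagrangian v k x) :
    𝒯.action ρ u = 𝒯'.action ρ v :=
  finsum_congr fun k => setIntegral_congr_fun (Z.measurableSet_dom k) fun x hx => by
    simp only [h k x hx]

theorem action_eq_neg {𝒯 : FieldTheory Z W} {𝒯' : FieldTheory Z W'}
    (ρ : SmoothPartitionOfUnity (Patch H M ι) I M) {u : Reps H M ι W} {v : Reps H M ι W'}
    (h : ∀ k, ∀ x ∈ Z.dom k, 𝒯.lagrangian u k x = -𝒯'.lagrangian v k x) :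
    𝒯.action ρ u = -𝒯'.action ρ v := by
  rw [action, action, ← finsum_neg_distrib]
  refine finsum_congr fun k => ?_
  rw [← integral_neg]
  refine setIntegral_congr_fun (Z.measurableSet_dom k) fun x hx => ?_
  simp only [h k x hx, ContinuousAlternatingMap.neg_apply, mul_neg]

end FieldTheory

theorem mainTheorem6 {H : Type*} [TopologicalSpace H] (I : ModelWithCorners ℝ E4 H)
    {M : Type*} [TopologicalSpace M] [ChartedSpace H M] [IsManifold I ∞ M]
    [T2Space M] [CompactSpace M] (hM : IsOrientedAtlas I M)
    {ι : Type*} (Z : MinkowskiBundle I M ι)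
    (β : ℝ) (T : so31 ≃ₗ⁅ℝ,so31⁆ so31)
    (hT : β • (T : so31 →ₗ[ℝ] so31) ≠ -LinearMap.id) :
    -- in the invertibility sector, `id + β T` is invertible
    IsUnit (deform (T : so31 →ₗ[ℝ] so31) β) ∧
    -- qeGR is classically equivalent to qgH, through the graph map `F₁`
    FieldTheory.IsClassicalEquivalence (qeGR Z (T : so31 →ₗ[ℝ] so31) β)
      (qgH Z (T : so31 →ₗ[ℝ] so31) β) forget₁ (graphMap₁ Z (T : so31 →ₗ[ℝ] so31) β) ∧
    -- `F₁^* S_qeGR = - S_qgH`, already for the Lagrangian densities (no boundary terms)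
    (∀ u ∈ (qgH Z (T : so31 →ₗ[ℝ] so31) β).fields,
      (∀ k, ∀ x ∈ Z.dom k,
        (qeGR Z (T : so31 →ₗ[ℝ] so31) β).lagrangian
            (graphMap₁ Z (T : so31 →ₗ[ℝ] so31) β u) k x =
          -(qgH Z (T : so31 →ₗ[ℝ] so31) β).lagrangian u k x) ∧
      ∀ ρ : SmoothPartitionOfUnity (Patch H M ι) I M, ρ.IsSubordinate Z.region →
        (qeGR Z (T : so31 →ₗ[ℝ] so31) β).action ρ (graphMap₁ Z (T : so31 →ₗ[ℝ] so31) β u) =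
          -(qgH Z (T : so31 →ₗ[ℝ] so31) β).action ρ u) ∧
    (β ≠ -1 →
      -- qgH is classically equivalent to gH, through the graph map `F₂`
      FieldTheory.IsClassicalEquivalence (qgH Z (T : so31 →ₗ[ℝ] so31) β)
        (gH Z (T : so31 →ₗ[ℝ] so31) β) forget₂ (graphMap₂ Z β) ∧
      -- `F₂^* S_qgH = S_gH`, already for the Lagrangian densities
      (∀ u ∈ (gH Z (T : so31 →ₗ[ℝ] so31) β).fields,
        (∀ k, ∀ x ∈ Z.dom k,
          (qgH Z (T : so31 →ₗ[ℝ] so31) β).lagrangian (graphMap₂ Z β u) k x =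
            (gH Z (T : so31 →ₗ[ℝ] so31) β).lagrangian u k x) ∧
        ∀ ρ : SmoothPartitionOfUnity (Patch H M ι) I M, ρ.IsSubordinate Z.region →
          (qgH Z (T : so31 →ₗ[ℝ] so31) β).action ρ (graphMap₂ Z β u) =
            (gH Z (T : so31 →ₗ[ℝ] so31) β).action ρ u)) := by
  have hT' : AdEquivariant (T : so31 →ₗ[ℝ] so31) := fun X Y =>
    LieModuleHom.map_lie (T : so31 →ₗ⁅ℝ,so31⁆ so31) X Y
  have h := hT'.isUnit_deform hT
  refine ⟨h, ?_, fun u hu => ?_, fun hβ => ⟨?_, fun u hu => ?_⟩⟩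
  · have h1 := (FieldTheory.reductionQeGR (Z := Z) hT' h).isClassicalEquivalence
    rw [FieldTheory.map_reductionQeGR] at h1
    convert h1 using 1
    exact funext fun v => (FieldTheory.graphQeGR_zero v).symm
  · have h1 := fun k x (hx : x ∈ Z.dom k) => FieldTheory.lagrangian_graphMap₁ hT' h hu hx
    exact ⟨h1, fun ρ _ => FieldTheory.action_eq_neg ρ h1⟩
  · exact (FieldTheory.reductionQgH (Z := Z) hβ).isClassicalEquivalence
  · have h1 := fun k x (hx : x ∈ Z.dom k) =>
      FieldTheory.lagrangian_graphMap₂ (T := (T : so31 →ₗ[ℝ] so31)) (v := u) hβ hx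
    exact ⟨h1, fun ρ _ => FieldTheory.action_congr ρ h1⟩
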